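/- **Setting.** A $d$-dimensional *MDP* ($d\ge 1$) $G$ consists of a finite set of states $S$, partitioned into Controller states $S^C$ and Random states $S^R$, a set of edges $E\subseteq S\times S$ such that every state has a successor, integer weight vectors $w(s,t)\in\mathbb Z^d$ for $(s,t)\in E$, and for each $s\in S^R$ a probability distribution $R(s)$ with rational values whose support is exactly the set of successors of $s$. A *play* is an infinite path $\pi=s_0s_1\cdots$; its mean payoff is the vector $\mathrm{MP}(\pi)=\liminf_{n}\frac1n\sum_{k<n}w(s_k,s_{k+1})$ (componentwise). Vector inequalities are componentwise; in particular $>$ is strict in every component. A *strategy* is a stochastic Moore machine $f=(M,\alpha,f_u,f_o)$ with a (possibly infinite) set of memory states $M$, an initial distribution $\alpha$ on $M$, an update function $f_u:S\times M\to\mathcal D(M)$ and an output function $f_o:S^C\times M\to\mathcal D(S)$, with $f_o(s,m)$ supported on the successors of $s$; $\mathcal D(A)$ is the set of probability distributions on $A$ with rational values. It is *finite-memory* if $M$ is finite. Put $f_u^*(\varepsilon)=\alpha$, $f_u^*(\rho s)(m')=\sum_m f_u^*(\rho)(m)f_u(s,m)(m')$ and $f_o^*(\rho s)(s')=\sum_m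 f_u^*(\rho)(m)f_o(s,m)(s')$. The *outcomes* of $f$ from $s_0$ are the plays $s_0s_1\cdots$ such that $s_{i+1}$ is in the support of $f_o^*(s_0\cdots s_i)$ whenever $s_i\in S^C$. The expectation $\mathbb E_{s_0,f}$ is taken in the induced Markov chain on $S\times M$, started in $(s_0,m)$ with $m$ drawn from $\alpha$, in which $(s,m)$ moves to $(s',m')$ with probability $f_o(s,m)(s')f_u(s,m)(m')$ if $s\in S^C$ and $R(s)(s')f_u(s,m)(m')$ if $s\in S^R$. The strategy $f$ *achieves the beyond worst-case (BWC) threshold* $(\vec\mu;\vec\nu)$ from $s_0$ if $\mathrm{MP}(\pi)>\vec\mu$ for every outcome $\pi$ of $f$ from $s_0$, and $\mathbb E_{s_0,f}[\mathrm{MP}]>\vec\nu$. The MDP is *pruned* if from every state some strategy achieves $(\vec 0;\vec 0)$. An *end-component* (EC) is a non-empty set $U\subseteq S$ such that the graph induced on $U$ is strongly connected and all successors of Random states of $U$ lie in $U$. It is *winning* (a WEC) if from every $s\in U$ Controller has a strategy all of whose outcomes stay in $U$ and have mean payoff $>\vec 0$. A *MWEC* is a WEC not strictly contained in another WEC. **Linear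 system $T$.** For a state $s_0$ and $\vec\nu\in\mathbb R^d$, the system has real variables $y_s$ ($s\in S$) and $y_{st},x_{st}$ ($(s,t)\in E$), and the constraints - (A1) $1_{s_0}(s)+\sum_{(r,s)\in E}y_{rs}=\sum_{(s,t)\in E}y_{st}+y_s$ for all $s\in S$; - (A1') $y_{st}=R(s)(t)\cdot\bigl(\sum_{(r,s)\in E}y_{rs}-y_s\bigr)$ for all $(s,t)\in E$ with $s\in S^R$; - (A2) $\sum_{\text{MWEC }U}\sum_{s\in U}y_s=1$; - (B) $\sum_{s\in U}y_s=\sum_{(r,s)\in E\cap U\times U}x_{rs}$ for every MWEC $U$; - (B') $x_{st}=0$ for every $(s,t)\in E$ that is not contained in $U\times U$ for some MWEC $U$; - (C1) $\sum_{(r,s)\in E}x_{rs}=\sum_{(s,t)\in E}x_{st}$ for all $s\in S$; - (C1') $x_{st}=R(s)(t)\cdot\sum_{(r,s)\in E}x_{rs}$ for all $(s,t)\in E$ with $s\in S^R$; - (C2) $\sum_{(s,t)\in E}x_{st}\,w(s,t)[i]>\vec\nu[i]$ for all $1\le i\le d$; - (C3) $\sum_{(s,t)\in E\cap U\times U}x_{st}\,w(s,t)[i]>0$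 for every MWEC $U$ and all $1\le i\le d$. **Lemma.** Let $G$ be a pruned MDP, let $s_0\in S^C$ be such that every WEC contains a state reachable from $s_0$ in the graph of $G$, and let $\vec\nu\in\mathbb R^d$ with $\vec\nu\ge\vec 0$. There exists a finite-memory strategy achieving the BWC threshold $(\vec 0;\vec\nu)$ from $s_0$ if, and only if, the system $T$ has a solution in non-negative real numbers. -/

import Mathlib

open MeasureTheory ProbabilityTheory

/-- All values of the probability distribution `p` are rational numbers. -/
def PMF.IsRational {A : Type*} (p : PMF A) : Prop :=
  ∀ a, ∃ q : ℚ, (p a).toReal = q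

/-- A `d`-dimensional multi-weighted Markov decision process with finite state space `S`.
Only the weights `w s t` of edges `E s t` are ever used. -/
structure MDP (S : Type*) [Fintype S] (d : ℕ) where
  /-- the dimension is positive -/
  one_le_dim : 1 ≤ d
  /-- the directed edges -/
  E : S → S → Prop
  /-- every state has a successor -/
  exists_succ : ∀ s, ∃ t, E s t
  /-- the weight vector of an edge -/
  w : S → S → Fin d → ℤ
  /-- the states of Controller; all the others are the states of Random -/
  ctrl : Set S
  /-- the distribution over successors at a state of Random -/
  R : (s : S) → s ∉ ctrl → PMF S
  R_rational : ∀ s hs, (R s hs).IsRational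
  R_support : ∀ s hs t, t ∈ (R s hs).support ↔ E s t

namespace MDP

variable {S : Type*} [Fintype S] {d : ℕ}

/-! ### Plays and payoffs -/

/-- `π` is a play: an infinite path in the graph. -/
def IsPlay (G : MDP S d) (π : ℕ → S) : Prop :=
  ∀ n, G.E (π n) (π (n + 1))

/-- Component `i` of the total payoff up to length `n`. -/
def totalPayoff (G : MDP S d) (n : ℕ) (π : ℕ → S) (i : Fin d) : ℝ :=
  ∑ k ∈ Finset.range n, (G.w (π k) (π (k + 1)) i : ℝ)

/-- Component `i` of the lim-inf mean payoff. The averages are bounded because there are finitely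
many weights, so that this lim-inf is the genuine one. -/
noncomputable def meanPayoff (G : MDP S d) (π : ℕ → S) (i : Fin d) : ℝ :=
  Filter.liminf (fun n : ℕ => G.totalPayoff n π i / n) Filter.atTop

/-! ### Strategies -/

/-- A strategy of Controller, as a stochastic Moore machine with an arbitrary (possibly infinite)
set `Mem` of memory states. -/
structure Strategy (G : MDP S d) where
  Mem : Type
  /-- the initial memory distribution -/
  init : PMF Mem
  /-- the stochastic memory update -/
  upd : S → Mem → PMF Mem
  /-- the stochastic output -/
  out : (s : S) → s ∈ G.ctrl → Mem → PMF S
  init_rational : init.IsRational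
  upd_rational : ∀ s m, (upd s m).IsRational
  out_rational : ∀ s hs m, (out s hs m).IsRational
  out_support : ∀ s hs m t, t ∈ (out s hs m).support → G.E s t

namespace Strategy

variable {G : MDP S d}

/-- A strategy is finite-memory if its set of memory states is finite. -/
def IsFiniteMemory (f : G.Strategy) : Prop := Finite f.Mem

/-- The update function extended to finite sequences of states. -/
noncomputable def updSeq (f : G.Strategy) (l : List S) : PMF f.Mem :=
  l.foldl (fun μ s => μ.bind (f.upd s)) f.init

/-- The output function extended to finite sequences of states `l ++ [s]`
that end in a state `s` of Controller. -/
noncomputable def outSeq (f : G.Strategy) (l : List S) (s : S) (hs : s ∈ G.ctrl) : PMF S :=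
  (f.updSeq l).bind (f.out s hs)

/-- The play `π` is consistent with `f`. -/
def Consistent (f : G.Strategy) (π : ℕ → S) : Prop :=
  ∀ (n : ℕ) (hn : π n ∈ G.ctrl),
    π (n + 1) ∈ (f.outSeq ((List.range n).map π) (π n) hn).support

/-- The outcomes of `f` from `s₀`: the plays that start in `s₀` and are consistent with `f`. -/
def Outcome (f : G.Strategy) (s₀ : S) : Set (ℕ → S) :=
  {π | π 0 = s₀ ∧ G.IsPlay π ∧ f.Consistent π}

/-! ### The induced Markov chain -/

/-- A state of the Markov chain induced by `f`: a state of the MDP with a memory state. -/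
structure Conf (f : G.Strategy) where
  state : S
  mem : f.Mem

/-- The discrete σ-algebra on the states of the induced chain. -/
instance (f : G.Strategy) : MeasurableSpace f.Conf := ⊤

open Classical in
/-- The distribution of the next state of the MDP at a state of the induced chain. -/
noncomputable def next (f : G.Strategy) (c : f.Conf) : PMF S :=
  if h : c.state ∈ G.ctrl then f.out c.state h c.mem else G.R c.state h

/-- The transition distribution of the induced chain: the next state of the MDP and the next
memory state are chosen independently. -/
noncomputable def step (f : G.Strategy) (c : f.Conf) : PMF f.Conf :=
  (f.next c).bind fun s' => (f.upd c.state c.mem).map fun m' => ⟨s', m'⟩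

/-- The transition kernel of the induced chain. -/
noncomputable def stepKernel (f : G.Strategy) : Kernel f.Conf f.Conf where
  toFun c := (f.step c).toMeasure
  measurable' := measurable_from_top

instance (f : G.Strategy) : IsMarkovKernel f.stepKernel :=
  ⟨fun c => PMF.toMeasure.isProbabilityMeasure (f.step c)⟩

/-- The same transition as a kernel from histories of length `n + 1`;
it looks only at the current state of the chain. -/
noncomputable def histKernel (f : G.Strategy) (n : ℕ) :
    Kernel ((_i : Finset.Iic n) → f.Conf) f.Conf :=
  f.stepKernel.comap (fun h => h ⟨n, Finset.mem_Iic.2 le_rfl⟩) (measurable_pi_apply _)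

instance (f : G.Strategy) (n : ℕ) : IsMarkovKernel (f.histKernel n) := by
  unfold histKernel; infer_instance

/-- The probability measure on the infinite paths of the induced Markov chain, started in `s₀`
with a memory state drawn from the initial memory distribution. -/
noncomputable def pathMeasure (f : G.Strategy) (s₀ : S) : Measure (ℕ → f.Conf) :=
  Kernel.trajMeasure (X := fun _ => f.Conf) (f.init.map fun m => (⟨s₀, m⟩ : f.Conf)).toMeasure
    f.histKernel

/-- Component `i` of the expected mean payoff of `f` from `s₀`. -/
noncomputable def expMeanPayoff (f : G.Strategy) (s₀ : S) (i : Fin d) : ℝ :=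
  ∫ ρ, G.meanPayoff (fun n => (ρ n).state) i ∂(f.pathMeasure s₀)

/-! ### Objectives -/

/-- The expected-value achievable solutions of `f`. -/
def ExpSol (f : G.Strategy) (s₀ : S) : Set (Fin d → ℝ) :=
  {ν | ∀ i, ν i < f.expMeanPayoff s₀ i}

/-- The worst-case achievable solutions of `f`. -/
def WCSol (f : G.Strategy) (s₀ : S) : Set (Fin d → ℝ) :=
  {μ | ∀ π ∈ f.Outcome s₀, ∀ i, μ i < G.meanPayoff π i}

/-- The beyond worst-case achievable solutions of `f`. -/
def BWCSol (f : G.Strategy) (s₀ : S) : Set ((Fin d → ℝ) × (Fin d → ℝ)) :=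
  {p | p.1 ∈ f.WCSol s₀ ∧ p.2 ∈ f.ExpSol s₀}

end Strategy

/-- `G` is pruned: from every state, Controller has a strategy for the threshold `(0; 0)`. -/
def IsPruned (G : MDP S d) : Prop :=
  ∀ s, ∃ f : G.Strategy, ((0, 0) : (Fin d → ℝ) × (Fin d → ℝ)) ∈ f.BWCSol s

/-! ### End-components -/

/-- `U` is an end-component: it is non-empty, the induced subgraph is strongly connected, and
no edge leaves `U` from a state of Random. -/
def IsEC (G : MDP S d) (U : Finset S) : Prop :=
  U.Nonempty ∧
  (∀ s ∈ U, ∀ t ∈ U, Relation.ReflTransGen (fun a b => a ∈ U ∧ b ∈ U ∧ G.E a b) s t) ∧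
  (∀ s ∈ U, s ∉ G.ctrl → ∀ t, G.E s t → t ∈ U)

/-- `U` is a winning end-component: from each of its states, Controller can surely guarantee a mean
payoff `> 0` while remaining in `U`. -/
def IsWEC (G : MDP S d) (U : Finset S) : Prop :=
  G.IsEC U ∧ ∀ s ∈ U, ∃ f : G.Strategy,
    (∀ π ∈ f.Outcome s, ∀ n, π n ∈ U) ∧ (0 : Fin d → ℝ) ∈ f.WCSol s

/-- `U` is a maximal winning end-component. -/
def IsMWEC (G : MDP S d) (U : Finset S) : Prop :=
  G.IsWEC U ∧ ∀ V, G.IsWEC V → ¬ U ⊂ V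

/-- `t` is reachable from `s` in the graph; equivalently, some strategy reaches `t` from `s` with
positive probability. -/
def Reachable (G : MDP S d) (s t : S) : Prop :=
  Relation.ReflTransGen G.E s t

/-! ### The linear system -/

open Classical in
/-- `(y, ye, x)` is a non-negative solution of the linear system `T`. The variables are `y s` for
the states `s`, and `ye s t` and `x s t` for the edges `(s, t)`; values of `ye` and `x` at pairs
that are not edges are never used. -/
structure SolvesT (G : MDP S d) (s₀ : S) (ν : Fin d → ℝ)
    (y : S → ℝ) (ye x : S → S → ℝ) : Prop where
  y_nonneg : ∀ s, 0 ≤ y s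
  ye_nonneg : ∀ s t, G.E s t → 0 ≤ ye s t
  x_nonneg : ∀ s t, G.E s t → 0 ≤ x s t
  /-- flow conservation with initial flow `1` in `s₀` and leak `y` -/
  y_flow : ∀ s, (if s = s₀ then 1 else 0) + ∑ r with G.E r s, ye r s
    = ∑ t with G.E s t, ye s t + y s
  /-- flow out of a state of Random -/
  y_random : ∀ s (hs : s ∉ G.ctrl) t, G.E s t →
    ye s t = (G.R s hs t).toReal * (∑ r with G.E r s, ye r s - y s)
  /-- the total leak inside the maximal winning end-components is `1` -/
  y_sum : ∑ U : Finset S with G.IsMWEC U, ∑ s ∈ U, y s = 1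
  /-- inside each of them the total leak equals the total frequency -/
  x_y : ∀ U : Finset S, G.IsMWEC U → ∑ s ∈ U, y s = ∑ r ∈ U, ∑ s ∈ U with G.E r s, x r s
  /-- The long-run frequencies `x` are carried by the maximal winning end-components. -/
  x_supp : ∀ s t, G.E s t → (¬ ∃ U, G.IsMWEC U ∧ s ∈ U ∧ t ∈ U) → x s t = 0
  /-- flow conservation of the frequencies -/
  x_flow : ∀ s, ∑ r with G.E r s, x r s = ∑ t with G.E s t, x s t
  /-- frequencies out of a state of Random -/
  x_random : ∀ s (hs : s ∉ G.ctrl) t, G.E s t →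
    x s t = (G.R s hs t).toReal * ∑ r with G.E r s, x r s
  /-- the global mean payoff is above the threshold -/
  mp_global : ∀ i, ν i < ∑ s, ∑ t with G.E s t, x s t * G.w s t i
  /-- the local mean payoffs are positive -/
  mp_local : ∀ U : Finset S, G.IsMWEC U → ∀ i,
    0 < ∑ s ∈ U, ∑ t ∈ U with G.E s t, x s t * G.w s t i

end MDP

/-! From a strategy to a solution. A finite-memory strategy induces a finite Markov chain on pairs
of a state and a memory state. This chain makes finitely many expected visits `z` to its transient
states, enters its recurrent part with probabilities `l`, and has limit frequencies `ξ` there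
(`exists_transient_decomposition`). Summing out the memory turns `l` into `y`, the edge flow of `z`
into `ye`, and that of `ξ` into `x`. As all outcomes have positive mean payoff, every recurrent
class that is reached projects to a WEC (`isWEC_reached`); hence `l` and `ξ` are carried by the
MWECs, with equal mass in each. Fatou's lemma bounds the expected mean payoff by the payoff under
`x`, which gives (C2). Applied to the part of `ξ` over one MWEC, it gives (C3), provided that the
MWEC is entered with positive probability. An explorer enters all of them (`exists_explorer`); since
the constraints are convex, mixing in a little of its solution makes (C3) strict everywhere.

From a solution to a strategy. Read `ye` as a flow out of `s₀` that leaks at the rates `y`.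
Following it long enough settles in each MWEC `U` with probability close to the leak in `U`
(`exists_first`). Inside of `U` the frequencies `x`, perturbed so that every edge is used, define an
irreducible chain; the Poisson equation provides potentials up to which every payoff component has a
strictly positive drift (`exists_gamble`). This gamble is good in expectation, but guarantees
nothing. The worst-case guarantee comes from a second fact: a strategy with surely positive mean
payoff forces payoff `1` in bounded time, so that any deficit is recovered in linear time
(`exists_force`, `force_of_deficit`).

A plan combines the two in blocks: gamble for a fixed number of steps, then recover until the block
has earned at least `1` in every component. Blocks have bounded length, hence every play has a
positive mean payoff (`Plan.Follows.meanPayoff_pos`). An exponential supermartingale bounds the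
expected deficit after the gamble independently of its length, so in long blocks the recovery costs
only a small fraction of the gain (`Plan.exists_certificate`). Plays that settle in no MWEC recover
by prunedness and still contribute a positive amount. All real probabilities are finally replaced by
rational ones. -/

open Filter Topology

/-! ### Finite Markov chains: stationary distributions, Lyapunov functions, the Poisson equation. -/

namespace FiniteChain

variable {C : Type*} [Fintype C]

/-- `p` is a stochastic matrix. -/
structure IsStochastic (p : C → C → ℝ) : Prop where
  nonneg : ∀ a b, 0 ≤ p a b
  sum_eq_one : ∀ a, ∑ b, p a b = 1

/-- The distribution after `n` steps of the chain `p` started with distribution `α`. -/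
def evolve (p : C → C → ℝ) (α : C → ℝ) : ℕ → C → ℝ
  | 0 => α
  | n + 1 => fun b => ∑ a, evolve p α n a * p a b

/-- `b` can be reached from `a` with positive probability. -/
def Conn {C : Type*} (p : C → C → ℝ) : C → C → Prop :=
  Relation.ReflTransGen fun a b => 0 < p a b

/-- The recurrent states. -/
def Rec {C : Type*} (p : C → C → ℝ) : Set C :=
  {c | ∀ c', Conn p c c' → Conn p c' c}

/-- The states from which `A` can be reached in at most `n` steps. -/
def within {C : Type*} (p : C → C → ℝ) (A : Set C) : ℕ → Set C
  | 0 => A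
  | n + 1 => {c | c ∈ within p A n ∨ ∃ c', 0 < p c c' ∧ c' ∈ within p A n}

lemma rec_closed {C : Type*} {p : C → C → ℝ} {a b : C} (ha : a ∈ Rec p) (hab : Conn p a b) :
    b ∈ Rec p :=
  fun c hc => (ha c (hab.trans hc)).trans hab

section

variable {p : C → C → ℝ} {α : C → ℝ}

lemma evolve_nonneg (hp : IsStochastic p) (hα : ∀ c, 0 ≤ α c) (n : ℕ) (c : C) :
    0 ≤ evolve p α n c := by
  induction n generalizing c with
  | zero => exact hα c
  | succ n ih => exact Finset.sum_nonneg fun a _ => mul_nonneg (ih a) (hp.nonneg a c)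

lemma sum_evolve (hp : IsStochastic p) (n : ℕ) : ∑ c, evolve p α n c = ∑ c, α c := by
  induction n with
  | zero => rfl
  | succ n ih =>
    simp only [evolve]
    rw [Finset.sum_comm]
    simp_rw [← Finset.mul_sum, hp.sum_eq_one, mul_one]
    exact ih

lemma evolve_le_one (hp : IsStochastic p) (hα : ∀ c, 0 ≤ α c) (h1 : ∑ c, α c = 1) (n : ℕ) (c : C) :
    evolve p α n c ≤ 1 := by
  rw [← h1, ← sum_evolve hp n]
  exact Finset.single_le_sum (fun a _ => evolve_nonneg hp hα n a) (Finset.mem_univ c)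

/-- The occupation averages of a finite chain have a limit point, which is a stationary
distribution. -/
lemma exists_cesaro_limit (hp : IsStochastic p) (hα : ∀ c, 0 ≤ α c) (h1 : ∑ c, α c = 1) :
    ∃ (ξ : C → ℝ) (φ : ℕ → ℕ), StrictMono φ ∧ (∀ c, 0 ≤ ξ c) ∧ ∑ c, ξ c = 1 ∧
      (∀ b, ∑ a, ξ a * p a b = ξ b) ∧
      ∀ c, Tendsto (fun k => (∑ j ∈ Finset.range (φ k), evolve p α j c) / φ k) atTop
        (𝓝 (ξ c)) := by
  set A : ℕ → C → ℝ := fun n c => (∑ j ∈ Finset.range (n + 1), evolve p α j c) / (n + 1 : ℕ)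
    with hA
  have hmem : ∀ n, A n ∈ stdSimplex ℝ C := by
    intro n
    refine ⟨fun c => ?_, ?_⟩
    · exact div_nonneg (Finset.sum_nonneg fun j _ => evolve_nonneg hp hα j c) (by positivity)
    · simp only [hA]
      rw [← Finset.sum_div, Finset.sum_comm]
      simp_rw [sum_evolve hp, h1]
      simp
      exact Nat.cast_add_one_ne_zero n
  -- Compactness gives convergence only along a subsequence, which suffices. The index is shifted by
  -- one below because `A n` averages `n + 1` terms.
  obtain ⟨ξ, hξ, ψ, hψ, hlim⟩ := (isCompact_stdSimplex ℝ C).tendsto_subseq hmem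
  have hlim' : ∀ c, Tendsto (fun k => A (ψ k) c) atTop (𝓝 (ξ c)) := by
    intro c
    exact (tendsto_pi_nhds.1 hlim) c
  refine ⟨ξ, fun k => ψ k + 1, fun a b h => by simpa using hψ h, hξ.1, hξ.2, ?_, ?_⟩
  · intro b
    have e1 : Tendsto (fun k => ∑ a, A (ψ k) a * p a b) atTop (𝓝 (∑ a, ξ a * p a b)) :=
      tendsto_finsetSum _ fun a _ => (hlim' a).mul_const _
    -- One step of the chain shifts the averaged window by one, so `A n` is invariant up to two
    -- boundary terms divided by `n + 1`.
    have e2 : ∀ n, ∑ a, A n a * p a b = A n b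
        + (evolve p α (n + 1) b - α b) / (n + 1 : ℕ) := by
      intro n
      have : ∑ a, A n a * p a b
          = (∑ j ∈ Finset.range (n + 1), evolve p α (j + 1) b) / (n + 1 : ℕ) := by
        simp only [hA, evolve]
        rw [Finset.sum_comm, Finset.sum_div]
        refine Finset.sum_congr rfl fun a _ => ?_
        rw [Finset.sum_div, Finset.sum_div, Finset.sum_mul]
        refine Finset.sum_congr rfl fun j _ => ?_
        ring
      rw [this]
      simp only [hA]
      rw [← add_div]
      congr 1
      have h3 := Finset.sum_range_succ' (fun j => evolve p α j b) (n + 1)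
      have h4 := Finset.sum_range_succ (fun j => evolve p α j b) (n + 1)
      have h5 : evolve p α 0 b = α b := rfl
      linarith
    have e3 : Tendsto (fun n : ℕ => (evolve p α (n + 1) b - α b) / (n + 1 : ℕ)) atTop (𝓝 0) := by
      refine squeeze_zero_norm (a := fun n : ℕ => 1 / ((n : ℝ) + 1)) (fun n => ?_)
        tendsto_one_div_add_atTop_nhds_zero_nat
      rw [Real.norm_eq_abs, abs_div]
      have a1 := evolve_nonneg hp hα (n + 1) b
      have a2 := evolve_le_one hp hα h1 (n + 1) b
      have a3 := hα b
      have a4 : α b ≤ 1 := evolve_le_one hp hα h1 0 b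
      have : |((n + 1 : ℕ) : ℝ)| = (n : ℝ) + 1 := by
        rw [abs_of_nonneg (by positivity)]; push_cast; ring
      rw [this]
      gcongr
      rw [abs_le]; constructor <;> linarith
    have e4 : Tendsto (fun k => ∑ a, A (ψ k) a * p a b) atTop (𝓝 (ξ b + 0)) := by
      simp_rw [e2]
      exact (hlim' b).add (e3.comp hψ.tendsto_atTop)
    simpa using tendsto_nhds_unique e1 e4
  · exact hlim'

lemma conn_pos {ξ : C → ℝ} (hp : IsStochastic p) (hξ : ∀ c, 0 ≤ ξ c)
    (hst : ∀ b, ∑ a, ξ a * p a b = ξ b) {a b : C} (hab : Conn p a b) (ha : 0 < ξ a) : 0 < ξ b := by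
  induction hab with
  | refl => exact ha
  | @tail b c _ hbc ih =>
    rw [← hst c]
    exact lt_of_lt_of_le (mul_pos ih hbc)
      (Finset.single_le_sum (fun a _ => mul_nonneg (hξ a) (hp.nonneg a c)) (Finset.mem_univ b))

/-- Among the states reachable from `c`, one with the fewest reachable states is recurrent: whatever
it reaches must reach just as many, hence the same states, and so leads back. -/
lemma exists_conn_rec (p : C → C → ℝ) (c : C) : ∃ c' ∈ Rec p, Conn p c c' := by
  classical
  obtain ⟨c', hc', hmin⟩ := Finset.exists_min_image
    (Finset.univ.filter fun c' => Conn p c c')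
    (fun c' => (Finset.univ.filter fun b => Conn p c' b).card)
    ⟨c, Finset.mem_filter.2 ⟨Finset.mem_univ _, Relation.ReflTransGen.refl⟩⟩
  simp only [Finset.mem_filter, Finset.mem_univ, true_and] at hc' hmin
  refine ⟨c', fun b hb => ?_, hc'⟩
  have hsub : (Finset.univ.filter fun x => Conn p b x) ⊆ Finset.univ.filter fun x => Conn p c' x := by
    intro x hx
    simp only [Finset.mem_filter, Finset.mem_univ, true_and] at hx ⊢
    exact hb.trans hx
  have := Finset.eq_of_subset_of_card_le hsub (hmin b (hc'.trans hb))
  have h2 : c' ∈ Finset.univ.filter fun x => Conn p b x := by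
    rw [this]; exact Finset.mem_filter.2 ⟨Finset.mem_univ _, Relation.ReflTransGen.refl⟩
  exact (Finset.mem_filter.1 h2).2

/-- A Lyapunov function for hitting a closed set that can be reached from everywhere. -/
lemma exists_lyapunov (hp : IsStochastic p) (A : Set C)
    (hA : ∀ c, ∃ c' ∈ A, Conn p c c') :
    ∃ g : C → ℝ, (∀ c, 0 ≤ g c) ∧ (∀ c ∈ A, g c = 0) ∧
      ∀ c ∉ A, 1 + ∑ c', p c c' * g c' ≤ g c := by
  classical
  have hWs : ∀ n, within p A (n + 1) =
      {c | c ∈ within p A n ∨ ∃ c', 0 < p c c' ∧ c' ∈ within p A n} := fun n => rfl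
  have hex : ∀ c, ∃ n, c ∈ within p A n := by
    intro c
    obtain ⟨c', hc', hcon⟩ := hA c
    induction hcon using Relation.ReflTransGen.head_induction_on with
    | refl => exact ⟨0, hc'⟩
    | @head a b hab _ ih =>
      obtain ⟨n, hn⟩ := ih
      exact ⟨n + 1, by rw [hWs]; exact Or.inr ⟨b, hab, hn⟩⟩
  let D : C → ℕ := fun c => Nat.find (hex c)
  have hDA : ∀ c ∈ A, D c = 0 := fun c hc => by
    exact (Nat.find_eq_zero (hex c)).2 hc
  have hDs : ∀ c ∉ A, ∃ k c', D c = k + 1 ∧ 0 < p c c' ∧ D c' ≤ k := by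
    intro c hc
    have hne : D c ≠ 0 := by
      intro h0
      have h0 := (Nat.find_eq_zero (hex c)).1 h0
      exact hc h0
    obtain ⟨k, hk⟩ := Nat.exists_eq_succ_of_ne_zero hne
    have hspec : c ∈ within p A (k + 1) := by
      have := Nat.find_spec (hex c)
      rw [show Nat.find (hex c) = k + 1 from hk] at this
      exact this
    rw [hWs] at hspec
    rcases hspec with h | ⟨c', h1, h2⟩
    · exact absurd h (Nat.find_min (hex c) (by rw [show Nat.find (hex c) = k + 1 from hk]; omega))
    · exact ⟨k, c', hk, h1, Nat.find_min' (hex c') h2⟩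
  obtain ⟨δ, hδ0, hδ1, hδ⟩ : ∃ δ : ℝ, 0 < δ ∧ δ ≤ 1 ∧ ∀ a b, 0 < p a b → δ ≤ p a b := by
    by_cases hne : (Finset.univ.filter fun x : C × C => 0 < p x.1 x.2).Nonempty
    · obtain ⟨m, hm, hmin⟩ := Finset.exists_min_image _ (fun x : C × C => p x.1 x.2) hne
      simp only [Finset.mem_filter, Finset.mem_univ, true_and] at hm hmin
      refine ⟨p m.1 m.2, hm, ?_, fun a b hab => hmin (a, b) hab⟩
      rw [← hp.sum_eq_one m.1]
      exact Finset.single_le_sum (fun b _ => hp.nonneg m.1 b) (Finset.mem_univ m.2)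
    · refine ⟨1, one_pos, le_rfl, fun a b hab => absurd ?_ hne⟩
      exact ⟨(a, b), by simpa using hab⟩
  -- The function is `M * (1 - β ^ D c)`. If `D c = k + 1`, a step towards `A` has probability at
  -- least `δ` and makes the mean of `β ^ D` at least `δ * β ^ k`, twice the present value `β ^ (k +
  -- 1)`. The factor `M` scales the smallest such gain to `1`.
  set β := δ / 2 with hβ
  have hβ0 : 0 < β := by positivity
  have hβ1 : β ≤ 1 := by rw [hβ]; linarith
  set K := Finset.univ.sup D with hK
  have hDK : ∀ c, D c ≤ K := fun c => Finset.le_sup (Finset.mem_univ c)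
  set M := 2 / (δ * β ^ K) with hM
  have hM0 : 0 < M := by positivity
  refine ⟨fun c => M * (1 - β ^ D c), fun c => ?_, fun c hc => ?_, fun c hc => ?_⟩
  · exact mul_nonneg hM0.le (sub_nonneg.2 (pow_le_one₀ hβ0.le hβ1))
  · simp [hDA c hc]
  · obtain ⟨k, c', hk, hpos, hc'⟩ := hDs c hc
    have e1 : ∑ b, p c b * (M * (1 - β ^ D b)) = M * (1 - ∑ b, p c b * β ^ D b) := by
      have h1 := hp.sum_eq_one c
      simp only [mul_sub, mul_one, Finset.sum_sub_distrib, ← Finset.sum_mul, h1, one_mul,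
        Finset.mul_sum]
      congr 1
      exact Finset.sum_congr rfl fun b _ => by ring
    have e2 : δ * β ^ k ≤ ∑ b, p c b * β ^ D b := by
      calc δ * β ^ k ≤ p c c' * β ^ D c' :=
            mul_le_mul (hδ _ _ hpos) (pow_le_pow_of_le_one hβ0.le hβ1 hc') (by positivity)
              hpos.le
        _ ≤ _ := Finset.single_le_sum (f := fun b => p c b * β ^ D b)
              (fun b _ => mul_nonneg (hp.nonneg c b) (by positivity)) (Finset.mem_univ c')
    have e3 : β ^ K ≤ β ^ k :=
      pow_le_pow_of_le_one hβ0.le hβ1 (by have := hDK c; omega)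
    have e4 : M * (δ * β ^ K / 2) = 1 := by rw [hM]; field_simp
    have e5 : M * (δ * β ^ K / 2) ≤ M * (∑ b, p c b * β ^ D b - β ^ (k + 1)) := by
      apply mul_le_mul_of_nonneg_left _ hM0.le
      have : β ^ (k + 1) = δ / 2 * β ^ k := by rw [pow_succ, hβ]; ring
      rw [this]
      nlinarith [mul_le_mul_of_nonneg_left e3 hδ0.le]
    change _ ≤ M * (1 - β ^ D c)
    rw [e1, hk]
    nlinarith

/-- The expected number of visits outside of a closed set is bounded by the Lyapunov function. -/
lemma sum_evolve_le_lyapunov (hp : IsStochastic p) (hα : ∀ c, 0 ≤ α c) (A : Set C) [DecidablePred (· ∈ A)]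
    (hcl : ∀ a ∈ A, ∀ b, 0 < p a b → b ∈ A) {g : C → ℝ} (hg : ∀ c, 0 ≤ g c)
    (hgA : ∀ c ∈ A, g c = 0) (hg1 : ∀ c ∉ A, 1 + ∑ c', p c c' * g c' ≤ g c) (n : ℕ) :
    ∑ k ∈ Finset.range n, ∑ c with c ∉ A, evolve p α k c ≤ ∑ c, α c * g c := by
  -- Keeping the remaining potential on the left makes the bound inductive: each visit outside of
  -- `A` is paid for by an expected drop of `g` by at least `1`.
  have key : ∀ n, ∑ k ∈ Finset.range n, ∑ c with c ∉ A, evolve p α k c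
      + ∑ c, evolve p α n c * g c ≤ ∑ c, α c * g c := by
    intro n
    induction n with
    | zero => simp [evolve]
    | succ n ih =>
      rw [Finset.sum_range_succ]
      have e : ∑ c, evolve p α (n + 1) c * g c = ∑ a, evolve p α n a * ∑ c, p a c * g c := by
        simp only [evolve, Finset.sum_mul, Finset.mul_sum]
        rw [Finset.sum_comm]
        exact Finset.sum_congr rfl fun a _ => Finset.sum_congr rfl fun c _ => by ring
      have e2 : ∑ c with c ∉ A, evolve p α n c + ∑ a, evolve p α n a * ∑ c, p a c * g c
          ≤ ∑ c, evolve p α n c * g c := by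
        rw [Finset.sum_filter, ← Finset.sum_add_distrib]
        refine Finset.sum_le_sum fun a _ => ?_
        have hnn := evolve_nonneg hp hα n a
        by_cases ha : a ∈ A
        · have : ∑ c, p a c * g c = 0 := by
            refine Finset.sum_eq_zero fun c _ => ?_
            rcases (hp.nonneg a c).eq_or_lt with h | h
            · rw [← h, zero_mul]
            · rw [hgA c (hcl a ha c h), mul_zero]
          simp [ha, this, hgA a ha]
        · simp only [ha, not_false_eq_true, if_true]
          nlinarith [mul_le_mul_of_nonneg_left (hg1 a ha) hnn]
      linarith
  have := key n
  have h2 : 0 ≤ ∑ c, evolve p α n c * g c :=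
    Finset.sum_nonneg fun c _ => mul_nonneg (evolve_nonneg hp hα n c) (hg c)
  linarith

/-- The Poisson equation of an irreducible chain. -/
lemma exists_poisson [Nonempty C] (hp : IsStochastic p) (hirr : ∀ a b, Conn p a b) {ξ : C → ℝ}
    (hξ : ∀ c, 0 < ξ c) (hst : ∀ b, ∑ a, ξ a * p a b = ξ b) (r : C → ℝ) (v : ℝ)
    (hr : ∑ a, ξ a * (r a - v) = 0) :
    ∃ g : C → ℝ, ∀ a, v + g a = r a + ∑ b, p a b * g b := by
  classical
  let L : (C → ℝ) →ₗ[ℝ] (C → ℝ) :=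
    { toFun := fun g a => g a - ∑ b, p a b * g b
      map_add' := fun g h => by
        ext a
        simp only [Pi.add_apply, mul_add, Finset.sum_add_distrib]
        ring
      map_smul' := fun c g => by
        ext a
        simp only [Pi.smul_apply, smul_eq_mul, RingHom.id_apply, mul_sub, Finset.mul_sum]
        congr 1
        exact Finset.sum_congr rfl fun b _ => by ring }
  by_cases hmem : (fun a => r a - v) ∈ LinearMap.range L
  · obtain ⟨g, hg⟩ := hmem
    refine ⟨g, fun a => ?_⟩
    have : g a - ∑ b, p a b * g b = r a - v := congrFun hg a
    linarith
  · exfalso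
    -- Fredholm alternative: otherwise some functional kills the range of `L` but not `r - v`. Its
    -- coefficients `l` form a left-invariant vector, which irreducibility forces to be a multiple
    -- of `ξ`; but `ξ` kills `r - v`.
    obtain ⟨f, hf, hker⟩ := Submodule.exists_le_ker_of_notMem hmem
    set l : C → ℝ := fun a => f (Pi.single a 1) with hl
    have hfl : ∀ h : C → ℝ, f h = ∑ a, h a * l a := by
      intro h
      conv_lhs => rw [← Finset.univ_sum_single h]
      rw [map_sum]
      refine Finset.sum_congr rfl fun a _ => ?_
      have : Pi.single a (h a) = h a • (Pi.single a (1 : ℝ) : C → ℝ) := by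
        rw [← Pi.single_smul, smul_eq_mul, mul_one]
      rw [this, map_smul, smul_eq_mul]
    have hinv : ∀ b, ∑ a, l a * p a b = l b := by
      intro b
      have h0 : f (L (Pi.single b 1)) = 0 := hker ⟨_, rfl⟩
      rw [hfl] at h0
      have : ∀ a, L (Pi.single b 1) a = (if a = b then 1 else 0) - p a b := by
        intro a
        change (Pi.single b (1 : ℝ) : C → ℝ) a - ∑ c, p a c * (Pi.single b (1 : ℝ) : C → ℝ) c = _
        simp [Pi.single_apply]
      simp only [this, sub_mul, Finset.sum_sub_distrib, ite_mul, one_mul, zero_mul,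
        Finset.sum_ite_eq', Finset.mem_univ, if_true] at h0
      rw [← sub_eq_zero, ← neg_eq_zero, neg_sub, ← h0]
      congr 1
      exact Finset.sum_congr rfl fun a _ => by ring
    -- Subtract the largest multiple of `ξ` that leaves a non-negative vector. The difference is
    -- invariant and vanishes at `b0`, hence at every state that leads to `b0`, which is everywhere.
    obtain ⟨b0, -, hb0⟩ := Finset.exists_min_image Finset.univ (fun a => l a / ξ a)
      Finset.univ_nonempty
    set k := l b0 / ξ b0 with hk
    have hm0 : ∀ a, 0 ≤ l a - k * ξ a := by
      intro a
      have := hb0 a (Finset.mem_univ a)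
      rw [le_div_iff₀ (hξ a)] at this
      linarith
    have hminv : ∀ b, ∑ a, (l a - k * ξ a) * p a b = l b - k * ξ b := by
      intro b
      rw [← hinv b, ← hst b, Finset.mul_sum, ← Finset.sum_sub_distrib]
      exact Finset.sum_congr rfl fun a _ => by ring
    have hz : ∀ a, l a - k * ξ a = 0 := by
      intro a
      have hcon := hirr a b0
      induction hcon using Relation.ReflTransGen.head_induction_on with
      | refl => rw [hk, div_mul_cancel₀ _ (hξ b0).ne', sub_self]
      | @head a b hab _ ih =>
        have h1 := hminv b
        rw [ih] at h1
        have h2 := (Finset.sum_eq_zero_iff_of_nonneg fun c _ =>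
          mul_nonneg (hm0 c) (hp.nonneg c b)).1 h1 a (Finset.mem_univ a)
        rcases mul_eq_zero.1 h2 with h | h
        · exact h
        · exact absurd h hab.ne'
    apply hf
    rw [hfl]
    have : ∀ a, l a = k * ξ a := fun a => sub_eq_zero.1 (hz a)
    simp_rw [this]
    calc ∑ a, (r a - v) * (k * ξ a) = k * ∑ a, ξ a * (r a - v) := by
          rw [Finset.mul_sum]; exact Finset.sum_congr rfl fun a _ => by ring
      _ = 0 := by rw [hr, mul_zero]

end

end FiniteChain

/-! ### Two analytic tools: an exponential moment bound and rational approximation. -/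

/-- An exponential of a bounded variable with positive mean has mean at most `1`, if the exponent is
negative and small. -/
lemma sum_mul_exp_neg_le_one {ι : Type*} [Fintype ι] {q D : ι → ℝ} {B δ l : ℝ} (hq : ∀ i, 0 ≤ q i)
    (hq1 : ∑ i, q i = 1) (hD : ∀ i, 0 < q i → |D i| ≤ B) (hδ : δ ≤ ∑ i, q i * D i) (hl : 0 ≤ l)
    (hlB : l * B ≤ 1) (hlδ : l * B ^ 2 ≤ δ) : ∑ i, q i * Real.exp (-l * D i) ≤ 1 := by
  have h1 : ∀ i, q i * Real.exp (-l * D i) ≤ q i - l * (q i * D i) + q i * (l * (l * B ^ 2)) := by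
    intro i
    rcases (hq i).eq_or_lt with h | h
    · simp [← h]
    · have hd := hD i h
      have habs : |(-l * D i)| ≤ 1 := by
        rw [abs_mul, abs_neg, abs_of_nonneg hl]
        exact (mul_le_mul_of_nonneg_left hd hl).trans hlB
      -- `exp u ≤ 1 + u + u ^ 2` for `|u| ≤ 1`. In the mean, the quadratic term costs at most `l *
      -- (l * B ^ 2) ≤ l * δ`, which the linear term gains.
      have h2 := (abs_le.1 (Real.abs_exp_sub_one_sub_id_le habs)).2
      have h3 : (D i) ^ 2 ≤ B ^ 2 := by
        rw [← sq_abs]; exact pow_le_pow_left₀ (abs_nonneg _) hd 2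
      have h4 : (-l * D i) ^ 2 ≤ l * (l * B ^ 2) := by
        have := mul_le_mul_of_nonneg_left h3 (mul_nonneg hl hl)
        nlinarith
      nlinarith
  calc ∑ i, q i * Real.exp (-l * D i)
      ≤ ∑ i, (q i - l * (q i * D i) + q i * (l * (l * B ^ 2))) := Finset.sum_le_sum fun i _ => h1 i
    _ = 1 - l * ∑ i, q i * D i + l * (l * B ^ 2) := by
        rw [Finset.sum_add_distrib, Finset.sum_sub_distrib, ← Finset.mul_sum, ← Finset.sum_mul, hq1,
          one_mul]
    _ ≤ 1 := by nlinarith [mul_le_mul_of_nonneg_left hδ hl, mul_le_mul_of_nonneg_left hlδ hl]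

/-- The real numbers can be approximated by rational numbers in a `ℚ`-linear way. -/
lemma exists_linear_rational_approx :
    ∃ φ : ℕ → ℝ →ₗ[ℚ] ℚ, (∀ k, φ k 1 = 1) ∧
      ∀ a, Tendsto (fun k => ((φ k a : ℚ) : ℝ)) atTop (𝓝 a) := by
  -- Extend `{1}` to a basis of `ℝ` over `ℚ`, fix `1`, and send every other basis vector to rational
  -- approximations of itself. A given real number involves only finitely many basis vectors, so its
  -- images converge to it.
  have hli : LinearIndepOn ℚ id ({1} : Set ℝ) := by
    rw [linearIndepOn_singleton_iff]; simp
  set b := Module.Basis.extend hli with hb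
  have h1mem : (1 : ℝ) ∈ hli.extend (Set.subset_univ _) :=
    Module.Basis.subset_extend hli (Set.mem_singleton 1)
  set i1 : hli.extend (Set.subset_univ ({1} : Set ℝ)) := ⟨1, h1mem⟩ with hi1
  have hbi : ∀ i, b i = (i : ℝ) := fun i => Module.Basis.extend_apply_self hli i
  have happ : ∀ x : ℝ, ∃ u : ℕ → ℚ, Tendsto (fun k => ((u k : ℚ) : ℝ)) atTop (𝓝 x) := by
    intro x
    have h : ∀ k : ℕ, ∃ q : ℚ, x < q ∧ (q : ℝ) < x + 1 / ((k : ℝ) + 1) := fun k =>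
      exists_rat_btwn (by have : 0 < 1 / ((k : ℝ) + 1) := by positivity
                          linarith)
    choose u hu1 hu2 using h
    refine ⟨u, tendsto_of_tendsto_of_tendsto_of_le_of_le tendsto_const_nhds (h := fun k : ℕ =>
      x + 1 / ((k : ℝ) + 1)) ?_ (fun k => (hu1 k).le) (fun k => (hu2 k).le)⟩
    simpa using (tendsto_const_nhds (x := x)).add (tendsto_one_div_add_atTop_nhds_zero_nat (𝕜 := ℝ))
  choose u hu using happ
  classical
  refine ⟨fun k => b.constr ℚ fun i => if i = i1 then 1 else u i k, fun k => ?_, fun a => ?_⟩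
  · have : (1 : ℝ) = b i1 := (hbi i1).symm
    have h2 := b.constr_basis ℚ (fun i => if i = i1 then (1 : ℚ) else u i k) i1
    rw [← this, if_pos rfl] at h2
    exact h2
  · have hrep : ∀ k, (((b.constr ℚ fun i => if i = i1 then 1 else u i k) a : ℚ) : ℝ)
        = ∑ i ∈ (b.repr a).support, ((b.repr a i : ℚ) : ℝ) *
            (((if i = i1 then 1 else u i k : ℚ)) : ℝ) := by
      intro k
      rw [Module.Basis.constr_apply, Finsupp.sum]
      push_cast [smul_eq_mul]
      rfl
    simp_rw [hrep]
    have ha : a = ∑ i ∈ (b.repr a).support, ((b.repr a i : ℚ) : ℝ) * (i : ℝ) := by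
      conv_lhs => rw [← b.linearCombination_repr a, Finsupp.linearCombination_apply, Finsupp.sum]
      exact Finset.sum_congr rfl fun i _ => by rw [hbi, Rat.smul_def]
    conv => 
      arg 3
      rw [ha]
    refine tendsto_finsetSum _ fun i _ => Tendsto.const_mul _ ?_
    by_cases hi : i = i1
    · simp only [hi, if_true, hi1]
      simp
    · simp only [hi, if_false]
      exact hu i

open Filter Topology FiniteChain

lemma PMF.sum_toReal {A : Type*} [Fintype A] (p : PMF A) : ∑ a, (p a).toReal = 1 := by
  rw [← ENNReal.toReal_sum fun a _ => p.apply_ne_top a, ← tsum_fintype (L := .unconditional _),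
    p.tsum_coe, ENNReal.toReal_one]

lemma PMF.toReal_pos_iff {A : Type*} (p : PMF A) (a : A) : 0 < (p a).toReal ↔ a ∈ p.support := by
  rw [ENNReal.toReal_pos_iff, PMF.mem_support_iff, pos_iff_ne_zero]
  exact ⟨fun h => h.1, fun h => ⟨h, (p.apply_ne_top a).lt_top⟩⟩

/-- Fatou's lemma for a uniformly bounded sequence, along a subsequence. -/
lemma integral_liminf_le_of_tendsto {Ω : Type*} [MeasurableSpace Ω] (μ : Measure Ω)
    [IsProbabilityMeasure μ] {a : ℕ → Ω → ℝ} (ha : ∀ n, Measurable (a n)) {W : ℝ}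
    (hW : ∀ n ω, |a n ω| ≤ W) {φ : ℕ → ℕ} (hφ : StrictMono φ) {l : ℝ}
    (hl : Tendsto (fun k => ∫ ω, a (φ k) ω ∂μ) atTop (𝓝 l)) :
    ∫ ω, liminf (fun n => a n ω) atTop ∂μ ≤ l := by
  have hbd : ∀ (u : ℕ → ℕ) ω, IsBoundedUnder (· ≥ ·) atTop fun n => a (u n) ω := fun u ω =>
    ⟨-W, by simpa using ⟨0, fun n _ => (abs_le.1 (hW (u n) ω)).1⟩⟩
  have hcb : ∀ (u : ℕ → ℕ) ω, IsCoboundedUnder (· ≥ ·) atTop fun n => a (u n) ω := fun u ω =>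
    IsBoundedUnder.isCoboundedUnder_ge
      ⟨W, by simpa using ⟨0, fun n _ => (abs_le.1 (hW (u n) ω)).2⟩⟩
  have hlow : ∀ (u : ℕ → ℕ) ω, -W ≤ liminf (fun n => a (u n) ω) atTop := fun u ω =>
    le_liminf_of_le (hcb u ω) (Eventually.of_forall fun n => (abs_le.1 (hW _ ω)).1)
  have hup : ∀ (u : ℕ → ℕ) ω, liminf (fun n => a (u n) ω) atTop ≤ W := fun u ω =>
    liminf_le_of_frequently_le (Frequently.of_forall fun n => (abs_le.1 (hW _ ω)).2) (hbd u ω)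
  have hmeas : ∀ u : ℕ → ℕ, Measurable fun ω => liminf (fun n => a (u n) ω) atTop := fun u =>
    Measurable.liminf fun n => ha (u n)
  have hint : ∀ u : ℕ → ℕ, Integrable (fun ω => liminf (fun n => a (u n) ω) atTop) μ := fun u =>
    Integrable.of_bound (hmeas u).aestronglyMeasurable W
      (Eventually.of_forall fun ω => by
        rw [Real.norm_eq_abs, abs_le]; exact ⟨hlow u ω, hup u ω⟩)
  have hinta : ∀ n, Integrable (a n) μ := fun n =>
    Integrable.of_bound (ha n).aestronglyMeasurable W (Eventually.of_forall fun ω => hW n ω)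
  have h1 : ∫ ω, liminf (fun n => a n ω) atTop ∂μ ≤ ∫ ω, liminf (fun k => a (φ k) ω) atTop ∂μ := by
    refine integral_mono (hint id) (hint φ) fun ω => ?_
    have := liminf_le_liminf_of_le (g := map φ atTop) (f := atTop) hφ.tendsto_atTop
      (u := fun n => a n ω) (hbd id ω)
      (by simpa [IsCoboundedUnder, Filter.map_map, Function.comp_def] using hcb φ ω)
    simpa [liminf, Filter.map_map, Function.comp_def] using this
  refine h1.trans ?_
  -- Adding `W` makes the functions non-negative, as Fatou's lemma requires.
  have h2 : ∫⁻ ω, ENNReal.ofReal (liminf (fun k => a (φ k) ω) atTop + W) ∂μ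
      ≤ liminf (fun k => ∫⁻ ω, ENNReal.ofReal (a (φ k) ω + W) ∂μ) atTop := by
    refine le_trans (le_of_eq ?_) (lintegral_liminf_le fun k =>
      ((ha (φ k)).add_const W).ennreal_ofReal)
    refine lintegral_congr fun ω => ?_
    have hm : Monotone fun x : ℝ => ENNReal.ofReal (x + W) := fun x y h =>
      ENNReal.ofReal_le_ofReal (by linarith)
    exact hm.map_liminf_of_continuousAt (fun k => a (φ k) ω)
      (ENNReal.continuous_ofReal.comp (continuous_id.add continuous_const)).continuousAt
      (hcb φ ω) (hbd φ ω)
  have h3 : ∀ k, ∫⁻ ω, ENNReal.ofReal (a (φ k) ω + W) ∂μ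
      = ENNReal.ofReal (∫ ω, a (φ k) ω ∂μ + W) := by
    intro k
    have h := ofReal_integral_eq_lintegral_ofReal (f := fun ω => a (φ k) ω + W)
      ((hinta _).add (integrable_const W)) (Eventually.of_forall fun ω => by
        have := (abs_le.1 (hW (φ k) ω)).1
        change 0 ≤ a (φ k) ω + W
        linarith)
    rw [← h, integral_add (hinta _) (integrable_const W)]
    simp
  have h4 : Tendsto (fun k => ENNReal.ofReal (∫ ω, a (φ k) ω ∂μ + W)) atTop
      (𝓝 (ENNReal.ofReal (l + W))) :=
    (ENNReal.continuous_ofReal.tendsto _).comp (hl.add_const W)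
  simp_rw [h3] at h2
  have h5 := ofReal_integral_eq_lintegral_ofReal
    (f := fun ω => liminf (fun k => a (φ k) ω) atTop + W)
    ((hint φ).add (integrable_const W)) (Eventually.of_forall fun ω => by
        have := hlow φ ω
        change 0 ≤ liminf (fun k => a (φ k) ω) atTop + W
        linarith)
  rw [h4.liminf_eq, ← h5, integral_add (hint φ) (integrable_const W)] at h2
  have hlW : -W ≤ l := by
    refine ge_of_tendsto' hl fun k => ?_
    calc -W = ∫ _, -W ∂μ := by simp
      _ ≤ _ := integral_mono (integrable_const _) (hinta _) fun ω => (abs_le.1 (hW (φ k) ω)).1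
  rw [ENNReal.ofReal_le_ofReal_iff (by linarith)] at h2
  simpa using h2

/-! ### Mean payoffs along plays, and the laws of the induced Markov chain. -/

namespace MDP

variable {S : Type*} [Fintype S] {d : ℕ} {G : MDP S d}

lemma exists_weight_bound (G : MDP S d) : ∃ W : ℝ, 0 < W ∧ ∀ s t i, |(G.w s t i : ℝ)| ≤ W := by
  obtain ⟨W, hW⟩ := (Set.finite_range fun x : S × S × Fin d => |(G.w x.1 x.2.1 x.2.2 : ℝ)|).bddAbove
  exact ⟨max W 1, by positivity, fun s t i => (hW ⟨(s, t, i), rfl⟩).trans (le_max_left _ _)⟩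

section payoff

variable {W : ℝ}

lemma abs_totalPayoff_le (hW : ∀ s t i, |(G.w s t i : ℝ)| ≤ W) (n : ℕ) (π : ℕ → S) (i : Fin d) :
    |G.totalPayoff n π i| ≤ n * W := by
  unfold totalPayoff
  calc _ ≤ ∑ k ∈ Finset.range n, |(G.w (π k) (π (k + 1)) i : ℝ)| := Finset.abs_sum_le_sum_abs _ _
    _ ≤ ∑ k ∈ Finset.range n, W := Finset.sum_le_sum fun k _ => hW _ _ _
    _ = n * W := by simp

lemma abs_average_le (hW0 : 0 < W) (hW : ∀ s t i, |(G.w s t i : ℝ)| ≤ W) (n : ℕ) (π : ℕ → S)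
    (i : Fin d) : |G.totalPayoff n π i / n| ≤ W := by
  rcases Nat.eq_zero_or_pos n with rfl | hn
  · simpa using hW0.le
  · have hn' : (0 : ℝ) < n := by exact_mod_cast hn
    rw [abs_div, abs_of_pos hn', div_le_iff₀ hn', mul_comm]
    exact abs_totalPayoff_le hW n π i

lemma average_isBounded (π : ℕ → S) (i : Fin d) :
    IsBoundedUnder (· ≥ ·) atTop fun n : ℕ => G.totalPayoff n π i / n := by
  obtain ⟨W, hW0, hW⟩ := G.exists_weight_bound
  exact ⟨-W, by simpa using ⟨0, fun n _ => (abs_le.1 (abs_average_le hW0 hW n π i)).1⟩⟩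

lemma average_isCobounded (π : ℕ → S) (i : Fin d) :
    IsCoboundedUnder (· ≥ ·) atTop fun n : ℕ => G.totalPayoff n π i / n := by
  obtain ⟨W, hW0, hW⟩ := G.exists_weight_bound
  exact IsBoundedUnder.isCoboundedUnder_ge
    ⟨W, by simpa using ⟨0, fun n _ => (abs_le.1 (abs_average_le hW0 hW n π i)).2⟩⟩

lemma le_meanPayoff {π : ℕ → S} {i : Fin d} {c : ℝ}
    (h : ∀ᶠ n : ℕ in atTop, c ≤ G.totalPayoff n π i / n) : c ≤ G.meanPayoff π i :=
  le_liminf_of_le (average_isCobounded π i) h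

lemma abs_meanPayoff_le (hW0 : 0 < W) (hW : ∀ s t i, |(G.w s t i : ℝ)| ≤ W) (π : ℕ → S)
    (i : Fin d) : |G.meanPayoff π i| ≤ W := by
  rw [abs_le]
  exact ⟨le_meanPayoff (Eventually.of_forall fun n => (abs_le.1 (abs_average_le hW0 hW n π i)).1),
    liminf_le_of_frequently_le
      (Frequently.of_forall fun n => (abs_le.1 (abs_average_le hW0 hW n π i)).2)
      (average_isBounded π i)⟩

/-- If the total payoff grows linearly, then the mean payoff is at least the rate. -/
lemma le_meanPayoff_of_linear {π : ℕ → S} {i : Fin d} {c K : ℝ} {N : ℕ}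
    (h : ∀ n ≥ N, c * n - K ≤ G.totalPayoff n π i) : c ≤ G.meanPayoff π i := by
  refine le_of_forall_pos_lt_add fun ε hε => ?_
  have : c - ε / 2 ≤ G.meanPayoff π i := by
    apply le_meanPayoff
    obtain ⟨M, hM⟩ := exists_nat_gt (|K| / (ε / 2))
    filter_upwards [eventually_ge_atTop N, eventually_ge_atTop M, eventually_gt_atTop 0]
      with n h1 h2 h3
    have h3' : (0 : ℝ) < n := by exact_mod_cast h3
    rw [le_div_iff₀ h3']
    have h4 : (M : ℝ) ≤ n := by exact_mod_cast h2
    rw [div_lt_iff₀ (by positivity)] at hM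
    have h5 := h n h1
    have h6 := le_abs_self K
    nlinarith
  linarith

/-- A play with positive mean payoff reaches every total payoff. -/
lemma exists_totalPayoff_ge {π : ℕ → S} (h : ∀ i, 0 < G.meanPayoff π i) (K : ℝ) :
    ∃ n, ∀ i, K ≤ G.totalPayoff n π i := by
  have : ∀ i, ∀ᶠ n : ℕ in atTop, K ≤ G.totalPayoff n π i := by
    intro i
    have h1 : ∀ᶠ n : ℕ in atTop, G.meanPayoff π i / 2 < G.totalPayoff n π i / n :=
      eventually_lt_of_lt_liminf (by
        change _ < G.meanPayoff π i
        linarith [h i]) (average_isBounded π i)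
    obtain ⟨M, hM⟩ := exists_nat_gt (|K| / (G.meanPayoff π i / 2))
    filter_upwards [h1, eventually_ge_atTop M, eventually_gt_atTop 0] with n h1 h2 h3
    have h3' : (0 : ℝ) < n := by exact_mod_cast h3
    rw [lt_div_iff₀ h3'] at h1
    have h4 : (M : ℝ) ≤ n := by exact_mod_cast h2
    rw [div_lt_iff₀ (by linarith [h i])] at hM
    have h6 := le_abs_self K
    nlinarith [h i]
  exact (eventually_all.2 this).exists

/-- The mean payoff does not depend on a finite prefix. -/
lemma meanPayoff_shift (π : ℕ → S) (m : ℕ) (i : Fin d) {c : ℝ}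
    (h : c < G.meanPayoff π i) : c ≤ G.meanPayoff (fun n => π (m + n)) i := by
  obtain ⟨W, hW0, hW⟩ := G.exists_weight_bound
  have h1 : ∀ᶠ n : ℕ in atTop, c < G.totalPayoff n π i / n :=
    eventually_lt_of_lt_liminf h (average_isBounded π i)
  obtain ⟨N, hN⟩ := eventually_atTop.1 h1
  refine le_meanPayoff_of_linear (N := N + 1) (K := m * W + m * |c|) fun n hn => ?_
  have h2 := hN (m + n) (by omega)
  have h3 : (0 : ℝ) < (m + n : ℕ) := by
    have : 0 < m + n := by omega
    exact_mod_cast this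
  rw [lt_div_iff₀ h3] at h2
  have h4 : G.totalPayoff (m + n) π i
      = G.totalPayoff m π i + G.totalPayoff n (fun k => π (m + k)) i := by
    unfold totalPayoff
    rw [Finset.sum_range_add]
    rfl
  have h5 := (abs_le.1 (abs_totalPayoff_le hW m π i)).2
  have h6 := neg_abs_le c
  have h7 : (0 : ℝ) ≤ m := Nat.cast_nonneg m
  push_cast at h2
  rw [h4] at h2
  nlinarith

end payoff

namespace Strategy

variable (f : G.Strategy)

instance : DiscreteMeasurableSpace f.Conf := ⟨fun _ => trivial⟩

lemma finite_conf (hf : f.IsFiniteMemory) : Finite f.Conf := by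
  have : Finite f.Mem := hf
  exact Finite.of_injective (fun c : f.Conf => (c.state, c.mem)) fun a b h => by
    cases a; cases b; simpa using h

/-- The path measure of the induced chain for an arbitrary initial distribution. -/
noncomputable def chainMeasure (α : PMF f.Conf) : Measure (ℕ → f.Conf) :=
  Kernel.trajMeasure (X := fun _ => f.Conf) α.toMeasure f.histKernel

instance (α : PMF f.Conf) : IsProbabilityMeasure (f.chainMeasure α) := by
  have : IsProbabilityMeasure α.toMeasure := PMF.toMeasure.isProbabilityMeasure α
  unfold chainMeasure
  infer_instance

/-- The transition matrix of the induced chain. -/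
noncomputable def matrix (c c' : f.Conf) : ℝ := (f.step c c').toReal

lemma isStochastic_matrix [Fintype f.Conf] : IsStochastic f.matrix :=
  ⟨fun _ _ => ENNReal.toReal_nonneg, fun c => (f.step c).sum_toReal⟩

lemma matrix_pos_iff {c c' : f.Conf} : 0 < f.matrix c c' ↔ c' ∈ (f.step c).support :=
  PMF.toReal_pos_iff _ _

variable [Fintype f.Conf] (α : PMF f.Conf)

lemma integral_chainMeasure_zero (φ : f.Conf → ℝ) :
    ∫ ρ, φ (ρ 0) ∂(f.chainMeasure α) = ∑ c, (α c).toReal * φ c := by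
  have hmap : (f.chainMeasure α).map (fun ρ => ρ 0) = α.toMeasure := by
    have : IsProbabilityMeasure α.toMeasure := PMF.toMeasure.isProbabilityMeasure α
    have h1 : (f.chainMeasure α).map (Preorder.frestrictLe 0)
        = α.toMeasure.map (MeasurableEquiv.piUnique fun _ : Finset.Iic 0 => f.Conf).symm := by
      unfold chainMeasure Kernel.trajMeasure
      rw [Measure.map_comp _ _ (by fun_prop), Kernel.traj_map_frestrictLe,
        Kernel.partialTraj_self, Measure.id_comp]
    have h2 : (fun ρ : ℕ → f.Conf => ρ 0)
        = (fun h : (Finset.Iic 0 → f.Conf) => h ⟨0, Finset.mem_Iic.2 le_rfl⟩)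
          ∘ Preorder.frestrictLe (π := fun _ => f.Conf) 0 := rfl
    rw [h2, ← Measure.map_map (by fun_prop) (by fun_prop), h1,
      Measure.map_map (by fun_prop) (by fun_prop)]
    exact Measure.map_id
  rw [← integral_map (φ := fun ρ : ℕ → f.Conf => ρ 0) (f := φ)
    (measurable_pi_apply 0).aemeasurable
    (measurable_of_finite φ).aestronglyMeasurable, hmap, PMF.integral_eq_sum]
  rfl

/-- The Markov property. -/
lemma integral_chainMeasure_succ (n : ℕ) (Φ : (ℕ → f.Conf) → f.Conf → ℝ)
    (hΦ : ∀ ρ ρ' c, (∀ k ≤ n, ρ k = ρ' k) → Φ ρ c = Φ ρ' c) :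
    ∫ ρ, Φ ρ (ρ (n + 1)) ∂(f.chainMeasure α)
      = ∫ ρ, ∑ c, f.matrix (ρ n) c * Φ ρ c ∂(f.chainMeasure α) := by
  have : IsProbabilityMeasure α.toMeasure := PMF.toMeasure.isProbabilityMeasure α
  set μ := f.chainMeasure α with hμ
  -- A history is continued by its last entry. Since `Φ` looks only at the times up to `n`, it
  -- becomes a function on the finite space of histories.
  set ex : (Finset.Iic n → f.Conf) → ℕ → f.Conf :=
    fun h k => h ⟨min k n, Finset.mem_Iic.2 (min_le_right _ _)⟩ with hex
  have hagree : ∀ ρ : ℕ → f.Conf, ∀ k ≤ n,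
      ρ k = ex (Preorder.frestrictLe (π := fun _ => f.Conf) n ρ) k := by
    intro ρ k hk
    simp [hex, Preorder.frestrictLe, hk]
  set F : (Finset.Iic n → f.Conf) × f.Conf → ℝ := fun x => Φ (ex x.1) x.2 with hF
  have hkey := Kernel.map_frestrictLe_trajMeasure_compProd_eq_map_trajMeasure
    (X := fun _ => f.Conf) (κ := f.histKernel) (μ₀ := α.toMeasure) (a := n)
  change (μ.map (Preorder.frestrictLe n)) ⊗ₘ f.histKernel n =
    μ.map (fun x => (Preorder.frestrictLe n x, x (n + 1))) at hkey
  have hFm : Measurable F := measurable_of_finite F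
  have : IsProbabilityMeasure (μ.map (Preorder.frestrictLe (π := fun _ => f.Conf) n)) :=
    Measure.isProbabilityMeasure_map (by fun_prop)
  calc ∫ ρ, Φ ρ (ρ (n + 1)) ∂μ
      = ∫ ρ, F (Preorder.frestrictLe n ρ, ρ (n + 1)) ∂μ :=
        integral_congr_ae (Eventually.of_forall fun ρ => hΦ _ _ _ (hagree ρ))
    _ = ∫ x, F x ∂(μ.map (fun x => (Preorder.frestrictLe n x, x (n + 1)))) :=
        (integral_map (by fun_prop) hFm.aestronglyMeasurable).symm
    _ = ∫ x, F x ∂((μ.map (Preorder.frestrictLe n)) ⊗ₘ f.histKernel n) := by rw [hkey]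
    _ = ∫ h, ∫ c, F (h, c) ∂(f.histKernel n h) ∂(μ.map (Preorder.frestrictLe n)) :=
        Measure.integral_compProd Integrable.of_finite
    _ = ∫ h, ∑ c, f.matrix (h ⟨n, Finset.mem_Iic.2 le_rfl⟩) c * F (h, c)
          ∂(μ.map (Preorder.frestrictLe n)) := by
        refine integral_congr_ae (Eventually.of_forall fun h => ?_)
        have : f.histKernel n h = (f.step (h ⟨n, Finset.mem_Iic.2 le_rfl⟩)).toMeasure := rfl
        simp only [this]
        rw [PMF.integral_eq_sum]
        rfl
    _ = ∫ ρ, ∑ c, f.matrix (ρ n) c * F (Preorder.frestrictLe n ρ, c) ∂μ := by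
        rw [integral_map (by fun_prop) (measurable_of_finite _).aestronglyMeasurable]
        rfl
    _ = _ := integral_congr_ae (Eventually.of_forall fun ρ =>
        Finset.sum_congr rfl fun c _ => by rw [hΦ _ _ c (hagree ρ)])

lemma integral_chainMeasure_law (n : ℕ) (φ : f.Conf → ℝ) :
    ∫ ρ, φ (ρ n) ∂(f.chainMeasure α)
      = ∑ c, evolve f.matrix (fun c => (α c).toReal) n c * φ c := by
  induction n generalizing φ with
  | zero => exact f.integral_chainMeasure_zero α φ
  | succ n ih =>
    rw [f.integral_chainMeasure_succ α n (fun _ c => φ c) fun _ _ _ _ => rfl,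
      ih fun c => ∑ c', f.matrix c c' * φ c']
    simp only [evolve, Finset.mul_sum, Finset.sum_mul]
    rw [Finset.sum_comm]
    exact Finset.sum_congr rfl fun _ _ => Finset.sum_congr rfl fun _ _ => by ring

lemma integral_chainMeasure_pair (n : ℕ) (φ : f.Conf → f.Conf → ℝ) :
    ∫ ρ, φ (ρ n) (ρ (n + 1)) ∂(f.chainMeasure α)
      = ∑ c, evolve f.matrix (fun c => (α c).toReal) n c * ∑ c', f.matrix c c' * φ c c' := by
  rw [f.integral_chainMeasure_succ α n (fun ρ c => φ (ρ n) c)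
    (fun _ _ _ h => by rw [h n le_rfl])]
  exact f.integral_chainMeasure_law α n fun c => ∑ c', f.matrix c c' * φ c c'

lemma measurable_path (n : ℕ) (φ : f.Conf → f.Conf → ℝ) :
    Measurable fun ρ : ℕ → f.Conf => φ (ρ n) (ρ (n + 1)) := by
  have h : Measurable fun x : f.Conf × f.Conf => φ x.1 x.2 := measurable_of_finite _
  exact h.comp (by fun_prop : Measurable fun ρ : ℕ → f.Conf => (ρ n, ρ (n + 1)))

lemma integrable_path (n : ℕ) (φ : f.Conf → f.Conf → ℝ) :
    Integrable (fun ρ => φ (ρ n) (ρ (n + 1))) (f.chainMeasure α) := by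
  obtain ⟨W, hW⟩ := (Set.finite_range fun x : f.Conf × f.Conf => |φ x.1 x.2|).bddAbove
  exact Integrable.of_bound (f.measurable_path n φ).aestronglyMeasurable W
    (Eventually.of_forall fun ρ => hW ⟨(ρ n, ρ (n + 1)), rfl⟩)

/-- Almost surely, all transitions have positive probability. -/
lemma ae_chainMeasure_step :
    ∀ᵐ ρ ∂(f.chainMeasure α), ∀ n, ρ (n + 1) ∈ (f.step (ρ n)).support := by
  classical
  rw [ae_all_iff]
  intro n
  have h0 := f.integral_chainMeasure_pair α n fun c c' => if 0 < f.matrix c c' then 0 else 1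
  have h1 : ∀ c, ∑ c', f.matrix c c' * (if 0 < f.matrix c c' then (0 : ℝ) else 1) = 0 := by
    intro c
    refine Finset.sum_eq_zero fun c' _ => ?_
    split_ifs with h
    · simp
    · have : f.matrix c c' = 0 := le_antisymm (not_lt.1 h) (f.isStochastic_matrix.nonneg c c')
      simp [this]
  simp only [h1, mul_zero, Finset.sum_const_zero] at h0
  rw [integral_eq_zero_iff_of_nonneg (fun ρ => by dsimp only; split_ifs <;> norm_num)
    (f.integrable_path α n fun c c' => if 0 < f.matrix c c' then 0 else 1)] at h0
  filter_upwards [h0] with ρ hρ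
  by_contra hc
  rw [← matrix_pos_iff] at hc
  simp [hc] at hρ

/-- Almost surely, the initial state has positive probability. -/
lemma ae_chainMeasure_zero : ∀ᵐ ρ ∂(f.chainMeasure α), ρ 0 ∈ α.support := by
  classical
  have h0 := f.integral_chainMeasure_zero α fun c => if c ∈ α.support then 0 else 1
  have h1 : ∀ c, (α c).toReal * (if c ∈ α.support then (0 : ℝ) else 1) = 0 := by
    intro c
    split_ifs with h
    · simp
    · rw [PMF.mem_support_iff, not_not] at h
      simp [h]
  simp only [h1, Finset.sum_const_zero] at h0
  rw [integral_eq_zero_iff_of_nonneg (fun ρ => by dsimp only; split_ifs <;> norm_num)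
    (f.integrable_path α 0 fun c _ => if c ∈ α.support then 0 else 1)] at h0
  filter_upwards [h0] with ρ hρ
  by_contra hc
  simp [hc] at hρ

/-- If `h` is a lower bound of the drift of the payoff `r` up to the coboundary of `g`, then almost
surely the average payoff is asymptotically at least the average of `h`. -/
lemma ae_average_ge (r : f.Conf → f.Conf → ℝ) (h g : f.Conf → ℝ)
    (hdrift : ∀ c, h c + g c ≤ ∑ c', f.matrix c c' * (r c c' + g c')) :
    ∀ᵐ ρ ∂(f.chainMeasure α), ∀ ε > 0, ∀ᶠ n : ℕ in atTop,
      -ε * n ≤ ∑ k ∈ Finset.range n, (r (ρ k) (ρ (k + 1)) - h (ρ k)) := by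
  set μ := f.chainMeasure α with hμ
  obtain ⟨M, hM⟩ := (Set.finite_range fun c : f.Conf => |g c|).bddAbove
  have hM : ∀ c, |g c| ≤ M := fun c => hM ⟨c, rfl⟩
  -- The accuracies `1 / (m + 1)` are countably many, so one null set serves for all `ε`.
  have main : ∀ m : ℕ, ∀ᵐ ρ ∂μ, ∀ᶠ n : ℕ in atTop,
      -(1 / ((m : ℝ) + 1)) * n < ∑ k ∈ Finset.range n, (r (ρ k) (ρ (k + 1)) - h (ρ k)) := by
    intro m
    set ε : ℝ := 1 / ((m : ℝ) + 1) with hε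
    have hε0 : 0 < ε := by positivity
    -- By `hdrift`, this increment has conditional mean at least `ε / 2`; hence for small `l` the
    -- process `Y` below is a positive supermartingale.
    set D : f.Conf → f.Conf → ℝ := fun c c' => r c c' - h c + g c' - g c + ε / 2 with hD
    obtain ⟨B0, hB0⟩ := (Set.finite_range fun x : f.Conf × f.Conf => |D x.1 x.2|).bddAbove
    set B := max B0 1 with hB
    have hB1 : 1 ≤ B := le_max_right _ _
    have hDB : ∀ c c', |D c c'| ≤ B := fun c c' => (hB0 ⟨(c, c'), rfl⟩).trans (le_max_left _ _)
    set l := min (1 / B) (ε / 2 / B ^ 2) with hl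
    have hl0 : 0 < l := by positivity
    have hlB : l * B ≤ 1 := by
      rw [← le_div_iff₀ (by positivity)]; exact min_le_left _ _
    have hlδ : l * B ^ 2 ≤ ε / 2 := by
      rw [← le_div_iff₀ (by positivity)]; exact min_le_right _ _
    have hexp : ∀ c, ∑ c', f.matrix c c' * Real.exp (-l * D c c') ≤ 1 := by
      intro c
      refine sum_mul_exp_neg_le_one (fun c' => f.isStochastic_matrix.nonneg c c')
        (f.isStochastic_matrix.sum_eq_one c) (fun c' _ => hDB c c') ?_ hl0.le hlB hlδ
      have h1 : ∑ c', f.matrix c c' * D c c'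
          = ∑ c', f.matrix c c' * (r c c' + g c') + (ε / 2 - h c - g c) := by
        have h2 := f.isStochastic_matrix.sum_eq_one c
        calc ∑ c', f.matrix c c' * D c c'
            = ∑ c', (f.matrix c c' * (r c c' + g c') + f.matrix c c' * (ε / 2 - h c - g c)) :=
              Finset.sum_congr rfl fun c' _ => by rw [hD]; ring
          _ = _ := by rw [Finset.sum_add_distrib, ← Finset.sum_mul, h2, one_mul]
      rw [h1]
      linarith [hdrift c]
    set Y : ℕ → (ℕ → f.Conf) → ℝ := fun n ρ =>
      Real.exp (-l * ∑ k ∈ Finset.range n, D (ρ k) (ρ (k + 1))) with hY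
    have hYm : ∀ n, Measurable (Y n) := fun n =>
      Real.measurable_exp.comp ((Finset.measurable_sum _ fun k _ =>
        f.measurable_path k D).const_mul (-l))
    have hYint : ∀ n, Integrable (Y n) μ := fun n =>
      Integrable.of_bound (hYm n).aestronglyMeasurable (Real.exp (l * (n * B)))
        (Eventually.of_forall fun ρ => by
          rw [Real.norm_eq_abs, abs_of_pos (Real.exp_pos _)]
          apply Real.exp_le_exp.2
          have : |∑ k ∈ Finset.range n, D (ρ k) (ρ (k + 1))| ≤ n * B :=
            (Finset.abs_sum_le_sum_abs _ _).trans
              ((Finset.sum_le_sum fun k _ => hDB _ _).trans_eq (by simp))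
          have := (abs_le.1 this).1
          nlinarith)
    have hYle : ∀ n, ∫ ρ, Y n ρ ∂μ ≤ 1 := by
      intro n
      induction n with
      | zero => simp [hY]
      | succ n ih =>
        have e1 : ∫ ρ, Y (n + 1) ρ ∂μ = ∫ ρ, Y n ρ * Real.exp (-l * D (ρ n) (ρ (n + 1))) ∂μ := by
          refine integral_congr_ae (Eventually.of_forall fun ρ => ?_)
          simp only [hY]
          rw [← Real.exp_add, Finset.sum_range_succ]
          congr 1
          ring
        rw [e1, f.integral_chainMeasure_succ α n
          (fun ρ c => Y n ρ * Real.exp (-l * D (ρ n) c)) (fun ρ ρ' c hag => by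
            have : ∑ k ∈ Finset.range n, D (ρ k) (ρ (k + 1))
                = ∑ k ∈ Finset.range n, D (ρ' k) (ρ' (k + 1)) := by
              refine Finset.sum_congr rfl fun k hk => ?_
              have hk := Finset.mem_range.1 hk
              rw [hag k (by omega), hag (k + 1) (by omega)]
            simp only [hY]
            rw [this, hag n le_rfl])]
        refine le_trans (integral_mono_of_nonneg (Eventually.of_forall fun ρ => ?_) (hYint n)
          (Eventually.of_forall fun ρ => ?_)) ih
        · exact Finset.sum_nonneg fun c _ => mul_nonneg (f.isStochastic_matrix.nonneg _ _)
            (mul_nonneg (Real.exp_pos _).le (Real.exp_pos _).le)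
        · have : ∑ c, f.matrix (ρ n) c * (Y n ρ * Real.exp (-l * D (ρ n) c))
              = Y n ρ * ∑ c, f.matrix (ρ n) c * Real.exp (-l * D (ρ n) c) := by
            rw [Finset.mul_sum]
            exact Finset.sum_congr rfl fun c _ => by ring
          simp only [this]
          exact mul_le_of_le_one_right (Real.exp_pos _).le (hexp (ρ n))
    have hsum : ∀ (n : ℕ) (ρ : ℕ → f.Conf), ∑ k ∈ Finset.range n, D (ρ k) (ρ (k + 1))
        = ∑ k ∈ Finset.range n, (r (ρ k) (ρ (k + 1)) - h (ρ k)) + (g (ρ n) - g (ρ 0))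
          + n * (ε / 2) := by
      intro n ρ
      induction n with
      | zero => simp
      | succ n ih =>
        rw [Finset.sum_range_succ, Finset.sum_range_succ, ih]
        push_cast
        rw [hD]; ring
    set bad : ℕ → Set (ℕ → f.Conf) := fun n =>
      {ρ | ∑ k ∈ Finset.range n, (r (ρ k) (ρ (k + 1)) - h (ρ k)) ≤ -ε * n} with hbad
    -- A Chernoff bound: on `bad n` the variable `Y n` is exponentially large in `n`, while its mean
    -- is at most `1`. The bound is geometric, so Borel–Cantelli applies.
    have hprob : ∀ n, μ (bad n)
        ≤ ENNReal.ofReal (Real.exp (l * (2 * M)) * Real.exp (-(l * (ε / 2))) ^ n) := by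
      intro n
      have hsub : bad n ⊆ {ρ | Real.exp (l * (n * (ε / 2) - 2 * M)) ≤ Y n ρ} := by
        intro ρ hρ
        simp only [Set.mem_ofPred_eq, hY]
        apply Real.exp_le_exp.2
        rw [hsum]
        have hρ' : ∑ k ∈ Finset.range n, (r (ρ k) (ρ (k + 1)) - h (ρ k)) ≤ -ε * n := hρ
        have g1 := (abs_le.1 (hM (ρ n))).2
        have g2 := (abs_le.1 (hM (ρ 0))).1
        nlinarith
      have hmarkov := mul_meas_ge_le_integral_of_nonneg (μ := μ)
        (Eventually.of_forall fun ρ => (Real.exp_pos _).le) (hYint n)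
        (Real.exp (l * (n * (ε / 2) - 2 * M)))
      have hreal : μ.real (bad n) ≤ Real.exp (l * (2 * M)) * Real.exp (-(l * (ε / 2))) ^ n := by
        have h1 : μ.real (bad n)
            ≤ μ.real {ρ | Real.exp (l * (n * (ε / 2) - 2 * M)) ≤ Y n ρ} :=
          measureReal_mono hsub
        have h2 : Real.exp (l * (n * (ε / 2) - 2 * M))
            * (Real.exp (l * (2 * M)) * Real.exp (-(l * (ε / 2))) ^ n) = 1 := by
          rw [← Real.exp_nat_mul, ← Real.exp_add, ← Real.exp_add, ← Real.exp_zero]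
          congr 1
          ring
        have h3 := Real.exp_pos (l * (n * (ε / 2) - 2 * M))
        have h4 : Real.exp (l * (n * (ε / 2) - 2 * M)) * μ.real (bad n) ≤ 1 :=
          (mul_le_mul_of_nonneg_left h1 h3.le).trans (hmarkov.trans (hYle n))
        rw [← h2] at h4
        exact le_of_mul_le_mul_left h4 h3
      rw [← ENNReal.ofReal_toReal (measure_ne_top μ (bad n))]
      exact ENNReal.ofReal_le_ofReal hreal
    have hfin : ∑' n, μ (bad n) ≠ ⊤ := by
      refine ne_top_of_le_ne_top ?_ (ENNReal.tsum_le_tsum hprob)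
      apply Summable.tsum_ofReal_ne_top
      apply Summable.mul_left
      apply summable_geometric_of_lt_one (Real.exp_pos _).le
      rw [Real.exp_lt_one_iff]
      have : 0 < l * (ε / 2) := by positivity
      linarith
    filter_upwards [ae_eventually_notMem hfin] with ρ hρ
    filter_upwards [hρ] with n hn
    exact not_le.1 hn
  filter_upwards [ae_all_iff.2 main] with ρ hρ ε hε
  obtain ⟨m, hm⟩ := exists_nat_one_div_lt hε
  filter_upwards [hρ m] with n hn
  have : (0 : ℝ) ≤ n := Nat.cast_nonneg n
  nlinarith

/-- The expected mean payoff is at most every limit point of the expected average payoffs. -/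
lemma integral_meanPayoff_le (i : Fin d) {φ : ℕ → ℕ} (hφ : StrictMono φ) {l : ℝ}
    (hl : Tendsto (fun k => (∑ j ∈ Finset.range (φ k), ∑ c,
      evolve f.matrix (fun c => (α c).toReal) j c *
        ∑ c', f.matrix c c' * (G.w c.state c'.state i : ℝ)) / φ k) atTop (𝓝 l)) :
    ∫ ρ, G.meanPayoff (fun n => (ρ n).state) i ∂(f.chainMeasure α) ≤ l := by
  obtain ⟨W, hW0, hW⟩ := G.exists_weight_bound
  refine integral_liminf_le_of_tendsto (f.chainMeasure α)
    (a := fun n ρ => G.totalPayoff n (fun n => (ρ n).state) i / n) (fun n => ?_)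
    (fun n ρ => abs_average_le hW0 hW n _ i) hφ ?_
  · exact (Finset.measurable_sum _ fun k _ =>
      f.measurable_path k fun c c' => (G.w c.state c'.state i : ℝ)).div_const _
  · convert hl using 2 with k
    rw [integral_div]
    congr 1
    unfold totalPayoff
    rw [integral_finsetSum _ fun k _ =>
      f.integrable_path α k fun c c' => (G.w c.state c'.state i : ℝ)]
    exact Finset.sum_congr rfl fun j _ =>
      f.integral_chainMeasure_pair α j fun c c' => (G.w c.state c'.state i : ℝ)

lemma integrable_meanPayoff (i : Fin d) :
    Integrable (fun ρ => G.meanPayoff (fun n => (ρ n).state) i) (f.chainMeasure α) := by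
  obtain ⟨W, hW0, hW⟩ := G.exists_weight_bound
  refine Integrable.of_bound (Measurable.aestronglyMeasurable ?_) W
    (Eventually.of_forall fun ρ => abs_meanPayoff_le hW0 hW _ i)
  unfold meanPayoff
  exact Measurable.liminf fun n => (Finset.measurable_sum _ fun k _ =>
      f.measurable_path k fun c c' => (G.w c.state c'.state i : ℝ)).div_const _

end Strategy

end MDP

lemma PMF.isRational_pure {A : Type*} (a : A) : (PMF.pure a).IsRational := by
  classical
  intro b
  rw [PMF.pure_apply]
  split_ifs
  · exact ⟨1, by simp⟩
  · exact ⟨0, by simp⟩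

/-! ### Outcomes of strategies, and payoffs that can be forced in bounded time. -/

namespace MDP

variable {S : Type*} [Fintype S] {d : ℕ} {G : MDP S d}

namespace Strategy

lemma next_of_mem (f : G.Strategy) {c : f.Conf} (h : c.state ∈ G.ctrl) :
    f.next c = f.out c.state h c.mem := by
  unfold next; rw [dif_pos h]

lemma next_of_notMem (f : G.Strategy) {c : f.Conf} (h : c.state ∉ G.ctrl) :
    f.next c = G.R c.state h := by
  unfold next; rw [dif_neg h]

lemma edge_of_mem_next (f : G.Strategy) {c : f.Conf} {t : S} (h : t ∈ (f.next c).support) :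
    G.E c.state t := by
  by_cases hc : c.state ∈ G.ctrl
  · rw [f.next_of_mem hc] at h
    exact f.out_support _ _ _ _ h
  · rw [f.next_of_notMem hc] at h
    exact (G.R_support _ hc t).1 h

lemma mem_support_step (f : G.Strategy) {c c' : f.Conf} :
    c' ∈ (f.step c).support ↔
      c'.state ∈ (f.next c).support ∧ c'.mem ∈ (f.upd c.state c.mem).support := by
  unfold step
  simp only [PMF.mem_support_bind_iff, PMF.mem_support_map_iff]
  constructor
  · rintro ⟨s, hs, m, hm, rfl⟩
    exact ⟨hs, hm⟩
  · rintro ⟨hs, hm⟩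
    exact ⟨_, hs, _, hm, rfl⟩

lemma updSeq_append (f : G.Strategy) (l : List S) (s : S) :
    f.updSeq (l ++ [s]) = (f.updSeq l).bind (f.upd s) := by
  unfold updSeq
  rw [List.foldl_append]
  rfl

/-- The paths of the induced chain project to outcomes. -/
lemma outcome_of_path (f : G.Strategy) {ρ : ℕ → f.Conf} (h0 : (ρ 0).mem ∈ f.init.support)
    (hstep : ∀ n, ρ (n + 1) ∈ (f.step (ρ n)).support) :
    (fun n => (ρ n).state) ∈ f.Outcome (ρ 0).state := by
  have hmem : ∀ n, (ρ n).mem ∈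
      (f.updSeq ((List.range n).map fun n => (ρ n).state)).support := by
    intro n
    induction n with
    | zero => exact h0
    | succ n ih =>
      rw [List.range_succ, List.map_append, List.map_singleton, updSeq_append,
        PMF.mem_support_bind_iff]
      exact ⟨_, ih, (f.mem_support_step.1 (hstep n)).2⟩
  refine ⟨rfl, fun n => f.edge_of_mem_next (f.mem_support_step.1 (hstep n)).1, fun n hn => ?_⟩
  unfold outSeq
  rw [PMF.mem_support_bind_iff]
  refine ⟨_, hmem n, ?_⟩
  have := (f.mem_support_step.1 (hstep n)).1
  rwa [f.next_of_mem hn] at this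

end Strategy

/-- Controller can guarantee, from `s` with accumulated payoff `v`, to reach an accumulated payoff
of at least `1` in every component within `n` steps, without leaving `U`. -/
def Force (G : MDP S d) (U : Finset S) : ℕ → S → (Fin d → ℤ) → Prop
  | 0, _, v => ∀ i, 1 ≤ v i
  | n + 1, s, v => (∀ i, 1 ≤ v i) ∨
      (s ∈ G.ctrl ∧ ∃ t ∈ U, G.E s t ∧ G.Force U n t (v + G.w s t)) ∨
      (s ∉ G.ctrl ∧ ∀ t, G.E s t → t ∈ U ∧ G.Force U n t (v + G.w s t))

variable {U : Finset S}

lemma force_of_one_le {n : ℕ} {s : S} {v : Fin d → ℤ} (h : ∀ i, 1 ≤ v i) : G.Force U n s v := by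
  cases n with
  | zero => exact h
  | succ n => exact Or.inl h

/-- Concatenation: where the first forcing succeeds with payoff `u`, a second one takes over from `u
+ c`; the offset `c` is carried along unchanged. -/
lemma Force.comp {n m : ℕ} {s : S} {v c : Fin d → ℤ} (h : G.Force U n s v) (hs : s ∈ U)
    (hc : ∀ t ∈ U, ∀ u : Fin d → ℤ, (∀ i, 1 ≤ u i) → ∀ k ≥ m, G.Force U k t (u + c)) :
    ∀ k ≥ n + m, G.Force U k s (v + c) := by
  induction n generalizing s v with
  | zero => exact fun k hk => hc s hs v h k (by omega)
  | succ n ih =>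
    intro k hk
    obtain ⟨k, rfl⟩ : ∃ j, k = j + 1 := ⟨k - 1, by omega⟩
    rcases h with h | ⟨h1, t, ht, hE, h⟩ | ⟨h1, h⟩
    · exact hc s hs v h _ (by omega)
    · refine Or.inr (Or.inl ⟨h1, t, ht, hE, ?_⟩)
      have := ih h ht k (by omega)
      rwa [add_right_comm] at this
    · refine Or.inr (Or.inr ⟨h1, fun t hE => ⟨(h t hE).1, ?_⟩⟩)
      have := ih (h t hE).2 (h t hE).1 k (by omega)
      rwa [add_right_comm] at this

lemma Force.mono {n k : ℕ} {s : S} {v : Fin d → ℤ} (h : G.Force U n s v) (hk : n ≤ k) :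
    G.Force U k s v := by
  induction n generalizing s v k with
  | zero => exact force_of_one_le h
  | succ n ih =>
    obtain ⟨k, rfl⟩ : ∃ j, k = j + 1 := ⟨k - 1, by omega⟩
    rcases h with h | ⟨h1, t, ht, hE, h⟩ | ⟨h1, h⟩
    · exact Or.inl h
    · exact Or.inr (Or.inl ⟨h1, t, ht, hE, ih h (by omega)⟩)
    · exact Or.inr (Or.inr ⟨h1, fun t hE => ⟨(h t hE).1, ih (h t hE).2 (by omega)⟩⟩)

/-- Deficits can be made up for in linear time. -/
lemma force_of_deficit {n₀ : ℕ} (h0 : ∀ s ∈ U, G.Force U n₀ s 0) (m : ℕ) {s : S} (hs : s ∈ U)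
    {v : Fin d → ℤ} (hv : ∀ i, -(m : ℤ) ≤ v i) : G.Force U (n₀ * (m + 1)) s v := by
  induction m generalizing s v with
  | zero =>
    have := (h0 s hs).comp (m := 0) (c := v) hs
      (fun t _ u hu k _ => force_of_one_le fun i => by
        have := hv i; have := hu i; simp only [Pi.add_apply]; push_cast at *; omega)
    simpa using this _ le_rfl
  | succ m ih =>
    -- One round of at most `n₀` steps gains at least `1` in every component, which lowers the
    -- deficit to `m`.
    have := (h0 s hs).comp (m := n₀ * (m + 1)) (c := v) hs
      (fun t ht u hu k hk => (ih ht fun i => by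
        have := hv i; have := hu i; simp only [Pi.add_apply]; push_cast at *; omega).mono hk)
    have := this (n₀ * (m + 1 + 1)) (by ring_nf; omega)
    simpa using this

/-- A strategy with positive worst-case mean payoff reaches payoff `1` in bounded time. -/
lemma exists_force (f : G.Strategy) {s₀ : S}
    (hU : ∀ π ∈ f.Outcome s₀, ∀ n, π n ∈ U)
    (hpos : ∀ π ∈ f.Outcome s₀, ∀ i, 0 < G.meanPayoff π i) : ∃ n, G.Force U n s₀ 0 := by
  by_contra hno
  push Not at hno
  -- A Kőnig-type argument: if no time bound works at a state, then none works at some successor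
  -- allowed by `f`. At a state of Controller every successor in `U` inherits the failure; at a
  -- state of Random, bounds for the finitely many successors would have a maximum. That `t` lies in
  -- `U` is a hypothesis because it is known only once the whole play is known to be an outcome.
  have hnext : ∀ (l : List S) (s : S) (v : Fin d → ℤ), ∃ t, G.E s t ∧
      (∀ hs : s ∈ G.ctrl, t ∈ (f.outSeq l s hs).support) ∧
      (s ∈ U → (∀ n, ¬ G.Force U n s v) → t ∈ U → ∀ n, ¬ G.Force U n t (v + G.w s t)) := by
    intro l s v
    by_cases hs : s ∈ G.ctrl
    · obtain ⟨t, ht⟩ := (f.outSeq l s hs).support_nonempty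
      have hE : G.E s t := by
        unfold Strategy.outSeq at ht
        rw [PMF.mem_support_bind_iff] at ht
        obtain ⟨m, -, hm⟩ := ht
        exact f.out_support _ _ _ _ hm
      exact ⟨t, hE, fun _ => ht, fun _ hn htU n hF =>
        hn (n + 1) (Or.inr (Or.inl ⟨hs, t, htU, hE, hF⟩))⟩
    · by_cases hn : ∀ n, ¬ G.Force U n s v
      · by_contra hcon
        push Not at hcon
        have h2 : ∀ t, ∃ n, G.E s t → t ∈ U ∧ G.Force U n t (v + G.w s t) := by
          intro t
          by_cases hE : G.E s t
          · obtain ⟨-, -, h3, n, h4⟩ := hcon t hE (fun h => absurd h hs)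
            exact ⟨n, fun _ => ⟨h3, h4⟩⟩
          · exact ⟨0, fun h => absurd h hE⟩
        choose n hn2 using h2
        exact hn (Finset.univ.sup n + 1) (Or.inr (Or.inr ⟨hs, fun t hE =>
          ⟨(hn2 t hE).1, (hn2 t hE).2.mono (Finset.le_sup (Finset.mem_univ t))⟩⟩))
      · obtain ⟨t, hE⟩ := G.exists_succ s
        exact ⟨t, hE, fun h => absurd h hs, fun _ h => absurd h hn⟩
  choose nx hE hctrl hnot using hnext
  -- The triple consists of the history, the current state and the payoff so far.
  let seq : ℕ → List S × S × (Fin d → ℤ) := fun n => Nat.rec ([], s₀, 0)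
    (fun _ x => (x.1 ++ [x.2.1], nx x.1 x.2.1 x.2.2, x.2.2 + G.w x.2.1 (nx x.1 x.2.1 x.2.2))) n
  set π : ℕ → S := fun n => (seq n).2.1 with hπ
  have hl : ∀ n, (seq n).1 = (List.range n).map π := by
    intro n
    induction n with
    | zero => rfl
    | succ n ih =>
      rw [List.range_succ, List.map_append, ← ih]
      rfl
  have hout : π ∈ f.Outcome s₀ := by
    refine ⟨rfl, fun n => hE _ _ _, fun n hn => ?_⟩
    rw [← hl n]
    exact hctrl (seq n).1 (π n) (seq n).2.2 hn
  have hinv : ∀ n N, ¬ G.Force U N (π n) (seq n).2.2 := by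
    intro n
    induction n with
    | zero => exact hno
    | succ n ih => exact hnot _ _ _ (hU π hout n) ih (hU π hout (n + 1))
  have htot : ∀ n i, (((seq n).2.2 i : ℤ) : ℝ) = G.totalPayoff n π i := by
    intro n i
    induction n with
    | zero => simp [seq, totalPayoff]
    | succ n ih =>
      have : (seq (n + 1)).2.2 i = (seq n).2.2 i + G.w (π n) (π (n + 1)) i := rfl
      rw [this]
      unfold totalPayoff at *
      rw [Finset.sum_range_succ, ← ih]
      push_cast
      rfl
  -- Positive mean payoffs bring all components above `1` at a common time, where `Force` holds with
  -- bound `0`.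
  obtain ⟨n, hn⟩ := exists_totalPayoff_ge (hpos π hout) 1
  refine hinv n 0 fun i => ?_
  have := hn i
  rw [← htot] at this
  exact_mod_cast this

/-- Controller can repeatedly reach payoff `1` in bounded time inside of `U`. -/
def Profitable (G : MDP S d) (U : Finset S) : Prop :=
  ∃ n₀, ∀ s ∈ U, G.Force U n₀ s 0

lemma profitable_of_strategies
    (h : ∀ s ∈ U, ∃ f : G.Strategy, (∀ π ∈ f.Outcome s, ∀ n, π n ∈ U) ∧
      (0 : Fin d → ℝ) ∈ f.WCSol s) : G.Profitable U := by
  have h1 : ∀ s, ∃ n, s ∈ U → G.Force U n s 0 := by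
    intro s
    by_cases hs : s ∈ U
    · obtain ⟨f, hf1, hf2⟩ := h s hs
      obtain ⟨n, hn⟩ := exists_force f hf1 hf2
      exact ⟨n, fun _ => hn⟩
    · exact ⟨0, fun h => absurd h hs⟩
  choose n hn using h1
  exact ⟨Finset.univ.sup n, fun s hs => (hn s hs).mono (Finset.le_sup (Finset.mem_univ s))⟩

lemma IsWEC.profitable (h : G.IsWEC U) : G.Profitable U := profitable_of_strategies h.2

lemma IsPruned.profitable (h : G.IsPruned) : G.Profitable Finset.univ :=
  profitable_of_strategies fun s _ => by
    obtain ⟨f, hf⟩ := h s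
    exact ⟨f, fun _ _ _ => Finset.mem_univ _, hf.1⟩

/-- The least time in which payoff `1` can be guaranteed. -/
noncomputable def rank (G : MDP S d) (U : Finset S) (s : S) (v : Fin d → ℤ) : ℕ :=
  sInf {n | G.Force U n s v}

lemma rank_le {n : ℕ} {s : S} {v : Fin d → ℤ} (h : G.Force U n s v) : G.rank U s v ≤ n :=
  Nat.sInf_le h

lemma Profitable.force_rank (h : G.Profitable U) {s : S} (hs : s ∈ U) (v : Fin d → ℤ) :
    G.Force U (G.rank U s v) s v := by
  obtain ⟨n₀, hn⟩ := h
  obtain ⟨m, hm⟩ : ∃ m : ℕ, ∀ i, -(m : ℤ) ≤ v i := by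
    refine ⟨Finset.univ.sup fun i => (v i).natAbs, fun i => ?_⟩
    have : (v i).natAbs ≤ Finset.univ.sup fun i => (v i).natAbs :=
      Finset.le_sup (f := fun i => (v i).natAbs) (Finset.mem_univ i)
    omega
  exact Nat.sInf_mem (s := {n | G.Force U n s v}) ⟨_, force_of_deficit hn m hs hm⟩

lemma Profitable.rank_eq_zero (h : G.Profitable U) {s : S} (hs : s ∈ U) {v : Fin d → ℤ} :
    G.rank U s v = 0 ↔ ∀ i, 1 ≤ v i := by
  constructor
  · intro h0
    have := h.force_rank hs v
    rw [h0] at this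
    exact this
  · intro hv
    exact Nat.le_zero.1 (rank_le (force_of_one_le hv))

/-- A rational distribution on the successors of `s`, which is the given one at a state of
Random. -/
structure Move (G : MDP S d) (s : S) where
  /-- the distribution -/
  dist : PMF S
  rational : dist.IsRational
  support : ∀ t ∈ dist.support, G.E s t
  random : ∀ hs : s ∉ G.ctrl, dist = G.R s hs

/-- Unfolding one level of `Force` at the least possible time gives a move after which one step less
is needed. -/
lemma Profitable.exists_move (h : G.Profitable U) {s : S} (hs : s ∈ U) {v : Fin d → ℤ}
    (hr : 0 < G.rank U s v) : ∃ m : G.Move s, ∀ t ∈ m.dist.support,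
      t ∈ U ∧ G.rank U t (v + G.w s t) + 1 ≤ G.rank U s v := by
  obtain ⟨k, hk⟩ : ∃ k, G.rank U s v = k + 1 := ⟨G.rank U s v - 1, by omega⟩
  have hF := h.force_rank hs v
  rw [hk] at hF ⊢
  rcases hF with h1 | ⟨h1, t, ht, hE, h2⟩ | ⟨h1, h2⟩
  · rw [(h.rank_eq_zero hs).2 h1] at hr
    exact absurd hr (lt_irrefl _)
  · refine ⟨⟨PMF.pure t, PMF.isRational_pure t, ?_, fun h => absurd h1 h⟩, ?_⟩
    · intro t' ht'
      rw [PMF.mem_support_pure_iff] at ht'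
      exact ht' ▸ hE
    · intro t' ht'
      rw [PMF.mem_support_pure_iff] at ht'
      subst ht'
      exact ⟨ht, by have := rank_le h2; omega⟩
  · refine ⟨⟨G.R s h1, G.R_rational s h1, fun t ht => (G.R_support s h1 t).1 ht, fun _ => rfl⟩,
      fun t ht => ?_⟩
    have := h2 t ((G.R_support s h1 t).1 ht)
    exact ⟨this.1, by have := rank_le this.2; omega⟩

instance (s : S) : Nonempty (G.Move s) := by
  by_cases hs : s ∈ G.ctrl
  · obtain ⟨t, ht⟩ := G.exists_succ s
    exact ⟨⟨PMF.pure t, PMF.isRational_pure t, fun t' ht' => by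
      rw [PMF.mem_support_pure_iff] at ht'
      exact ht' ▸ ht, fun h => absurd hs h⟩⟩
  · exact ⟨⟨G.R s hs, G.R_rational s hs, fun t ht => (G.R_support s hs t).1 ht, fun _ => rfl⟩⟩

end MDP

/-! ### Plans, their finite memory, and their surely positive mean payoff. -/

namespace MDP

variable {S : Type*} [Fintype S] {d : ℕ} {G : MDP S d}

lemma exists_nat_weight_bound (G : MDP S d) : ∃ W : ℕ, ∀ s t i, |G.w s t i| ≤ W := by
  obtain ⟨W, hW⟩ := (Set.finite_range fun x : S × S × Fin d =>
    (G.w x.1 x.2.1 x.2.2).natAbs).bddAbove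
  refine ⟨W, fun s t i => ?_⟩
  have : (G.w s t i).natAbs ≤ W := hW ⟨(s, t, i), rfl⟩
  rw [Int.abs_eq_natAbs]
  exact_mod_cast this

/-- A bound of the weights. -/
noncomputable def weightBound (G : MDP S d) : ℕ := G.exists_nat_weight_bound.choose

lemma abs_weight_le (G : MDP S d) (s t : S) (i : Fin d) : |G.w s t i| ≤ G.weightBound :=
  G.exists_nat_weight_bound.choose_spec s t i

lemma abs_weight_le_real (G : MDP S d) (s t : S) (i : Fin d) :
    |(G.w s t i : ℝ)| ≤ G.weightBound := by
  exact_mod_cast G.abs_weight_le s t i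

/-- The control states of a plan: a counter for the initial steps; afterwards a mode `U`, the current
state, the number of steps in the current block, and the payoff in the current block. -/
inductive Phase (S : Type*) (d : ℕ)
  | start (n : ℕ)
  | block (U : Finset S) (s : S) (k : ℕ) (v : Fin d → ℤ)

/-- A plan of Controller. For `time` steps it makes the moves `first`. Then it fixes a mode `U` that
contains the current state, and plays blocks inside of `U`: it makes the move `gamble` for `len`
steps, and then moves that eventually make the payoff of the block at least `1`. -/
structure Plan (G : MDP S d) where
  time : ℕ
  len : ℕ
  first : ℕ → ∀ s, G.Move s
  gamble : ∀ s, G.Move s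
  mode : S → Finset S
  len_pos : 1 ≤ len
  mem_mode : ∀ s, s ∈ mode s
  profitable : ∀ s, G.Profitable (mode s)
  gamble_mem : ∀ s, ∀ t ∈ mode s, ∀ u ∈ (gamble t).dist.support, u ∈ mode s

namespace Plan

variable (P : G.Plan)

open Classical in
/-- The next control state, on arrival in a state of the MDP. -/
noncomputable def nx : Phase S d → S → Phase S d
  | .start n, t => if n < P.time then .start (n + 1) else .block (P.mode t) t 0 0
  | .block U s k v, t =>
      if P.len ≤ k + 1 ∧ ∀ i, 1 ≤ (v + G.w s t) i then .block U t 0 0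
      -- The counter stops at `P.len`, which marks the recovery phase and keeps the number of
      -- control states finite.
      else .block U t (min (k + 1) P.len) (v + G.w s t)

open Classical in
/-- A move that decreases the rank. -/
noncomputable def recover (U : Finset S) (s : S) (v : Fin d → ℤ) : G.Move s :=
  if h : ∃ m : G.Move s, ∀ t ∈ m.dist.support,
      t ∈ U ∧ G.rank U t (v + G.w s t) + 1 ≤ G.rank U s v then h.choose
  else Classical.arbitrary _

/-- The move in a control state. -/
noncomputable def mv : Phase S d → ∀ s, G.Move s
  -- The counter already includes the present state: the first move is made in `.start 1`.
  | .start n, s => P.first (n - 1) s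
  | .block U _ k v, s => if k < P.len then P.gamble s else recover U s v

lemma recover_spec {U : Finset S} (h : G.Profitable U) {s : S} (hs : s ∈ U) {v : Fin d → ℤ}
    (hr : 0 < G.rank U s v) : ∀ t ∈ (recover (G := G) U s v).dist.support,
      t ∈ U ∧ G.rank U t (v + G.w s t) + 1 ≤ G.rank U s v := by
  have hex := h.exists_move hs hr
  unfold recover
  rw [dif_pos hex]
  exact hex.choose_spec

lemma exists_delay : ∃ n₀, ∀ s, ∀ t ∈ P.mode s, G.Force (P.mode s) n₀ t 0 := by
  choose n hn using P.profitable
  exact ⟨Finset.univ.sup n, fun s t ht => (hn s t ht).mono (Finset.le_sup (Finset.mem_univ s))⟩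

/-- A common time in which payoff `1` can be guaranteed in every mode. -/
noncomputable def delay : ℕ := P.exists_delay.choose

lemma force_delay {U : Finset S} (hU : U ∈ Set.range P.mode) {t : S} (ht : t ∈ U) :
    G.Force U P.delay t 0 := by
  obtain ⟨s, rfl⟩ := hU
  exact P.exists_delay.choose_spec s t ht

lemma profitable' {U : Finset S} (hU : U ∈ Set.range P.mode) : G.Profitable U := by
  obtain ⟨s, rfl⟩ := hU
  exact P.profitable s

/-- A bound of the time for recovery. -/
noncomputable def slack : ℕ := P.delay * (G.weightBound * P.len + 1)

lemma rank_le_slack {U : Finset S} (hU : U ∈ Set.range P.mode) {t : S} (ht : t ∈ U)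
    {v : Fin d → ℤ} (hv : ∀ i, |v i| ≤ G.weightBound * P.len) : G.rank U t v ≤ P.slack := by
  refine rank_le (force_of_deficit (fun s hs => P.force_delay hU hs) _ ht fun i => ?_)
  have := (abs_le.1 (hv i)).1
  push_cast
  exact this

/-- The control states that can occur in a state of the MDP. -/
def Valid : Phase S d → S → Prop
  | .start n, _ => 1 ≤ n ∧ n ≤ P.time
  | .block U s' k v, s => s' = s ∧ U ∈ Set.range P.mode ∧ s ∈ U ∧
      ((k < P.len ∧ ∀ i, |v i| ≤ G.weightBound * k) ∨
        -- A recovery move raises `|v i|` by at most the weight bound and lowers the rank by at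
        -- least one, so the sum bounded here does not grow. It limits the payoffs that have to be
        -- remembered.
        (k = P.len ∧ 0 < G.rank U s v ∧ G.rank U s v ≤ P.slack ∧
          ∀ i, |v i| + G.weightBound * G.rank U s v ≤ G.weightBound * (P.len + P.slack : ℕ)))

lemma valid_block_zero {U : Finset S} (hU : U ∈ Set.range P.mode) {t : S} (ht : t ∈ U) :
    P.Valid (.block U t 0 0) t :=
  ⟨rfl, hU, ht, Or.inl ⟨P.len_pos, fun i => by simp⟩⟩

lemma valid_init (s : S) : P.Valid (P.nx (.start 0) s) s := by
  simp only [nx]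
  split_ifs with h
  · exact ⟨le_rfl, h⟩
  · exact P.valid_block_zero ⟨s, rfl⟩ (P.mem_mode s)

/-- The moves in a block: either a gamble, or a move that decreases the rank. -/
lemma block_cases {U : Finset S} {s' s : S} {k : ℕ} {v : Fin d → ℤ}
    (hx : P.Valid (.block U s' k v) s) :
    (k < P.len ∧ P.mv (.block U s' k v) s = P.gamble s) ∨
    (k = P.len ∧ ∀ t ∈ (P.mv (.block U s' k v) s).dist.support,
      G.rank U t (v + G.w s t) + 1 ≤ G.rank U s v) := by
  obtain ⟨rfl, hU, hs, h⟩ := hx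
  rcases h with ⟨hk, -⟩ | ⟨hk, hr, -, -⟩
  · exact Or.inl ⟨hk, if_pos hk⟩
  · refine Or.inr ⟨hk, fun t ht => ?_⟩
    have : P.mv (.block U s' k v) s' = recover U s' v := if_neg (by omega)
    rw [this] at ht
    exact (recover_spec (P.profitable' hU) hs hr t ht).2

lemma mem_of_mem_mv {U : Finset S} {s' s : S} {k : ℕ} {v : Fin d → ℤ}
    (hx : P.Valid (.block U s' k v) s) {t : S}
    (ht : t ∈ (P.mv (.block U s' k v) s).dist.support) : t ∈ U := by
  obtain ⟨rfl, hU, hs, h⟩ := hx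
  rcases h with ⟨hk, -⟩ | ⟨hk, hr, -, -⟩
  · have : P.mv (.block U s' k v) s' = P.gamble s' := if_pos hk
    rw [this] at ht
    obtain ⟨r, rfl⟩ := hU
    exact P.gamble_mem r s' hs t ht
  · have : P.mv (.block U s' k v) s' = recover U s' v := if_neg (by omega)
    rw [this] at ht
    exact (recover_spec (P.profitable' hU) hs hr t ht).1

/-- The invariant behind finite memory: `P.len` gambling steps change each component by at most
`weightBound * len`, from where recovery takes at most `slack` steps. -/
lemma valid_nx {x : Phase S d} {s : S} (hx : P.Valid x s) {t : S}
    (ht : t ∈ (P.mv x s).dist.support) : P.Valid (P.nx x t) t := by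
  cases x with
  | start n =>
    simp only [nx]
    split_ifs with h
    · exact ⟨by omega, h⟩
    · exact P.valid_block_zero ⟨t, rfl⟩ (P.mem_mode t)
  | block U s' k v =>
    have htU := P.mem_of_mem_mv hx ht
    have hcases := P.block_cases hx
    obtain ⟨rfl, hU, hs, h⟩ := hx
    simp only [nx]
    split_ifs with h1
    · exact P.valid_block_zero hU htU
    · have hw : ∀ i, |(v + G.w s' t) i| ≤ |v i| + G.weightBound := fun i =>
        (abs_add_le _ _).trans (by linarith [G.abs_weight_le s' t i])
      have hrpos : P.len ≤ k + 1 → 0 < G.rank U t (v + G.w s' t) := by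
        intro hk
        rw [Nat.pos_iff_ne_zero, Ne, (P.profitable' hU).rank_eq_zero htU]
        exact fun h2 => h1 ⟨hk, h2⟩
      refine ⟨rfl, hU, htU, ?_⟩
      rcases h with ⟨hk, hv⟩ | ⟨hk, hr, hrs, hv⟩
      · by_cases hk1 : k + 1 < P.len
        · left
          rw [min_eq_left hk1.le]
          refine ⟨hk1, fun i => (hw i).trans ?_⟩
          have := hv i
          push_cast
          linarith
        · right
          have hk2 : k + 1 = P.len := by omega
          rw [min_eq_right (by omega)]
          have hv' : ∀ i, |(v + G.w s' t) i| ≤ G.weightBound * P.len := by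
            intro i
            refine (hw i).trans ?_
            have := hv i
            rw [← hk2]
            push_cast
            linarith
          have hr := P.rank_le_slack hU htU hv'
          refine ⟨rfl, hrpos (by omega), hr, fun i => ?_⟩
          have h3 : (G.rank U t (v + G.w s' t) : ℤ) ≤ P.slack := by exact_mod_cast hr
          have h4 := hv' i
          have h5 : (0 : ℤ) ≤ G.weightBound := by positivity
          push_cast
          nlinarith
      · right
        rw [min_eq_right (by omega)]
        rcases hcases with ⟨hk', -⟩ | ⟨-, hdec⟩
        · omega
        have hd := hdec t ht
        refine ⟨rfl, hrpos (by omega), by omega, fun i => ?_⟩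
        have h3 : (G.rank U t (v + G.w s' t) : ℤ) + 1 ≤ G.rank U s' v := by exact_mod_cast hd
        have h4 := hv i
        have h5 : (0 : ℤ) ≤ G.weightBound := by positivity
        have h6 := hw i
        nlinarith

/-- The set of relevant control states. -/
def box : Set (Phase S d) :=
  Phase.start '' Set.Iic P.time ∪
    (fun x : Finset S × S × ℕ × (Fin d → ℤ) => Phase.block x.1 x.2.1 x.2.2.1 x.2.2.2) ''
      (Set.univ ×ˢ Set.univ ×ˢ Set.Iic P.len ×ˢ
        Set.Icc (fun _ => -(G.weightBound * (P.len + P.slack : ℕ) : ℤ))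
          (fun _ => (G.weightBound * (P.len + P.slack : ℕ) : ℤ)))

lemma finite_box : P.box.Finite :=
  ((Set.finite_Iic _).image _).union
    ((Set.finite_univ.prod (Set.finite_univ.prod
      ((Set.finite_Iic _).prod (Set.finite_Icc _ _)))).image _)

lemma mem_box {x : Phase S d} {s : S} (hx : P.Valid x s) : x ∈ P.box := by
  cases x with
  | start n => exact Or.inl ⟨n, hx.2, rfl⟩
  | block U s' k v =>
    obtain ⟨rfl, hU, hs, h⟩ := hx
    refine Or.inr ⟨(U, s', k, v), ⟨trivial, trivial, ?_, ?_⟩, rfl⟩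
    · rcases h with ⟨hk, -⟩ | ⟨hk, -⟩
      · exact hk.le
      · exact hk.le
    · have h0 : ∀ i, |v i| ≤ (G.weightBound * (P.len + P.slack : ℕ) : ℤ) := by
        intro i
        rcases h with ⟨hk, hv⟩ | ⟨hk, hr, -, hv⟩
        · refine (hv i).trans ?_
          have : k ≤ P.len + P.slack := by omega
          gcongr
        · have := hv i
          have h5 : (0 : ℤ) ≤ G.weightBound * G.rank U s' v := by positivity
          linarith
      exact ⟨fun i => (abs_le.1 (h0 i)).1, fun i => (abs_le.1 (h0 i)).2⟩

lemma start_mem_box : Phase.start 0 ∈ P.box := Or.inl ⟨0, Nat.zero_le _, rfl⟩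

/-- A numbering of the relevant control states. -/
noncomputable def code : P.box ≃ Fin (Nat.card P.box) :=
  haveI : Finite P.box := P.finite_box
  Finite.equivFin P.box

open Classical in
/-- The number of a control state. -/
noncomputable def enc (x : Phase S d) : Fin (Nat.card P.box) :=
  -- The default is irrelevant: every control state that occurs along a play lies in the box.
  P.code (if h : x ∈ P.box then ⟨x, h⟩ else ⟨.start 0, P.start_mem_box⟩)

/-- The control state with a given number. -/
noncomputable def dec (m : Fin (Nat.card P.box)) : Phase S d := (P.code.symm m).1

lemma dec_enc {x : Phase S d} (hx : x ∈ P.box) : P.dec (P.enc x) = x := by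
  unfold dec enc
  rw [dif_pos hx, Equiv.symm_apply_apply]

/-- The strategy that follows a plan. -/
noncomputable def strategy : G.Strategy where
  -- Memory sets live in `Type`, whereas `Phase S d` lives in the universe of `S`; this is why the
  -- control states are numbered.
  Mem := Fin (Nat.card P.box)
  init := PMF.pure (P.enc (.start 0))
  -- The stored control state is the one before the arrival in `s`; update and output both process
  -- the arrival first.
  upd s m := PMF.pure (P.enc (P.nx (P.dec m) s))
  out s _ m := (P.mv (P.nx (P.dec m) s) s).dist
  init_rational := PMF.isRational_pure _
  upd_rational _ _ := PMF.isRational_pure _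
  out_rational _ _ _ := Move.rational _
  out_support _ _ _ t ht := Move.support _ t ht

lemma isFiniteMemory : P.strategy.IsFiniteMemory := by
  unfold Strategy.IsFiniteMemory strategy
  infer_instance

/-- The control states along a play. -/
noncomputable def run (π : ℕ → S) : ℕ → Phase S d
  | 0 => P.nx (.start 0) (π 0)
  | n + 1 => P.nx (run π n) (π (n + 1))

/-- The moves along `π` are those of the plan. -/
def Follows (π : ℕ → S) : Prop :=
  ∀ n, π (n + 1) ∈ (P.mv (P.run π n) (π n)).dist.support

variable {P} {π : ℕ → S}

lemma Follows.valid (h : P.Follows π) (n : ℕ) : P.Valid (P.run π n) (π n) := by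
  induction n with
  | zero => exact P.valid_init (π 0)
  | succ n ih => exact P.valid_nx ih (h n)

/-- The updates are deterministic, so the memory distribution after any history is a point mass, and
consistency speaks about the move in a single control state. -/
lemma follows_of_outcome {s : S} (h : π ∈ P.strategy.Outcome s) : P.Follows π := by
  obtain ⟨-, hplay, hcons⟩ := h
  have key : ∀ n, P.Valid (P.run π n) (π n) ∧ ∃ m, P.strategy.updSeq ((List.range n).map π)
      = PMF.pure m ∧ P.nx (P.dec m) (π n) = P.run π n := by
    intro n
    have hstep : ∀ n, (∃ m, P.strategy.updSeq ((List.range n).map π)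
        = PMF.pure m ∧ P.nx (P.dec m) (π n) = P.run π n) →
        π (n + 1) ∈ (P.mv (P.run π n) (π n)).dist.support := by
      rintro n ⟨m, hm, hr⟩
      by_cases hc : π n ∈ G.ctrl
      · have := hcons n hc
        unfold Strategy.outSeq at this
        rw [hm, PMF.pure_bind] at this
        rw [← hr]
        exact this
      · rw [(P.mv (P.run π n) (π n)).random hc]
        exact (G.R_support _ hc _).2 (hplay n)
    induction n with
    | zero =>
      exact ⟨P.valid_init (π 0), P.enc (.start 0), rfl, by rw [P.dec_enc P.start_mem_box]; rfl⟩
    | succ n ih =>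
      have hs := hstep n ih.2
      refine ⟨P.valid_nx ih.1 hs, ?_⟩
      obtain ⟨hv, m, hm, hr⟩ := ih
      refine ⟨P.enc (P.run π n), ?_, ?_⟩
      · rw [List.range_succ, List.map_append, List.map_singleton, Strategy.updSeq_append, hm,
          PMF.pure_bind, ← hr]
        rfl
      · rw [P.dec_enc (P.mem_box hv)]
        rfl
  intro n
  obtain ⟨-, m, hm, hr⟩ := key n
  by_cases hc : π n ∈ G.ctrl
  · have := hcons n hc
    unfold Strategy.outSeq at this
    rw [hm, PMF.pure_bind] at this
    rw [← hr]
    exact this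
  · rw [(P.mv (P.run π n) (π n)).random hc]
    exact (G.R_support _ hc _).2 (hplay n)

lemma run_start (π : ℕ → S) {n : ℕ} (h : n < P.time) : P.run π n = .start (n + 1) := by
  induction n with
  | zero => exact if_pos h
  | succ n ih =>
    change P.nx (P.run π n) (π (n + 1)) = _
    rw [ih (by omega)]
    exact if_pos h

lemma run_time (π : ℕ → S) : P.run π P.time = .block (P.mode (π P.time)) (π P.time) 0 0 := by
  cases h : P.time with
  | zero =>
    change P.nx (.start 0) (π 0) = _
    exact if_neg (by omega)
  | succ n =>
    change P.nx (P.run π n) (π (n + 1)) = _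
    rw [run_start π (by omega)]
    exact if_neg (by omega)

lemma exists_run_block (π : ℕ → S) {n : ℕ} (h : P.time ≤ n) :
    ∃ s k v, P.run π n = .block (P.mode (π P.time)) s k v := by
  induction n, h using Nat.le_induction with
  | base => exact ⟨_, _, _, run_time π⟩
  | succ n _ ih =>
    obtain ⟨s, k, v, ih⟩ := ih
    change ∃ s k v, P.nx (P.run π n) (π (n + 1)) = _
    rw [ih]
    simp only [nx]
    split_ifs
    · exact ⟨_, _, _, rfl⟩
    · exact ⟨_, _, _, rfl⟩

lemma Follows.mem_mode (h : P.Follows π) {n : ℕ} (hn : P.time ≤ n) :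
    π n ∈ P.mode (π P.time) := by
  obtain ⟨s, k, v, hr⟩ := exists_run_block (P := P) π hn
  have := h.valid n
  rw [hr] at this
  exact this.2.2.1

variable (P)

/-- The time that the current block can still take. -/
noncomputable def remaining : Phase S d → ℕ
  | .start _ => 0
  | .block U s k v => if k < P.len then P.len - k + P.slack else G.rank U s v

/-- A potential that shows that the payoff grows linearly. -/
noncomputable def potential (i : Fin d) : Phase S d → ℝ
  | .start _ => 0
  | .block U s k v => -(v i : ℝ) - (P.remaining (.block U s k v) : ℝ) / (P.len + P.slack : ℕ)

/-- A block takes at most `P.len + P.slack` steps and earns at least `1`, so on average each step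
earns the reciprocal. Within a block, the weight cancels against the stored payoff while `remaining`
drops by at least one; at its end, the payoff of at least `1` pays for resetting `remaining`. -/
lemma potential_step {U : Finset S} {s' s : S} {k : ℕ} {v : Fin d → ℤ}
    (hx : P.Valid (.block U s' k v) s) {t : S}
    (ht : t ∈ (P.mv (.block U s' k v) s).dist.support) (i : Fin d) :
    1 / ((P.len + P.slack : ℕ) : ℝ) + P.potential i (.block U s' k v)
      ≤ G.w s t i + P.potential i (P.nx (.block U s' k v) t) := by
  have hval := P.valid_nx hx ht
  have hcases := P.block_cases hx
  have hK : (0 : ℝ) < (P.len + P.slack : ℕ) := by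
    have := P.len_pos
    have : 0 < P.len + P.slack := by omega
    exact_mod_cast this
  set K : ℝ := ((P.len + P.slack : ℕ) : ℝ) with hKdef
  obtain ⟨rfl, hU, hs, h⟩ := hx
  have hrem1 : 1 ≤ P.remaining (.block U s' k v) := by
    simp only [remaining]
    split_ifs with hk
    · omega
    · rcases h with ⟨hk', -⟩ | ⟨-, hr, -⟩
      · omega
      · exact hr
  have hrem1' : (1 : ℝ) ≤ P.remaining (.block U s' k v) := by exact_mod_cast hrem1
  simp only [nx] at hval ⊢
  split_ifs at hval ⊢ with h1
  · have hv : (1 : ℝ) ≤ v i + G.w s' t i := by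
      have := h1.2 i
      simp only [Pi.add_apply] at this
      exact_mod_cast this
    have hrem0 : (P.remaining (.block U t 0 0) : ℝ) = K := by
      have : P.remaining (.block U t 0 0) = P.len - 0 + P.slack := if_pos P.len_pos
      rw [this, hKdef, Nat.sub_zero]
    simp only [potential, hrem0, Pi.zero_apply, Int.cast_zero, neg_zero, zero_sub]
    rw [div_self hK.ne']
    have : 1 / K ≤ (P.remaining (.block U s' k v) : ℝ) / K := by gcongr
    linarith
  · have hdec : P.remaining (.block U t (min (k + 1) P.len) (v + G.w s' t)) + 1
        ≤ P.remaining (.block U s' k v) := by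
      obtain ⟨-, -, htU, hval⟩ := hval
      simp only [remaining]
      rcases hcases with ⟨hk, -⟩ | ⟨hk, hd⟩
      · rw [if_pos hk]
        by_cases hk1 : k + 1 < P.len
        · rw [if_pos (by omega)]
          omega
        · rw [if_neg (by omega)]
          rcases hval with ⟨hk', -⟩ | ⟨-, -, hsl, -⟩
          · omega
          · omega
      · rw [if_neg (by omega), if_neg (by omega)]
        exact hd t ht
    have hdec' : (P.remaining (.block U t (min (k + 1) P.len) (v + G.w s' t)) : ℝ) + 1
        ≤ P.remaining (.block U s' k v) := by exact_mod_cast hdec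
    simp only [potential, Pi.add_apply]
    have h3 := div_le_div_of_nonneg_right hdec' hK.le
    rw [add_div] at h3
    rw [← hKdef]
    push_cast
    linarith

lemma exists_potential_bound : ∃ M : ℝ, ∀ x ∈ P.box, ∀ i, |P.potential i x| ≤ M := by
  have hfin : ((fun y : Phase S d × Fin d => |P.potential y.2 y.1|) '' (P.box ×ˢ Set.univ)).Finite :=
    (P.finite_box.prod Set.finite_univ).image _
  obtain ⟨M, hM⟩ := hfin.bddAbove
  exact ⟨M, fun x hx i => hM ⟨(x, i), ⟨hx, trivial⟩, rfl⟩⟩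

variable {P}

/-- Every play that follows a plan has a positive mean payoff. -/
lemma Follows.meanPayoff_pos (h : P.Follows π) (i : Fin d) : 0 < G.meanPayoff π i := by
  obtain ⟨M, hM⟩ := P.exists_potential_bound
  have hM : ∀ n, |P.potential i (P.run π n)| ≤ M := fun n => hM _ (P.mem_box (h.valid n)) i
  set η : ℝ := 1 / ((P.len + P.slack : ℕ) : ℝ) with hη
  have hη0 : 0 < η := by
    have := P.len_pos
    have h1 : 0 < P.len + P.slack := by omega
    have : (0 : ℝ) < (P.len + P.slack : ℕ) := by exact_mod_cast h1
    positivity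
  have hlin : ∀ n ≥ P.time, η * n - (η * P.time + G.weightBound * P.time)
      + P.potential i (P.run π P.time) ≤ G.totalPayoff n π i + P.potential i (P.run π n) := by
    intro n hn
    induction n, hn using Nat.le_induction with
    | base =>
      have := (abs_le.1 (abs_totalPayoff_le G.abs_weight_le_real P.time π i)).1
      linarith
    | succ n hn ih =>
      obtain ⟨s, k, v, hr⟩ := exists_run_block (P := P) π hn
      have h1 := h.valid n
      have h2 := h n
      rw [hr] at h1 h2
      have h3 := P.potential_step h1 h2 i
      have h4 : G.totalPayoff (n + 1) π i = G.totalPayoff n π i + G.w (π n) (π (n + 1)) i :=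
        Finset.sum_range_succ _ _
      have h5 : P.run π (n + 1) = P.nx (P.run π n) (π (n + 1)) := rfl
      rw [h4, h5]
      rw [hr] at ih ⊢
      push_cast
      linarith
  refine hη0.trans_le (le_meanPayoff_of_linear (N := P.time)
    (K := η * P.time + G.weightBound * P.time + 2 * M) fun n hn => ?_)
  have h1 := hlin n hn
  have h2 := (abs_le.1 (hM n)).2
  have h3 := (abs_le.1 (hM P.time)).1
  linarith

lemma zero_mem_WCSol (s : S) : (0 : Fin d → ℝ) ∈ P.strategy.WCSol s := fun _ hπ i =>
  (follows_of_outcome hπ).meanPayoff_pos i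

end Plan

end MDP

/-! ### The Markov chain of a plan, and lower bounds of its expected mean payoff. -/

namespace MDP

variable {S : Type*} [Fintype S] {d : ℕ} {G : MDP S d}

namespace Strategy

variable (f : G.Strategy)

lemma matrix_eq_mul (c c' : f.Conf) :
    f.matrix c c' = (f.next c c'.state).toReal * (f.upd c.state c.mem c'.mem).toReal := by
  classical
  unfold matrix
  rw [← ENNReal.toReal_mul]
  congr 1
  unfold step
  rw [PMF.bind_apply, tsum_eq_single c'.state]
  · congr 1
    rw [PMF.map_apply, tsum_eq_single c'.mem]
    · rw [if_pos rfl]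
    · intro m hm
      rw [if_neg]
      intro h
      exact hm (congrArg Conf.mem h).symm
  · intro s hs
    convert mul_zero _
    rw [PMF.map_apply]
    refine ENNReal.tsum_eq_zero.2 fun m => if_neg ?_
    rintro rfl
    exact hs rfl

/-- A state of the induced chain is a pair. -/
def confEquiv : f.Conf ≃ S × f.Mem where
  toFun c := (c.state, c.mem)
  invFun x := ⟨x.1, x.2⟩
  left_inv _ := rfl
  right_inv _ := rfl

lemma sum_conf [Fintype f.Conf] [Fintype f.Mem] (φ : f.Conf → ℝ) :
    ∑ c, φ c = ∑ s, ∑ m, φ ⟨s, m⟩ := by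
  rw [← Fintype.sum_prod_type', ← f.confEquiv.symm.sum_comp]
  rfl

lemma sum_matrix_mul [Fintype f.Conf] [Fintype f.Mem] (c : f.Conf) (φ : f.Conf → ℝ) :
    ∑ c', f.matrix c c' * φ c' = ∑ t, (f.next c t).toReal *
      ∑ m, (f.upd c.state c.mem m).toReal * φ ⟨t, m⟩ := by
  rw [f.sum_conf]
  refine Finset.sum_congr rfl fun t _ => ?_
  rw [Finset.mul_sum]
  refine Finset.sum_congr rfl fun m _ => ?_
  rw [matrix_eq_mul]
  ring

lemma sum_matrix_mul_state [Fintype f.Conf] [Fintype f.Mem] (c : f.Conf) (φ : S → ℝ) :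
    ∑ c', f.matrix c c' * φ c'.state = ∑ t, (f.next c t).toReal * φ t := by
  rw [f.sum_matrix_mul c fun c' => φ c'.state]
  refine Finset.sum_congr rfl fun t _ => ?_
  change _ * ∑ m, (f.upd c.state c.mem m).toReal * φ t = _
  rw [← Finset.sum_mul, PMF.sum_toReal, one_mul]

end Strategy

namespace Plan

variable (P : G.Plan)

noncomputable instance : Fintype P.strategy.Conf :=
  haveI := P.strategy.finite_conf P.isFiniteMemory
  Fintype.ofFinite _

noncomputable instance : Fintype P.strategy.Mem :=
  haveI : Finite P.strategy.Mem := P.isFiniteMemory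
  Fintype.ofFinite _

/-- The control state on arrival in a state of the induced chain. -/
noncomputable def eff (c : P.strategy.Conf) : Phase S d := P.nx (P.dec c.mem) c.state

variable {P}

lemma next_eq (c : P.strategy.Conf) : P.strategy.next c = (P.mv (P.eff c) c.state).dist := by
  by_cases h : c.state ∈ G.ctrl
  · rw [Strategy.next_of_mem _ h]
    rfl
  · rw [Strategy.next_of_notMem _ h, Move.random _ h]

lemma eff_mk {c : P.strategy.Conf} (hc : P.Valid (P.eff c) c.state) (t : S) :
    P.eff ⟨t, P.enc (P.eff c)⟩ = P.nx (P.eff c) t := by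
  change P.nx (P.dec (P.enc (P.eff c))) t = _
  rw [P.dec_enc (P.mem_box hc)]

lemma mem_of_step {c c' : P.strategy.Conf} (h : c' ∈ (P.strategy.step c).support) :
    c'.mem = P.enc (P.eff c) := by
  have := (P.strategy.mem_support_step.1 h).2
  exact (PMF.mem_support_pure_iff _ _).1 this

lemma eff_of_step {c c' : P.strategy.Conf} (hc : P.Valid (P.eff c) c.state)
    (h : c' ∈ (P.strategy.step c).support) :
    P.eff c' = P.nx (P.eff c) c'.state ∧ P.Valid (P.eff c') c'.state := by
  have h1 : P.eff c' = P.nx (P.eff c) c'.state := by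
    rw [← eff_mk hc, ← mem_of_step h]
  refine ⟨h1, ?_⟩
  rw [h1]
  have h2 := (P.strategy.mem_support_step.1 h).1
  rw [next_eq] at h2
  exact P.valid_nx hc h2

lemma sum_matrix_mul {c : P.strategy.Conf} (hc : P.Valid (P.eff c) c.state)
    (φ : S → Phase S d → ℝ) :
    ∑ c', P.strategy.matrix c c' * φ c'.state (P.eff c')
      = ∑ t, ((P.mv (P.eff c) c.state).dist t).toReal * φ t (P.nx (P.eff c) t) := by
  classical
  rw [P.strategy.sum_matrix_mul c fun c' => φ c'.state (P.eff c'), next_eq]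
  refine Finset.sum_congr rfl fun t _ => ?_
  congr 1
  refine (Finset.sum_eq_single (P.enc (P.eff c) : P.strategy.Mem) ?_ ?_).trans ?_
  rotate_left 2
  · have : (P.strategy.upd c.state c.mem) (P.enc (P.eff c)) = 1 := by
      change (PMF.pure (P.enc (P.eff c))) (P.enc (P.eff c)) = 1
      rw [PMF.pure_apply, if_pos rfl]
    rw [this, ENNReal.toReal_one, one_mul, eff_mk hc]
  · intro m _ hm
    have : (P.strategy.upd c.state c.mem) m = 0 := by
      change (PMF.pure (P.enc (P.eff c))) m = 0
      rw [PMF.pure_apply, if_neg hm]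
    rw [this, ENNReal.toReal_zero, zero_mul]
  · intro h
    exact absurd (Finset.mem_univ (α := P.strategy.Mem) _) h

/-- The paths of the induced chain follow the plan. -/
lemma path_spec {ρ : ℕ → P.strategy.Conf} (h0 : (ρ 0).mem ∈ P.strategy.init.support)
    (hstep : ∀ n, ρ (n + 1) ∈ (P.strategy.step (ρ n)).support) :
    P.Follows (fun n => (ρ n).state) ∧
      ∀ n, P.eff (ρ n) = P.run (fun n => (ρ n).state) n := by
  have hF : P.Follows (fun n => (ρ n).state) :=
    follows_of_outcome (P.strategy.outcome_of_path h0 hstep)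
  refine ⟨hF, fun n => ?_⟩
  induction n with
  | zero =>
    have h1 : (ρ 0).mem = P.enc (.start 0) := (PMF.mem_support_pure_iff _ _).1 h0
    change P.nx (P.dec (ρ 0).mem) _ = P.nx (.start 0) _
    rw [h1, P.dec_enc P.start_mem_box]
  | succ n ih =>
    have hv : P.Valid (P.eff (ρ n)) (ρ n).state := by
      rw [ih]; exact hF.valid n
    rw [(eff_of_step hv (hstep n)).1, ih]
    rfl

variable (P)

lemma ae_path_spec (s : S) : ∀ᵐ ρ ∂(P.strategy.pathMeasure s),
    (ρ 0).state = s ∧ P.Follows (fun n => (ρ n).state) ∧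
      ∀ n, P.eff (ρ n) = P.run (fun n => (ρ n).state) n := by
  filter_upwards [P.strategy.ae_chainMeasure_zero (P.strategy.init.map fun m => ⟨s, m⟩),
    P.strategy.ae_chainMeasure_step (P.strategy.init.map fun m => ⟨s, m⟩)] with ρ h0 h1
  rw [PMF.mem_support_map_iff] at h0
  obtain ⟨m, hm, h0⟩ := h0
  refine ⟨by rw [← h0], path_spec (by rw [← h0]; exact hm) h1⟩

open Classical in
/-- The distribution of the state after `n` initial steps. -/
noncomputable def law (first : ℕ → ∀ s, G.Move s) (s : S) : ℕ → S → ℝ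
  | 0, t => if t = s then 1 else 0
  | n + 1, t => ∑ r, law first s n r * ((first n r).dist t).toReal

/-- During the initial phase the move depends on the time and the current state only, so the states
by themselves form a time-inhomogeneous Markov chain. -/
lemma integral_state (s : S) {n : ℕ} (hn : n ≤ P.time) (φ : S → ℝ) :
    ∫ ρ, φ (ρ n).state ∂(P.strategy.pathMeasure s) = ∑ t, law P.first s n t * φ t := by
  classical
  induction n generalizing φ with
  | zero =>
    have h : ∫ ρ, φ (ρ 0).state ∂(P.strategy.pathMeasure s)
        = ∫ _, φ s ∂(P.strategy.pathMeasure s) := by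
      refine integral_congr_ae ?_
      filter_upwards [P.ae_path_spec s] with ρ hρ
      rw [hρ.1]
    have hprob : IsProbabilityMeasure (P.strategy.pathMeasure s) :=
      inferInstanceAs (IsProbabilityMeasure
        (P.strategy.chainMeasure (P.strategy.init.map fun m => ⟨s, m⟩)))
    rw [h]
    simp [law]
  | succ n ih =>
    have h1 := P.strategy.integral_chainMeasure_succ (P.strategy.init.map fun m => ⟨s, m⟩) n
      (fun _ c => φ c.state) fun _ _ _ _ => rfl
    have h2 : ∫ ρ, ∑ c, P.strategy.matrix (ρ n) c * φ c.state ∂(P.strategy.pathMeasure s)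
        = ∫ ρ, (fun r => ∑ t, ((P.first n r).dist t).toReal * φ t) (ρ n).state
            ∂(P.strategy.pathMeasure s) := by
      refine integral_congr_ae ?_
      filter_upwards [P.ae_path_spec s] with ρ hρ
      rw [P.strategy.sum_matrix_mul_state, next_eq, hρ.2.2 n, run_start _ (by omega)]
      rfl
    refine h1.trans (h2.trans ((ih (by omega)
      (fun r => ∑ t, ((P.first n r).dist t).toReal * φ t)).trans ?_))
    simp only [law, Finset.sum_mul, Finset.mul_sum]
    rw [Finset.sum_comm]
    exact Finset.sum_congr rfl fun _ _ => Finset.sum_congr rfl fun _ _ => by ring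

/-- `g` shows that in mode `U` the mean payoff in component `i` is at least `c`. -/
def Certifies (i : Fin d) (U : Finset S) (c : ℝ) (g : Phase S d → ℝ) : Prop :=
  ∀ s' s k v, P.Valid (.block U s' k v) s →
    c + g (.block U s' k v) ≤ ∑ t, ((P.mv (.block U s' k v) s).dist t).toReal *
      (G.w s t i + g (P.nx (.block U s' k v) t))

lemma exists_nx_block (U : Finset S) (s' : S) (k : ℕ) (v : Fin d → ℤ) (t : S) :
    ∃ s k' v', P.nx (.block U s' k v) t = .block U s k' v' := by
  simp only [nx]
  split_ifs
  · exact ⟨_, _, _, rfl⟩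
  · exact ⟨_, _, _, rfl⟩

/-- Lower bound of the expected mean payoff of a plan. -/
lemma le_expMeanPayoff (s : S) (i : Fin d) (val : Finset S → ℝ)
    (hval : ∀ U, val U = 0 ∨ ∃ g, P.Certifies i U (val U) g) :
    ∑ t, law P.first s P.time t * val (P.mode t) ≤ P.strategy.expMeanPayoff s i := by
  classical
  set good : Finset S → Prop := fun U => ∃ g, P.Certifies i U (val U) g with hgood
  have hch : ∀ U, ∃ g : Phase S d → ℝ, good U → P.Certifies i U (val U) g := by
    intro U
    by_cases h : good U
    · obtain ⟨g, hg⟩ := h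
      exact ⟨g, fun _ => hg⟩
    · exact ⟨0, fun h' => absurd h' h⟩
  choose gf hgf using hch
  let gg : Phase S d → ℝ
    | .start _ => 0
    | .block U s k v => if good U then gf U (.block U s k v) else 0
  set Gc : P.strategy.Conf → ℝ := fun c =>
    if P.Valid (P.eff c) c.state then gg (P.eff c) else 0 with hGc
  obtain ⟨M, hM⟩ := (Set.finite_range fun c => |Gc c|).bddAbove
  have hM : ∀ c, |Gc c| ≤ M := fun c => hM ⟨c, rfl⟩
  -- Where no certificate applies, the drift bound is made trivially true: a step loses at most the
  -- weight bound, and `Gc` varies by at most `2 * M`.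
  set low : ℝ := -(G.weightBound + 2 * M) with hlow
  let hh : Phase S d → ℝ
    | .start _ => low
    | .block U _ _ _ => if good U then val U else low
  set hc : P.strategy.Conf → ℝ := fun c =>
    if P.Valid (P.eff c) c.state then hh (P.eff c) else low with hhc
  set r : P.strategy.Conf → P.strategy.Conf → ℝ := fun c c' => G.w c.state c'.state i with hr
  have hdrift : ∀ c, hc c + Gc c ≤ ∑ c', P.strategy.matrix c c' * (r c c' + Gc c') := by
    intro c
    have hst := P.strategy.isStochastic_matrix
    have hbase : low + Gc c ≤ ∑ c', P.strategy.matrix c c' * (r c c' + Gc c') := by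
      calc low + Gc c ≤ -(G.weightBound + M) := by
            have := (abs_le.1 (hM c)).2
            rw [hlow]; linarith
        _ = ∑ c', P.strategy.matrix c c' * (-(G.weightBound + M)) := by
            rw [← Finset.sum_mul, hst.sum_eq_one, one_mul]
        _ ≤ _ := by
            refine Finset.sum_le_sum fun c' _ => mul_le_mul_of_nonneg_left ?_ (hst.nonneg _ _)
            have h1 := (abs_le.1 (hM c')).1
            have h2 := (abs_le.1 (G.abs_weight_le_real c.state c'.state i)).1
            linarith
    by_cases hv : P.Valid (P.eff c) c.state
    · have hmain : (∃ U s' k v, P.eff c = .block U s' k v ∧ good U) ∨ hc c = low := by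
        simp only [hhc, if_pos hv]
        cases hx : P.eff c with
        | start n => exact Or.inr rfl
        | block U s' k v =>
          by_cases hg : good U
          · exact Or.inl ⟨U, s', k, v, rfl, hg⟩
          · exact Or.inr (if_neg hg)
      rcases hmain with ⟨U, s', k, v, hx, hg⟩ | hmain
      · have e1 : ∑ c', P.strategy.matrix c c' * (r c c' + Gc c')
            = ∑ c', P.strategy.matrix c c' *
                (fun t x => (G.w c.state t i : ℝ) + gg x) c'.state (P.eff c') := by
          refine Finset.sum_congr rfl fun c' _ => ?_
          rcases (hst.nonneg c c').eq_or_lt with h | h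
          · rw [← h, zero_mul, zero_mul]
          · have h2 := (eff_of_step hv (P.strategy.matrix_pos_iff.1 h)).2
            simp only [hGc, if_pos h2, hr]
        rw [e1.trans (sum_matrix_mul hv fun t x => (G.w c.state t i : ℝ) + gg x)]
        have e2 : hc c + Gc c = val U + gf U (.block U s' k v) := by
          simp only [hhc, hGc, if_pos hv, hx]
          simp only [hh, gg, if_pos hg]
        rw [e2, hx]
        have hv' := hv
        rw [hx] at hv'
        refine (hgf U hg s' c.state k v hv').trans_eq ?_
        refine Finset.sum_congr rfl fun t _ => ?_
        obtain ⟨s1, k1, v1, h1⟩ := P.exists_nx_block U s' k v t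
        rw [h1]
        simp only [gg, if_pos hg]
      · rw [hmain]; exact hbase
    · have : hc c = low := if_neg hv
      rw [this]; exact hbase
  have hae : ∀ᵐ ρ ∂(P.strategy.pathMeasure s),
      val (P.mode (ρ P.time).state) ≤ G.meanPayoff (fun n => (ρ n).state) i := by
    filter_upwards [P.ae_path_spec s, P.strategy.ae_average_ge
      (P.strategy.init.map fun m => ⟨s, m⟩) r hc Gc hdrift] with ρ hρ havg
    obtain ⟨-, hF, heff⟩ := hρ
    set π : ℕ → S := fun n => (ρ n).state with hπ
    change val (P.mode (π P.time)) ≤ _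
    -- In a mode of value `0`, the surely positive mean payoff suffices. In a certified mode, `hc`
    -- is constant from time `P.time` on, and the almost sure bound on averages applies.
    rcases hval (P.mode (π P.time)) with h0 | hg
    · rw [h0]; exact (hF.meanPayoff_pos i).le
    · have hconst : ∀ n ≥ P.time, hc (ρ n) = val (P.mode (π P.time)) := by
        intro n hn
        obtain ⟨s', k, v, hx⟩ := exists_run_block (P := P) π hn
        have hv : P.Valid (P.eff (ρ n)) (ρ n).state := by rw [heff]; exact hF.valid n
        simp only [hhc, if_pos hv, heff, hx]
        exact if_pos hg
      set V := val (P.mode (π P.time)) with hV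
      set K := P.time * V - ∑ k ∈ Finset.range P.time, hc (ρ k) with hK
      have hsum : ∀ n ≥ P.time, ∑ k ∈ Finset.range n, hc (ρ k) = n * V - K := by
        intro n hn
        induction n, hn using Nat.le_induction with
        | base => rw [hK]; ring
        | succ n hn ih =>
          rw [Finset.sum_range_succ, ih, hconst n hn]
          push_cast; ring
      refine le_of_forall_pos_lt_add fun ε hε => ?_
      obtain ⟨N, hN⟩ := eventually_atTop.1 (havg (ε / 2) (by positivity))
      have : V - ε / 2 ≤ G.meanPayoff π i := by
        refine le_meanPayoff_of_linear (N := max N P.time) (K := K) fun n hn => ?_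
        have h1 := hN n (le_trans (le_max_left _ _) hn)
        have h2 := hsum n (le_trans (le_max_right _ _) hn)
        rw [Finset.sum_sub_distrib, h2] at h1
        have h3 : ∑ k ∈ Finset.range n, r (ρ k) (ρ (k + 1)) = G.totalPayoff n π i := rfl
        rw [h3] at h1
        linarith
      linarith
  rw [← P.integral_state s le_rfl fun t => val (P.mode t)]
  refine integral_mono_ae ?_ (P.strategy.integrable_meanPayoff _ i) hae
  exact P.strategy.integrable_path (P.strategy.init.map fun m => ⟨s, m⟩) P.time
    fun c _ => val (P.mode c.state)

/-- Long gambles with positive drift certify every payoff below the drift. -/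
lemma exists_certificate {U : Finset S} (hU : G.Profitable U) (z : ∀ s, G.Move s)
    (g : Fin d → S → ℝ) (c : Fin d → ℝ) (hc : ∀ i, 0 ≤ c i) {δ : ℝ} (hδ : 0 < δ)
    (hdrift : ∀ s ∈ U, ∀ i, c i + δ + g i s
      ≤ ∑ t, ((z s).dist t).toReal * (G.w s t i + g i t)) :
    ∃ J : ℕ, ∀ P : G.Plan, P.gamble = z → J ≤ P.len → ∀ i, ∃ γ, P.Certifies i U (c i) γ := by
  obtain ⟨n₀, hn₀⟩ := id hU
  obtain ⟨M0, hM0⟩ := (Set.finite_range fun x : Fin d × S => |g x.1 x.2|).bddAbove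
  set M := max M0 1 with hMdef
  have hM1 : 1 ≤ M := le_max_right _ _
  have hM : ∀ i s, |g i s| ≤ M := fun i s => (hM0 ⟨(i, s), rfl⟩).trans (le_max_left _ _)
  set W : ℝ := (G.weightBound : ℝ) with hW
  have hW0 : 0 ≤ W := Nat.cast_nonneg _
  set B := W + 2 * M with hB
  have hB1 : 1 ≤ B := by linarith
  set l := min (1 / B) (δ / B ^ 2) with hl
  have hl0 : 0 < l := by positivity
  have hlB : l * B ≤ 1 := by
    rw [← le_div_iff₀ (by positivity)]; exact min_le_left _ _
  have hlδ : l * B ^ 2 ≤ δ := by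
    rw [← le_div_iff₀ (by positivity)]; exact min_le_right _ _
  -- A supermartingale of the gamble that dominates the deficits of all components at once: each
  -- component has drift at least `δ` up to its potential, so for small `l` no summand grows in the
  -- mean.
  set Ψ : S → (Fin d → ℤ) → ℝ := fun s v => ∑ j, Real.exp (-l * (v j + g j s)) with hΨ
  have hΨ0 : ∀ s v, 0 ≤ Ψ s v := fun s v => Finset.sum_nonneg fun j _ => (Real.exp_pos _).le
  have hq0 : ∀ s t, 0 ≤ ((z s).dist t).toReal := fun s t => ENNReal.toReal_nonneg
  have hq1 : ∀ s, ∑ t, ((z s).dist t).toReal = 1 := fun s => (z s).dist.sum_toReal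
  have hΨstep : ∀ s ∈ U, ∀ v, ∑ t, ((z s).dist t).toReal * Ψ t (v + G.w s t) ≤ Ψ s v := by
    intro s hs v
    have e1 : ∑ t, ((z s).dist t).toReal * Ψ t (v + G.w s t)
        = ∑ j, Real.exp (-l * (v j + g j s)) * ∑ t, ((z s).dist t).toReal *
            Real.exp (-l * (G.w s t j + g j t - g j s)) := by
      simp only [hΨ, Finset.mul_sum]
      rw [Finset.sum_comm]
      refine Finset.sum_congr rfl fun j _ => Finset.sum_congr rfl fun t _ => ?_
      rw [mul_left_comm, ← Real.exp_add]
      congr 2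
      simp only [Pi.add_apply]
      push_cast
      ring
    rw [e1]
    refine Finset.sum_le_sum fun j _ => mul_le_of_le_one_right (Real.exp_pos _).le ?_
    refine sum_mul_exp_neg_le_one (hq0 s) (hq1 s) (B := B) (δ := δ) (fun t _ => ?_) ?_ hl0.le
      hlB hlδ
    · have h1 := abs_le.1 (hM j t)
      have h2 := abs_le.1 (hM j s)
      have h3 := abs_le.1 (G.abs_weight_le_real s t j)
      rw [abs_le]
      constructor <;> linarith [h1.1, h1.2, h2.1, h2.2, h3.1, h3.2]
    · have h1 : ∑ t, ((z s).dist t).toReal * (G.w s t j + g j t - g j s)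
          = ∑ t, ((z s).dist t).toReal * (G.w s t j + g j t) - g j s := by
        simp only [mul_sub, Finset.sum_sub_distrib, ← Finset.sum_mul, hq1, one_mul]
      rw [h1]
      linarith [hdrift s hs j, hc j]
  set a : ℝ := n₀ * (M + 2) with ha
  set b : ℝ := n₀ / l with hb
  have ha0 : 0 ≤ a := by positivity
  have hb0 : 0 ≤ b := by positivity
  -- Deficits are at most `M + Ψ / l`, by `u + 1 ≤ exp u`, and recovery is linear in the deficit. So
  -- the expected recovery time is bounded however long the gamble lasts.
  have hrank : ∀ s ∈ U, ∀ v, (G.rank U s v : ℝ) ≤ a + b * Ψ s v := by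
    intro s hs v
    set m : ℕ := ⌈M + Ψ s v / l⌉₊ with hm
    have hm1 : M + Ψ s v / l ≤ m := Nat.le_ceil _
    have hm2 : (m : ℝ) < M + Ψ s v / l + 1 :=
      Nat.ceil_lt_add_one (by have := hΨ0 s v; positivity)
    have h1 : ∀ j, -(m : ℤ) ≤ v j := by
      intro j
      have h2 : Real.exp (-l * (v j + g j s)) ≤ Ψ s v :=
        Finset.single_le_sum (f := fun j => Real.exp (-l * (v j + g j s)))
          (fun j _ => (Real.exp_pos _).le) (Finset.mem_univ j)
      have h3 := Real.add_one_le_exp (-l * (v j + g j s))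
      have h4 : -(v j : ℝ) - g j s ≤ Ψ s v / l := by
        rw [le_div_iff₀ hl0]; nlinarith
      have h5 := (abs_le.1 (hM j s)).2
      have h6 : -(m : ℝ) ≤ v j := by linarith
      exact_mod_cast h6
    have h2 : (G.rank U s v : ℝ) ≤ n₀ * (m + 1) := by
      exact_mod_cast rank_le (force_of_deficit hn₀ m hs h1)
    calc (G.rank U s v : ℝ) ≤ n₀ * (m + 1) := h2
      _ ≤ n₀ * (M + Ψ s v / l + 1 + 1) := by gcongr
      _ = a + b * Ψ s v := by rw [ha, hb]; ring
  -- A recovery step falls short of `c i` by at most `C`.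
  set C : ℝ := ∑ i, c i + W with hC
  have hcC : ∀ i, c i + W ≤ C := fun i => by
    have := Finset.single_le_sum (f := c) (fun j _ => hc j) (Finset.mem_univ i)
    rw [hC]; linarith
  have hC0 : 0 ≤ C := by
    have := Finset.sum_nonneg fun (i : Fin d) (_ : i ∈ Finset.univ) => hc i
    rw [hC]; linarith
  -- The surplus `δ` of each gambling step must in total cover the oscillation of `g` and the
  -- expected cost of recovery. The bound `J` is fixed before the plan, so that a single length can
  -- serve all modes.
  obtain ⟨J, hJ⟩ := exists_nat_gt ((2 * M + C * b * (d * Real.exp (l * M)) + C * a) / δ)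
  rw [div_lt_iff₀ hδ] at hJ
  refine ⟨J, fun P hz hJP i => ?_⟩
  have hlenδ : 2 * M + C * b * (d * Real.exp (l * M)) + C * a ≤ P.len * δ := by
    have : (J : ℝ) ≤ P.len := by exact_mod_cast hJP
    nlinarith
  set base : S → (Fin d → ℤ) → ℝ := fun s v => g i s - C * b * Ψ s v - C * a - M with hbase
  -- The value of a control state relative to the rate `c i`. While gambling it is the surplus still
  -- to come minus the expected cost of recovery; while recovering it is minus the worst possible
  -- remaining cost. A fresh block has value at least `0`, which closes the cycle.
  let γ : Phase S d → ℝ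
    | .start _ => 0
    | .block _ s k v =>
        if k < P.len then ((P.len : ℝ) - k) * δ + base s v else -C * G.rank U s v
  have hγ0 : ∀ s, 0 ≤ γ (.block U s 0 0) := by
    intro s
    have h1 : γ (.block U s 0 0) = ((P.len : ℝ) - (0 : ℕ)) * δ + base s 0 := if_pos P.len_pos
    have h2 : Ψ s 0 ≤ d * Real.exp (l * M) := by
      calc Ψ s 0 ≤ ∑ _j : Fin d, Real.exp (l * M) := by
            refine Finset.sum_le_sum fun j _ => Real.exp_le_exp.2 ?_
            have := (abs_le.1 (hM j s)).1
            simp only [Pi.zero_apply, Int.cast_zero, zero_add]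
            nlinarith
        _ = _ := by simp
    have h3 := (abs_le.1 (hM i s)).1
    have h4 := mul_le_mul_of_nonneg_left h2 (mul_nonneg hC0 hb0)
    rw [h1, hbase]
    push_cast
    linarith
  have hbase0 : ∀ s v, base s v ≤ 0 := by
    intro s v
    have h3 := (abs_le.1 (hM i s)).2
    have h4 := mul_nonneg (mul_nonneg hC0 hb0) (hΨ0 s v)
    have h5 := mul_nonneg hC0 ha0
    simp only [hbase]
    linarith
  have hbaser : ∀ s ∈ U, ∀ v, base s v ≤ -C * G.rank U s v := by
    intro s hs v
    have h3 := (abs_le.1 (hM i s)).2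
    have h4 := mul_le_mul_of_nonneg_left (hrank s hs v) hC0
    simp only [hbase]
    linarith
  refine ⟨γ, fun s' s k v hx => ?_⟩
  have hcases := P.block_cases hx
  have hmem : ∀ t ∈ (P.mv (.block U s' k v) s).dist.support, t ∈ U := fun t ht =>
    P.mem_of_mem_mv hx ht
  obtain ⟨rfl, hUr, hs, h⟩ := hx
  rcases hcases with ⟨hk, hmv⟩ | ⟨hk, hdec⟩
  · rw [hmv, hz] at hmem
    rw [hmv, hz]
    have hγ : γ (.block U s' k v) = ((P.len : ℝ) - k) * δ + base s' v := if_pos hk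
    have hnext : ∀ t, 0 < ((z s').dist t).toReal →
        ((P.len : ℝ) - k - 1) * δ + base t (v + G.w s' t) ≤ γ (P.nx (.block U s' k v) t) := by
      intro t ht
      have htU := hmem t ((PMF.toReal_pos_iff _ _).1 ht)
      simp only [nx]
      split_ifs with h1
      · have hk1 : k + 1 = P.len := by omega
        refine le_trans ?_ (hγ0 t)
        rw [← hk1]
        push_cast
        have := hbase0 t (v + G.w s' t)
        linarith
      · by_cases hk1 : k + 1 < P.len
        · rw [min_eq_left hk1.le]
          have : γ (.block U t (k + 1) (v + G.w s' t))
              = ((P.len : ℝ) - (k + 1 : ℕ)) * δ + base t (v + G.w s' t) := if_pos hk1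
          rw [this]
          push_cast
          linarith
        · have hk2 : k + 1 = P.len := by omega
          rw [min_eq_right (by omega)]
          have : γ (.block U t P.len (v + G.w s' t)) = -C * G.rank U t (v + G.w s' t) :=
            if_neg (lt_irrefl _)
          rw [this]
          refine le_trans ?_ (hbaser t htU _)
          rw [← hk2]
          push_cast
          linarith
    have hsum : ∑ t, ((z s').dist t).toReal *
        (G.w s' t i + (((P.len : ℝ) - k - 1) * δ + base t (v + G.w s' t)))
        ≤ ∑ t, ((z s').dist t).toReal * (G.w s' t i + γ (P.nx (.block U s' k v) t)) := by
      refine Finset.sum_le_sum fun t _ => ?_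
      rcases (hq0 s' t).eq_or_lt with h0 | h0
      · rw [← h0, zero_mul, zero_mul]
      · exact mul_le_mul_of_nonneg_left (by linarith [hnext t h0]) h0.le
    refine le_trans ?_ hsum
    have e1 : ∑ t, ((z s').dist t).toReal *
        (G.w s' t i + (((P.len : ℝ) - k - 1) * δ + base t (v + G.w s' t)))
        = ∑ t, ((z s').dist t).toReal * (G.w s' t i + g i t)
          - C * b * ∑ t, ((z s').dist t).toReal * Ψ t (v + G.w s' t)
          + (((P.len : ℝ) - k - 1) * δ - C * a - M) := by
      have h1 : ∀ x : ℝ, x = ∑ t, ((z s').dist t).toReal * x := fun x => by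
        rw [← Finset.sum_mul, hq1, one_mul]
      conv_rhs => rw [h1 (((P.len : ℝ) - k - 1) * δ - C * a - M)]
      rw [Finset.mul_sum, ← Finset.sum_sub_distrib, ← Finset.sum_add_distrib]
      refine Finset.sum_congr rfl fun t _ => ?_
      simp only [hbase]
      ring
    rw [e1, hγ]
    have h1 := hdrift s' hs i
    have h2 := mul_le_mul_of_nonneg_left (hΨstep s' hs v) (mul_nonneg hC0 hb0)
    simp only [hbase]
    linarith
  · have hγ : γ (.block U s' k v) = -C * G.rank U s' v := if_neg (by omega)
    set q : S → ℝ := fun t => ((P.mv (.block U s' k v) s').dist t).toReal with hq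
    have hq1' : ∑ t, q t = 1 := PMF.sum_toReal _
    have hterm : ∀ t, q t * (c i + γ (.block U s' k v))
        ≤ q t * (G.w s' t i + γ (P.nx (.block U s' k v) t)) := by
      intro t
      have hqt : 0 ≤ q t := ENNReal.toReal_nonneg
      rcases hqt.eq_or_lt with h0 | h0
      · rw [← h0, zero_mul, zero_mul]
      · refine mul_le_mul_of_nonneg_left ?_ h0.le
        have hts := (PMF.toReal_pos_iff _ _).1 h0
        have h1 : (G.rank U t (v + G.w s' t) : ℝ) + 1 ≤ G.rank U s' v := by
          exact_mod_cast hdec t hts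
        have h2 : -C * (G.rank U t (v + G.w s' t) : ℝ) ≤ γ (P.nx (.block U s' k v) t) := by
          simp only [nx]
          split_ifs with h3
          · refine le_trans ?_ (hγ0 t)
            have : (0 : ℝ) ≤ G.rank U t (v + G.w s' t) := Nat.cast_nonneg _
            nlinarith
          · rw [min_eq_right (by omega)]
            have : γ (.block U t P.len (v + G.w s' t)) = -C * G.rank U t (v + G.w s' t) :=
              if_neg (lt_irrefl _)
            rw [this]
        have h4 := (abs_le.1 (G.abs_weight_le_real s' t i)).1
        have h5 := hcC i
        have h6 := mul_le_mul_of_nonneg_left h1 hC0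
        rw [hγ]
        linarith
    calc c i + γ (.block U s' k v) = ∑ t, q t * (c i + γ (.block U s' k v)) := by
          rw [← Finset.sum_mul, hq1', one_mul]
      _ ≤ _ := Finset.sum_le_sum fun t _ => hterm t

end Plan

end MDP

namespace MDP

variable {S : Type*} [Fintype S] {d : ℕ} {G : MDP S d}

/-! ### Winning end-components -/

lemma isEC_union [DecidableEq S] {U V : Finset S} (hU : G.IsEC U) (hV : G.IsEC V) {r : S}
    (hrU : r ∈ U) (hrV : r ∈ V) : G.IsEC (U ∪ V) := by
  have hmonoU : ∀ s ∈ U, ∀ t ∈ U,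
      Relation.ReflTransGen (fun a b => a ∈ U ∪ V ∧ b ∈ U ∪ V ∧ G.E a b) s t := fun s hs t ht =>
    Relation.ReflTransGen.mono (fun a b h =>
      ⟨Finset.mem_union_left _ h.1, Finset.mem_union_left _ h.2.1, h.2.2⟩) _ _ (hU.2.1 s hs t ht)
  have hmonoV : ∀ s ∈ V, ∀ t ∈ V,
      Relation.ReflTransGen (fun a b => a ∈ U ∪ V ∧ b ∈ U ∪ V ∧ G.E a b) s t := fun s hs t ht =>
    Relation.ReflTransGen.mono (fun a b h =>
      ⟨Finset.mem_union_right _ h.1, Finset.mem_union_right _ h.2.1, h.2.2⟩) _ _ (hV.2.1 s hs t ht)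
  refine ⟨⟨r, Finset.mem_union_left _ hrU⟩, fun s hs t ht => ?_, fun s hs hc t hE => ?_⟩
  · rw [Finset.mem_union] at hs ht
    have h1 : Relation.ReflTransGen (fun a b => a ∈ U ∪ V ∧ b ∈ U ∪ V ∧ G.E a b) s r := by
      rcases hs with hs | hs
      · exact hmonoU s hs r hrU
      · exact hmonoV s hs r hrV
    have h2 : Relation.ReflTransGen (fun a b => a ∈ U ∪ V ∧ b ∈ U ∪ V ∧ G.E a b) r t := by
      rcases ht with ht | ht
      · exact hmonoU r hrU t ht
      · exact hmonoV r hrV t ht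
    exact h1.trans h2
  · rw [Finset.mem_union] at hs ⊢
    rcases hs with hs | hs
    · exact Or.inl (hU.2.2 s hs hc t hE)
    · exact Or.inr (hV.2.2 s hs hc t hE)

/-- No new strategy is needed: each state keeps one that stays in its own component. -/
lemma isWEC_union [DecidableEq S] {U V : Finset S} (hU : G.IsWEC U) (hV : G.IsWEC V) {r : S}
    (hrU : r ∈ U) (hrV : r ∈ V) : G.IsWEC (U ∪ V) := by
  refine ⟨isEC_union hU.1 hV.1 hrU hrV, fun s hs => ?_⟩
  rw [Finset.mem_union] at hs
  rcases hs with hs | hs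
  · obtain ⟨f, h1, h2⟩ := hU.2 s hs
    exact ⟨f, fun π hπ n => Finset.mem_union_left _ (h1 π hπ n), h2⟩
  · obtain ⟨f, h1, h2⟩ := hV.2 s hs
    exact ⟨f, fun π hπ n => Finset.mem_union_right _ (h1 π hπ n), h2⟩

lemma IsMWEC.subset_of_mem {U V : Finset S} (hU : G.IsMWEC U) (hV : G.IsWEC V) {r : S}
    (hrU : r ∈ U) (hrV : r ∈ V) : V ⊆ U := by
  classical
  by_contra hsub
  refine hU.2 _ (isWEC_union hU.1 hV hrU hrV) ⟨Finset.subset_union_left, fun h => hsub ?_⟩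
  exact Finset.subset_union_right.trans h

/-- Maximal winning end-components are disjoint. -/
lemma IsMWEC.eq_of_mem {U V : Finset S} (hU : G.IsMWEC U) (hV : G.IsMWEC V) {r : S}
    (hrU : r ∈ U) (hrV : r ∈ V) : U = V :=
  Finset.Subset.antisymm (hV.subset_of_mem hU.1 hrV hrU) (hU.subset_of_mem hV.1 hrU hrV)

lemma IsWEC.exists_isMWEC {U : Finset S} (hU : G.IsWEC U) : ∃ V, G.IsMWEC V ∧ U ⊆ V := by
  classical
  obtain ⟨V, hV, hmax⟩ := Finset.exists_max_image
    (Finset.univ.filter fun V : Finset S => G.IsWEC V ∧ U ⊆ V) Finset.card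
    ⟨U, by simp [hU]⟩
  simp only [Finset.mem_filter, Finset.mem_univ, true_and] at hV hmax
  exact ⟨V, ⟨hV.1, fun X hX hVX => absurd (hmax X ⟨hX, hV.2.trans hVX.1⟩)
    (not_le.2 (Finset.card_lt_card hVX))⟩, hV.2⟩

/-- Because the dimension is positive, payoff `0` has positive rank, and a move that decreases the
rank stays in `U`. -/
lemma Profitable.exists_succ {U : Finset S} (h : G.Profitable U) {s : S} (hs : s ∈ U) :
    ∃ m : G.Move s, ∀ t ∈ m.dist.support, t ∈ U := by
  have hr : 0 < G.rank U s 0 := by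
    rw [Nat.pos_iff_ne_zero, Ne, h.rank_eq_zero hs]
    intro h0
    have := h0 ⟨0, G.one_le_dim⟩
    simp at this
  obtain ⟨m, hm⟩ := h.exists_move hs hr
  exact ⟨m, fun t ht => (hm t ht).1⟩

open Classical in
/-- A sum over the states that is carried by the maximal winning end-components. -/
lemma sum_isMWEC {y : S → ℝ} (hy : ∀ s, y s ≠ 0 → ∃ U, G.IsMWEC U ∧ s ∈ U) :
    ∑ U : Finset S with G.IsMWEC U, ∑ s ∈ U, y s = ∑ s, y s := by
  have h1 : ∀ U : Finset S, ∑ s ∈ U, y s = ∑ s, if s ∈ U then y s else 0 := by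
    intro U
    rw [← Finset.sum_filter]
    congr 1
    ext s
    simp
  rw [Finset.sum_congr rfl fun U _ => h1 U, Finset.sum_comm]
  refine Finset.sum_congr rfl fun s _ => ?_
  by_cases hs : y s = 0
  · simp [hs]
  · obtain ⟨U, hU, hsU⟩ := hy s hs
    refine (Finset.sum_eq_single U ?_ ?_).trans (if_pos hsU)
    · intro V hV hne
      refine if_neg fun hsV => hne ?_
      exact (Finset.mem_filter.1 hV).2.eq_of_mem hU hsV hsU
    · intro h
      exact absurd (Finset.mem_filter.2 ⟨Finset.mem_univ _, hU⟩) h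

/-! ### Recurrent states of the induced chain -/

namespace Strategy

variable (f : G.Strategy)

open Classical in
/-- A deterministic strategy that makes choices in the supports of those of `f`, started in the
memory state `m`. -/
noncomputable def determinize (m : f.Mem) : G.Strategy where
  Mem := f.Mem
  init := PMF.pure m
  upd s m := PMF.pure (f.upd s m).support_nonempty.choose
  out s hs m := PMF.pure (f.out s hs m).support_nonempty.choose
  init_rational := PMF.isRational_pure _
  upd_rational _ _ := PMF.isRational_pure _
  out_rational _ _ _ := PMF.isRational_pure _
  out_support s hs m t ht := by
    rw [PMF.mem_support_pure_iff] at ht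
    rw [ht]
    exact f.out_support _ _ _ _ (f.out s hs m).support_nonempty.choose_spec

variable {f}

/-- With stochastic updates, a consistent play need not come from a path of the chain, since each of
its steps may rely on a different memory state. Deterministic updates leave a single memory sequence
`ms`, whose transitions are possible in the original chain. -/
lemma exists_path_of_outcome_determinize {m : f.Mem} {s : S} {π : ℕ → S}
    (hπ : π ∈ (f.determinize m).Outcome s) :
    ∃ ρ : ℕ → f.Conf, ρ 0 = ⟨s, m⟩ ∧ (∀ n, ρ (n + 1) ∈ (f.step (ρ n)).support) ∧
      ∀ n, (ρ n).state = π n := by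
  obtain ⟨h0, hplay, hcons⟩ := hπ
  let ms : ℕ → f.Mem := fun n =>
    Nat.rec m (fun k x => (f.upd (π k) x).support_nonempty.choose) n
  have hms : ∀ n, (f.determinize m).updSeq ((List.range n).map π) = PMF.pure (ms n) := by
    intro n
    induction n with
    | zero => rfl
    | succ n ih =>
      rw [List.range_succ, List.map_append, List.map_singleton, updSeq_append, ih]
      exact PMF.pure_bind _ _
  refine ⟨fun n => ⟨π n, ms n⟩, congrArg (fun x => (⟨x, m⟩ : f.Conf)) h0, fun n => ?_, fun n => rfl⟩
  rw [mem_support_step]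
  refine ⟨?_, (f.upd (π n) (ms n)).support_nonempty.choose_spec⟩
  by_cases hc : π n ∈ G.ctrl
  · have h1 := hcons n hc
    have e : (f.determinize m).outSeq ((List.range n).map π) (π n) hc
        = (f.determinize m).out (π n) hc (ms n) := by
      unfold outSeq
      rw [hms n]
      exact PMF.pure_bind _ _
    rw [e] at h1
    have h2 := (PMF.mem_support_pure_iff _ _).1 h1
    rw [f.next_of_mem (c := ⟨π n, ms n⟩) hc]
    change π (n + 1) ∈ _
    rw [h2]
    exact (f.out _ hc _).support_nonempty.choose_spec
  · rw [f.next_of_notMem (c := ⟨π n, ms n⟩) hc]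
    exact (G.R_support _ hc _).2 (hplay n)

/-- All paths of the induced chain from `c` have a positive mean payoff. -/
def Good (c : f.Conf) : Prop :=
  ∀ ρ : ℕ → f.Conf, ρ 0 = c → (∀ n, ρ (n + 1) ∈ (f.step (ρ n)).support) →
    ∀ i, 0 < G.meanPayoff (fun n => (ρ n).state) i

lemma good_init {s : S} (hWC : (0 : Fin d → ℝ) ∈ f.WCSol s) {m : f.Mem} (hm : m ∈ f.init.support) :
    Good (⟨s, m⟩ : f.Conf) := by
  intro ρ h0 hstep
  have := f.outcome_of_path (ρ := ρ) (by rw [h0]; exact hm) hstep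
  rw [h0] at this
  exact hWC _ this

lemma Good.step {c c' : f.Conf} (h : Good c) (hstep : c' ∈ (f.step c).support) : Good c' := by
  intro ρ h0 hρ i
  let ρ' : ℕ → f.Conf := fun n => Nat.casesOn n c ρ
  have h1 := h ρ' rfl (fun n => by
    cases n with
    | zero =>
      change ρ 0 ∈ (f.step c).support
      rw [h0]; exact hstep
    | succ n => exact hρ n) i
  -- `meanPayoff_shift` takes a strict lower bound; half of the mean payoff is one that is still
  -- positive.
  have h2 := meanPayoff_shift (fun n => (ρ' n).state) 1 i (half_lt_self h1)
  have h3 : (fun n => (ρ' (1 + n)).state) = fun n => (ρ n).state := by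
    funext n
    rw [Nat.add_comm]
  rw [h3] at h2
  linarith

lemma Good.conn {c c' : f.Conf} (h : Good c) (hc : Conn f.matrix c c') : Good c' := by
  induction hc with
  | refl => exact h
  | tail _ hbc ih => exact ih.step (f.matrix_pos_iff.1 hbc)

open Classical in
/-- The states that are reached from `c` in the induced chain. -/
noncomputable def reached (c : f.Conf) : Finset S :=
  Finset.univ.filter fun s => ∃ c', Conn f.matrix c c' ∧ c'.state = s

lemma mem_reached {c : f.Conf} {s : S} : s ∈ reached c ↔ ∃ c', Conn f.matrix c c' ∧ c'.state = s := by
  simp [reached]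

lemma exists_conf_of_mem_next {c : f.Conf} {t : S} (h : t ∈ (f.next c).support) :
    ∃ c', 0 < f.matrix c c' ∧ c'.state = t := by
  obtain ⟨m, hm⟩ := (f.upd c.state c.mem).support_nonempty
  exact ⟨⟨t, m⟩, f.matrix_pos_iff.2 (f.mem_support_step.2 ⟨h, hm⟩), rfl⟩

/-- The recurrent classes of the induced chain project to winning end-components. -/
lemma isWEC_reached {c : f.Conf} (hrec : c ∈ Rec f.matrix) (hgood : Good c) :
    G.IsWEC (reached c) := by
  refine ⟨⟨⟨c.state, mem_reached.2 ⟨c, Relation.ReflTransGen.refl, rfl⟩⟩, fun s hs t ht => ?_,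
    fun s hs hc t hE => ?_⟩, fun s hs => ?_⟩
  · obtain ⟨a, ha, rfl⟩ := mem_reached.1 hs
    obtain ⟨b, hb, rfl⟩ := mem_reached.1 ht
    have hab : Conn f.matrix a b := (hrec a ha).trans hb
    clear hb ht hs
    induction hab with
    | refl => exact Relation.ReflTransGen.refl
    | @tail x y hax hxy ih =>
      refine ih.tail ⟨mem_reached.2 ⟨x, ha.trans hax, rfl⟩,
        mem_reached.2 ⟨y, (ha.trans hax).tail hxy, rfl⟩, ?_⟩
      exact f.edge_of_mem_next (f.mem_support_step.1 (f.matrix_pos_iff.1 hxy)).1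
  · obtain ⟨a, ha, rfl⟩ := mem_reached.1 hs
    have : t ∈ (f.next a).support := by
      rw [f.next_of_notMem hc]
      exact (G.R_support _ hc t).2 hE
    obtain ⟨c', h1, h2⟩ := exists_conf_of_mem_next this
    exact mem_reached.2 ⟨c', ha.tail h1, h2⟩
  · obtain ⟨a, ha, rfl⟩ := mem_reached.1 hs
    refine ⟨f.determinize a.mem, fun π hπ n => ?_, fun π hπ i => ?_⟩
    · obtain ⟨ρ, h0, hstep, hst⟩ := exists_path_of_outcome_determinize hπ
      have hcon : ∀ n, Conn f.matrix c (ρ n) := by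
        intro n
        induction n with
        | zero => rw [h0]; exact ha
        | succ n ih => exact ih.tail (f.matrix_pos_iff.2 (hstep n))
      exact mem_reached.2 ⟨ρ n, hcon n, hst n⟩
    · obtain ⟨ρ, h0, hstep, hst⟩ := exists_path_of_outcome_determinize hπ
      have := hgood.conn ha ρ h0 hstep i
      have h2 : (fun n => (ρ n).state) = π := funext hst
      rw [h2] at this
      exact this

/-- A recurrent class that meets a maximal winning end-component stays in it. -/
lemma state_mem_of_conn {U : Finset S} (hU : G.IsMWEC U) {c c' : f.Conf}
    (hrec : c ∈ Rec f.matrix) (hgood : Good c) (hc : c.state ∈ U) (hcc : Conn f.matrix c c') :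
    c'.state ∈ U :=
  hU.subset_of_mem (isWEC_reached hrec hgood) hc
    (mem_reached.2 ⟨c, Relation.ReflTransGen.refl, rfl⟩) (mem_reached.2 ⟨c', hcc, rfl⟩)

lemma exists_isMWEC_of_rec {c : f.Conf} (hrec : c ∈ Rec f.matrix) (hgood : Good c) :
    ∃ U, G.IsMWEC U ∧ c.state ∈ U := by
  obtain ⟨U, hU, hsub⟩ := (isWEC_reached hrec hgood).exists_isMWEC
  exact ⟨U, hU, hsub (mem_reached.2 ⟨c, Relation.ReflTransGen.refl, rfl⟩)⟩

end Strategy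

end MDP

/-! ### Transient and recurrent behaviour of a finite chain. -/

namespace FiniteChain

variable {C : Type*} [Fintype C]

open Classical in
/-- A chain first visits transient states, `z c` times in expectation, and then enters the recurrent
part in `c` with probability `l c`. The limit frequencies `ξ` of a closed recurrent set are the
probability to enter it. -/
lemma exists_transient_decomposition {p : C → C → ℝ} {α : C → ℝ} (hp : IsStochastic p)
    (hα : ∀ c, 0 ≤ α c) (h1 : ∑ c, α c = 1) :
    ∃ (ξ z l : C → ℝ) (φ : ℕ → ℕ), StrictMono φ ∧ (∀ c, 0 ≤ ξ c) ∧ (∀ c, 0 ≤ z c) ∧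
      (∀ c, 0 ≤ l c) ∧ ∑ c, ξ c = 1 ∧ (∀ b, ∑ a, ξ a * p a b = ξ b) ∧
      (∀ c, Tendsto (fun k => (∑ j ∈ Finset.range (φ k), evolve p α j c) / φ k) atTop
        (𝓝 (ξ c))) ∧
      (∀ c ∈ Rec p, z c = 0) ∧ (∀ c ∉ Rec p, l c = 0) ∧ (∀ c ∉ Rec p, ξ c = 0) ∧
      (∀ c, z c + l c = α c + ∑ a, z a * p a c) ∧
      (∀ c, 0 < ξ c ∨ 0 < z c ∨ 0 < l c → ∃ n, 0 < evolve p α n c) ∧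
      ∀ B ⊆ Rec p, (∀ a ∈ B, ∀ b, 0 < p a b → b ∈ B) →
        ∑ c with c ∈ B, ξ c = ∑ c with c ∈ B, l c := by
  obtain ⟨ξ, φ, hφ, hξ0, hξ1, hξst, hlim⟩ := exists_cesaro_limit hp hα h1
  have hμ0 := evolve_nonneg hp hα
  have hcl : ∀ a ∈ Rec p, ∀ b, 0 < p a b → b ∈ Rec p := fun a ha b hab =>
    rec_closed ha (Relation.ReflTransGen.single hab)
  -- The recurrent part is closed and reachable from everywhere, so the expected numbers of visits
  -- to transient states are finite.
  obtain ⟨g, hg0, hgR, hg1⟩ := exists_lyapunov hp (Rec p) fun c => exists_conn_rec p c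
  have hsummable : ∀ c ∉ Rec p, Summable fun n => evolve p α n c := by
    intro c hc
    refine summable_of_sum_range_le (fun n => hμ0 n c) (c := ∑ c, α c * g c) fun n => ?_
    refine le_trans (Finset.sum_le_sum fun k _ => ?_)
      (sum_evolve_le_lyapunov hp hα (Rec p) hcl hg0 hgR hg1 n)
    exact Finset.single_le_sum (f := fun c => evolve p α k c) (fun a _ => hμ0 k a)
      (Finset.mem_filter.2 ⟨Finset.mem_univ c, hc⟩)
  set z : C → ℝ := fun c => if c ∈ Rec p then 0 else ∑' n, evolve p α n c with hz
  have hz0 : ∀ c, 0 ≤ z c := by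
    intro c
    simp only [hz]
    split_ifs
    · exact le_rfl
    · exact tsum_nonneg fun n => hμ0 n c
  have hsum : ∀ a, a ∉ Rec p → HasSum (fun n => evolve p α n a) (z a) := by
    intro a ha
    simp only [hz, if_neg ha]
    exact (hsummable a ha).hasSum
  have htot0 : ∀ c, 0 ≤ α c + ∑ a, z a * p a c := fun c =>
    add_nonneg (hα c) (Finset.sum_nonneg fun a _ => mul_nonneg (hz0 a) (hp.nonneg a c))
  have hztot : ∀ c ∉ Rec p, z c = α c + ∑ a, z a * p a c := by
    intro c hc
    -- A transient state has no recurrent predecessor.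
    have e1 : ∀ n, evolve p α (n + 1) c
        = ∑ a, (if a ∈ Rec p then 0 else evolve p α n a) * p a c := by
      intro n
      refine Finset.sum_congr rfl fun a _ => ?_
      split_ifs with ha
      · have : p a c = 0 := by
          rcases (hp.nonneg a c).eq_or_lt with h | h
          · exact h.symm
          · exact absurd (hcl a ha c h) hc
        rw [this, mul_zero, mul_zero]
      · rfl
    have e2 : HasSum (fun n => evolve p α (n + 1) c) (∑ a, z a * p a c) := by
      simp_rw [e1]
      refine hasSum_sum fun a _ => HasSum.mul_right _ ?_
      by_cases ha : a ∈ Rec p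
      · simp only [hz, if_pos ha]
        exact hasSum_zero
      · simp only [if_neg ha]
        exact hsum a ha
    have e3 := (hasSum_nat_add_iff' (f := fun n => evolve p α n c) 1).2 (hsum c hc)
    have e4 := e3.unique e2
    simp only [Finset.range_one, Finset.sum_singleton] at e4
    have e5 : evolve p α 0 c = α c := rfl
    linarith
  set l : C → ℝ := fun c => if c ∈ Rec p then α c + ∑ a, z a * p a c else 0 with hl
  have hl0 : ∀ c, 0 ≤ l c := by
    intro c
    simp only [hl]
    split_ifs
    · exact htot0 c
    · exact le_rfl
  have hzR : ∀ c ∈ Rec p, z c = 0 := fun c hc => if_pos hc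
  have hlR : ∀ c ∉ Rec p, l c = 0 := fun c hc => if_neg hc
  have hξR : ∀ c ∉ Rec p, ξ c = 0 := by
    intro c hc
    have h2 := ((hsummable c hc).tendsto_atTop_zero.cesaro).comp hφ.tendsto_atTop
    refine tendsto_nhds_unique (hlim c) (h2.congr fun k => ?_)
    simp only [Function.comp]
    rw [div_eq_inv_mul]
  have hzpos : ∀ c, 0 < z c → ∃ n, 0 < evolve p α n c := by
    intro c hc
    by_contra hno
    push Not at hno
    have : ∀ n, evolve p α n c = 0 := fun n => le_antisymm (hno n) (hμ0 n c)
    simp only [hz, this, tsum_zero, ite_self, lt_irrefl] at hc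
  refine ⟨ξ, z, l, φ, hφ, hξ0, hz0, hl0, hξ1, hξst, hlim, hzR, hlR, hξR, ?_, ?_, ?_⟩
  · intro c
    by_cases hc : c ∈ Rec p
    · rw [hzR c hc, zero_add]
      exact if_pos hc
    · rw [hlR c hc, add_zero]
      exact hztot c hc
  · rintro c (hc | hc | hc)
    · by_contra hno
      push Not at hno
      have : ∀ n, evolve p α n c = 0 := fun n => le_antisymm (hno n) (hμ0 n c)
      have h2 := hlim c
      simp only [this, Finset.sum_const_zero, zero_div] at h2
      rw [tendsto_nhds_unique h2 tendsto_const_nhds] at hc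
      exact lt_irrefl _ hc
    · exact hzpos c hc
    · have hcR : c ∈ Rec p := by
        by_contra h
        rw [hlR c h] at hc
        exact lt_irrefl _ hc
      simp only [hl, if_pos hcR] at hc
      rcases (hα c).eq_or_lt with h | h
      · rw [← h, zero_add] at hc
        obtain ⟨a, -, ha⟩ := (Finset.sum_pos_iff_of_nonneg fun a _ =>
          mul_nonneg (hz0 a) (hp.nonneg a c)).1 hc
        have hza : 0 < z a := lt_of_le_of_ne (hz0 a) fun h => by
          rw [← h, zero_mul] at ha; exact lt_irrefl _ ha
        have hpa : 0 < p a c := pos_of_mul_pos_right ha (hz0 a)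
        obtain ⟨n, hn⟩ := hzpos a hza
        exact ⟨n + 1, lt_of_lt_of_le (mul_pos hn hpa) (Finset.single_le_sum
          (f := fun a => evolve p α n a * p a c)
          (fun a _ => mul_nonneg (hμ0 n a) (hp.nonneg a c)) (Finset.mem_univ a))⟩
      · exact ⟨0, h⟩
  · intro B hB hBcl
    -- A recurrent state with a transition into `B` is reached back from `B`, hence lies in the
    -- closed set `B`. So mass enters `B` only from transient states.
    have hBin : ∀ a ∈ Rec p, a ∉ B → ∀ b ∈ B, p a b = 0 := by
      intro a ha haB b hb
      rcases (hp.nonneg a b).eq_or_lt with h | h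
      · exact h.symm
      · have hin : ∀ x, Conn p b x → x ∈ B := by
          intro x hx
          induction hx with
          | refl => exact hb
          | tail _ hxy ih => exact hBcl _ ih _ hxy
        exact absurd (hin a (ha b (Relation.ReflTransGen.single h))) haB
    set q : C → ℝ := fun a => ∑ b with b ∈ B, p a b with hq
    have hqB : ∀ a ∈ B, q a = 1 := by
      intro a ha
      rw [← hp.sum_eq_one a, hq]
      refine Finset.sum_subset (Finset.filter_subset _ _) fun b _ hb => ?_
      rcases (hp.nonneg a b).eq_or_lt with h | h
      · exact h.symm
      · exact absurd (Finset.mem_filter.2 ⟨Finset.mem_univ _, hBcl a ha b h⟩) hb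
    have hqR : ∀ a ∈ Rec p, a ∉ B → q a = 0 := fun a ha haB =>
      Finset.sum_eq_zero fun b hb => hBin a ha haB b (Finset.mem_filter.1 hb).2
    have hstep : ∀ n, ∑ c with c ∈ B, evolve p α (n + 1) c
        = ∑ c with c ∈ B, evolve p α n c
          + ∑ a, (if a ∈ Rec p then 0 else evolve p α n a) * q a := by
      intro n
      have e1 : ∑ c with c ∈ B, evolve p α (n + 1) c = ∑ a, evolve p α n a * q a := by
        simp only [evolve, hq, Finset.mul_sum]
        rw [Finset.sum_comm]
      rw [e1, Finset.sum_filter, ← Finset.sum_add_distrib]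
      refine Finset.sum_congr rfl fun a _ => ?_
      by_cases haB : a ∈ B
      · rw [if_pos haB, if_pos (hB haB), hqB a haB]; ring
      · rw [if_neg haB]
        by_cases haR : a ∈ Rec p
        · rw [hqR a haR haB]; ring
        · rw [if_neg haR]; ring
    have hclosed : ∀ n, ∑ c with c ∈ B, evolve p α n c = ∑ c with c ∈ B, α c
        + ∑ k ∈ Finset.range n, ∑ a, (if a ∈ Rec p then 0 else evolve p α k a) * q a := by
      intro n
      induction n with
      | zero => simp [evolve]
      | succ n ih => rw [hstep, ih, Finset.sum_range_succ, add_assoc]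
    have hlimit : Tendsto (fun n => ∑ c with c ∈ B, evolve p α n c) atTop
        (𝓝 (∑ c with c ∈ B, l c)) := by
      have e1 : ∑ c with c ∈ B, l c = ∑ c with c ∈ B, α c + ∑ a, z a * q a := by
        have : ∀ c ∈ Finset.univ.filter (fun c => c ∈ B), l c = α c + ∑ a, z a * p a c :=
          fun c hc => if_pos (hB (Finset.mem_filter.1 hc).2)
        rw [Finset.sum_congr rfl this, Finset.sum_add_distrib, Finset.sum_comm]
        simp only [hq, Finset.mul_sum]
      rw [e1]
      simp_rw [hclosed]
      refine tendsto_const_nhds.add (HasSum.tendsto_sum_nat ?_)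
      refine hasSum_sum fun a _ => HasSum.mul_right _ ?_
      by_cases ha : a ∈ Rec p
      · simp only [hz, if_pos ha]
        exact hasSum_zero
      · simp only [if_neg ha]
        exact hsum a ha
    have h2 : Tendsto (fun k => ∑ c with c ∈ B,
        (∑ j ∈ Finset.range (φ k), evolve p α j c) / φ k) atTop (𝓝 (∑ c with c ∈ B, ξ c)) :=
      tendsto_finsetSum _ fun c _ => hlim c
    -- The mass in `B` converges to the `l`-mass of `B`, hence so do its averages, which along `φ`
    -- tend to the `ξ`-mass.
    refine tendsto_nhds_unique h2 ((hlimit.cesaro.comp hφ.tendsto_atTop).congr fun k => ?_)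
    simp only [Function.comp]
    rw [← Finset.sum_div, Finset.sum_comm, div_eq_inv_mul]

end FiniteChain

/-! ### The flows of a finite-memory strategy, projected to the states of the MDP. -/

namespace MDP

variable {S : Type*} [Fintype S] {d : ℕ} {G : MDP S d}

open Classical in
/-- The constraints of the system `T` that do not mention the payoff. -/
structure WeakSolves (G : MDP S d) (s₀ : S) (y : S → ℝ) (ye x : S → S → ℝ) : Prop where
  y_nonneg : ∀ s, 0 ≤ y s
  ye_nonneg : ∀ s t, G.E s t → 0 ≤ ye s t
  x_nonneg : ∀ s t, G.E s t → 0 ≤ x s t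
  y_flow : ∀ s, (if s = s₀ then 1 else 0) + ∑ r with G.E r s, ye r s
    = ∑ t with G.E s t, ye s t + y s
  y_random : ∀ s (hs : s ∉ G.ctrl) t, G.E s t →
    ye s t = (G.R s hs t).toReal * (∑ r with G.E r s, ye r s - y s)
  y_sum : ∑ U : Finset S with G.IsMWEC U, ∑ s ∈ U, y s = 1
  x_y : ∀ U : Finset S, G.IsMWEC U → ∑ s ∈ U, y s = ∑ r ∈ U, ∑ s ∈ U with G.E r s, x r s
  x_supp : ∀ s t, G.E s t → (¬ ∃ U, G.IsMWEC U ∧ s ∈ U ∧ t ∈ U) → x s t = 0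
  x_flow : ∀ s, ∑ r with G.E r s, x r s = ∑ t with G.E s t, x s t
  x_random : ∀ s (hs : s ∉ G.ctrl) t, G.E s t →
    x s t = (G.R s hs t).toReal * ∑ r with G.E r s, x r s

namespace Strategy

variable (f : G.Strategy) [Fintype f.Conf] [Fintype f.Mem]

lemma sum_matrix_mem (c : f.Conf) (s : S) :
    ∑ m, f.matrix c ⟨s, m⟩ = (f.next c s).toReal := by
  simp only [matrix_eq_mul, ← Finset.mul_sum, PMF.sum_toReal, mul_one]

lemma next_eq_zero {c : f.Conf} {t : S} (h : ¬ G.E c.state t) : (f.next c t).toReal = 0 := by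
  by_contra hne
  exact h (f.edge_of_mem_next ((PMF.toReal_pos_iff _ _).1
    (lt_of_le_of_ne ENNReal.toReal_nonneg (Ne.symm hne))))

open Classical in
lemma sum_succ (c : f.Conf) : ∑ t with G.E c.state t, (f.next c t).toReal = 1 := by
  rw [← (f.next c).sum_toReal]
  refine Finset.sum_subset (Finset.filter_subset _ _) fun t _ ht => f.next_eq_zero fun h => ht ?_
  exact Finset.mem_filter.2 ⟨Finset.mem_univ _, h⟩

/-- The flow along an edge, if `a` is the flow through the states of the induced chain. -/
noncomputable def edgeFlow (a : f.Conf → ℝ) (s t : S) : ℝ :=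
  ∑ m, a ⟨s, m⟩ * (f.next ⟨s, m⟩ t).toReal

variable {f}

lemma edgeFlow_nonneg {a : f.Conf → ℝ} (ha : ∀ c, 0 ≤ a c) (s t : S) : 0 ≤ f.edgeFlow a s t :=
  Finset.sum_nonneg fun _ _ => mul_nonneg (ha _) ENNReal.toReal_nonneg

open Classical in
lemma sum_edgeFlow_out (a : f.Conf → ℝ) (s : S) :
    ∑ t with G.E s t, f.edgeFlow a s t = ∑ m, a ⟨s, m⟩ := by
  unfold edgeFlow
  rw [Finset.sum_comm]
  refine Finset.sum_congr rfl fun m _ => ?_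
  rw [← Finset.mul_sum, f.sum_succ ⟨s, m⟩, mul_one]

open Classical in
lemma sum_edgeFlow_in (a : f.Conf → ℝ) (s : S) :
    ∑ r with G.E r s, f.edgeFlow a r s = ∑ m, ∑ c, a c * f.matrix c ⟨s, m⟩ := by
  have h1 : ∑ r with G.E r s, f.edgeFlow a r s = ∑ r, f.edgeFlow a r s := by
    refine Finset.sum_subset (Finset.filter_subset _ _) fun r _ hr => ?_
    refine Finset.sum_eq_zero fun m _ => ?_
    rw [f.next_eq_zero (c := ⟨r, m⟩) fun h => hr (Finset.mem_filter.2 ⟨Finset.mem_univ _, h⟩),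
      mul_zero]
  rw [h1, Finset.sum_comm]
  simp_rw [← Finset.mul_sum, sum_matrix_mem]
  rw [f.sum_conf]
  rfl

lemma edgeFlow_random (a : f.Conf → ℝ) {s : S} (hs : s ∉ G.ctrl) (t : S) :
    f.edgeFlow a s t = (G.R s hs t).toReal * ∑ m, a ⟨s, m⟩ := by
  unfold edgeFlow
  rw [Finset.mul_sum]
  refine Finset.sum_congr rfl fun m _ => ?_
  rw [f.next_of_notMem (c := ⟨s, m⟩) hs, mul_comm]

open Classical in
lemma sum_edgeFlow_payoff (a : f.Conf → ℝ) (i : Fin d) :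
    ∑ s, ∑ t with G.E s t, f.edgeFlow a s t * G.w s t i
      = ∑ c, a c * ∑ c', f.matrix c c' * (G.w c.state c'.state i : ℝ) := by
  rw [f.sum_conf]
  refine Finset.sum_congr rfl fun s _ => ?_
  have h1 : ∀ m, ∑ c', f.matrix ⟨s, m⟩ c' * (G.w s c'.state i : ℝ)
      = ∑ t with G.E s t, (f.next ⟨s, m⟩ t).toReal * G.w s t i := by
    intro m
    rw [f.sum_matrix_mul_state ⟨s, m⟩ fun t => (G.w s t i : ℝ)]
    refine (Finset.sum_subset (Finset.filter_subset _ _) fun t _ ht => ?_).symm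
    rw [f.next_eq_zero (c := ⟨s, m⟩) fun h => ht (Finset.mem_filter.2 ⟨Finset.mem_univ _, h⟩),
      zero_mul]
  simp only [h1, edgeFlow, Finset.sum_mul, Finset.mul_sum]
  rw [Finset.sum_comm]
  exact Finset.sum_congr rfl fun m _ => Finset.sum_congr rfl fun t _ => by ring

end Strategy

end MDP

namespace MDP

variable {S : Type*} [Fintype S] {d : ℕ} {G : MDP S d}

namespace Strategy

variable {f : G.Strategy} [Fintype f.Conf]

/-- If all paths from the states of a stationary distribution have a positive mean payoff, then
the expected weight under this distribution is positive. -/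
lemma payoff_pos_of_stationary {η : f.Conf → ℝ} (h0 : ∀ c, 0 ≤ η c) (hne : ∃ c, 0 < η c)
    (hst : ∀ b, ∑ a, η a * f.matrix a b = η b) (hgood : ∀ c, 0 < η c → Good c) (i : Fin d) :
    0 < ∑ c, η c * ∑ c', f.matrix c c' * (G.w c.state c'.state i : ℝ) := by
  set M := ∑ c, η c with hM
  have hMpos : 0 < M := by
    obtain ⟨c, hc⟩ := hne
    exact lt_of_lt_of_le hc (Finset.single_le_sum (fun a _ => h0 a) (Finset.mem_univ c))
  have hsum : ∑ c, ENNReal.ofReal (η c / M) = 1 := by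
    rw [← ENNReal.ofReal_sum_of_nonneg fun c _ => div_nonneg (h0 c) hMpos.le, ← Finset.sum_div,
      ← hM, div_self hMpos.ne', ENNReal.ofReal_one]
  set α : PMF f.Conf := PMF.ofFintype _ hsum with hα
  have hαval : ∀ c, (α c).toReal = η c / M := fun c => by
    rw [hα, PMF.ofFintype_apply, ENNReal.toReal_ofReal (div_nonneg (h0 c) hMpos.le)]
  -- Started in the normalised `η`, the chain has the same law at all times, so the expected
  -- averages are constant. By Fatou's lemma they are at least the expected mean payoff, whose
  -- integrand is almost surely positive.
  have hev : ∀ n, evolve f.matrix (fun c => (α c).toReal) n = fun c => η c / M := by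
    intro n
    induction n with
    | zero => exact funext hαval
    | succ n ih =>
      funext b
      simp only [evolve, ih]
      rw [← hst b, Finset.sum_div]
      exact Finset.sum_congr rfl fun a _ => by ring
  set r : f.Conf → ℝ := fun c => ∑ c', f.matrix c c' * (G.w c.state c'.state i : ℝ)
  have hle := f.integral_meanPayoff_le α i (φ := fun k => k + 1)
    (strictMono_id.add_const 1) (l := ∑ c, η c / M * r c) (by
      refine tendsto_const_nhds.congr fun k => ?_
      simp only [hev, Finset.sum_const, Finset.card_range, nsmul_eq_mul]
      rw [mul_div_cancel_left₀]
      exact_mod_cast Nat.succ_ne_zero k)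
  have hpos : ∀ᵐ ρ ∂(f.chainMeasure α), 0 < G.meanPayoff (fun n => (ρ n).state) i := by
    filter_upwards [f.ae_chainMeasure_step α, f.ae_chainMeasure_zero α] with ρ h1 h2
    refine hgood (ρ 0) ?_ ρ rfl h1 i
    have := (PMF.toReal_pos_iff _ _).2 h2
    rw [hαval] at this
    exact (div_pos_iff_of_pos_right hMpos).1 this
  have hint : 0 < ∫ ρ, G.meanPayoff (fun n => (ρ n).state) i ∂(f.chainMeasure α) := by
    refine lt_of_le_of_ne (integral_nonneg_of_ae (hpos.mono fun ρ h => h.le)) fun h => ?_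
    have hz := (integral_eq_zero_iff_of_nonneg_ae (hpos.mono fun ρ h => h.le)
      (f.integrable_meanPayoff α i)).1 h.symm
    obtain ⟨ρ, h1, h2⟩ := (hpos.and hz).exists
    exact h1.ne' h2
  have e : ∑ c, η c / M * r c = (∑ c, η c * r c) / M := by
    rw [Finset.sum_div]
    exact Finset.sum_congr rfl fun a _ => by ring
  rw [e] at hle
  exact (div_pos_iff_of_pos_right hMpos).1 (hint.trans_le hle)

open Classical in
lemma sum_conf_mem [Fintype f.Mem] (U : Finset S) (φ : f.Conf → ℝ) :
    ∑ s ∈ U, ∑ m, φ ⟨s, m⟩ = ∑ c with c.state ∈ U, φ c := by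
  rw [Finset.sum_filter, f.sum_conf, ← Finset.sum_subset (Finset.subset_univ U)]
  · exact Finset.sum_congr rfl fun s hs => Finset.sum_congr rfl fun m _ => (if_pos hs).symm
  · intro s _ hs
    exact Finset.sum_eq_zero fun m _ => if_neg hs

/-- The initial distribution of the induced chain. -/
noncomputable def initMass (f : G.Strategy) (s₀ : S) (c : f.Conf) : ℝ :=
  ((f.init.map fun m => (⟨s₀, m⟩ : f.Conf)) c).toReal

lemma initMass_nonneg (s₀ : S) (c : f.Conf) : 0 ≤ f.initMass s₀ c := ENNReal.toReal_nonneg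

lemma sum_initMass (s₀ : S) : ∑ c, f.initMass s₀ c = 1 := PMF.sum_toReal _

lemma mem_init_of_initMass_pos {s₀ : S} {c : f.Conf} (h : 0 < f.initMass s₀ c) :
    c.state = s₀ ∧ c.mem ∈ f.init.support := by
  have h1 := (PMF.toReal_pos_iff _ _).1 h
  rw [PMF.mem_support_map_iff] at h1
  obtain ⟨m, hm, rfl⟩ := h1
  exact ⟨rfl, hm⟩

open Classical in
lemma sum_initMass_mem [Fintype f.Mem] (s₀ s : S) :
    ∑ m, f.initMass s₀ ⟨s, m⟩ = if s = s₀ then 1 else 0 := by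
  have h0 : ∀ s, s ≠ s₀ → ∑ m, f.initMass s₀ ⟨s, m⟩ = 0 := fun s hs =>
    Finset.sum_eq_zero fun m _ => by
      by_contra hne
      exact hs (mem_init_of_initMass_pos
        (lt_of_le_of_ne (initMass_nonneg s₀ _) (Ne.symm hne))).1
  split_ifs with h
  · rw [h, ← sum_initMass (f := f) s₀, f.sum_conf]
    exact (Finset.sum_eq_single s₀ (fun t _ ht => h0 t ht)
      fun h => absurd (Finset.mem_univ _) h).symm
  · exact h0 s h

lemma good_of_evolve_pos {s₀ : S} (hWC : (0 : Fin d → ℝ) ∈ f.WCSol s₀) {n : ℕ} {c : f.Conf}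
    (h : 0 < evolve f.matrix (f.initMass s₀) n c) : Good c := by
  induction n generalizing c with
  | zero =>
    obtain ⟨h1, h2⟩ := mem_init_of_initMass_pos h
    obtain ⟨s, m⟩ := c
    subst h1
    exact good_init hWC h2
  | succ n ih =>
    have h0 := evolve_nonneg f.isStochastic_matrix (initMass_nonneg (f := f) s₀) n
    obtain ⟨a, -, ha⟩ := (Finset.sum_pos_iff_of_nonneg fun a _ =>
      mul_nonneg (h0 a) (f.isStochastic_matrix.nonneg a c)).1 h
    have h1 : 0 < evolve f.matrix (f.initMass s₀) n a :=
      pos_of_mul_pos_left ha (f.isStochastic_matrix.nonneg a c)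
    exact (ih h1).step (f.matrix_pos_iff.1 (pos_of_mul_pos_right ha (h0 a)))

open Classical in
/-- A finite-memory strategy that surely has a positive mean payoff gives a solution of the
constraints that do not mention the payoff. -/
lemma exists_weakSolves [Fintype f.Mem] {s₀ : S} (hs₀ : s₀ ∈ G.ctrl)
    (hWC : (0 : Fin d → ℝ) ∈ f.WCSol s₀) :
    ∃ (y : S → ℝ) (ye x : S → S → ℝ), WeakSolves G s₀ y ye x ∧
      (∀ i, f.expMeanPayoff s₀ i ≤ ∑ s, ∑ t with G.E s t, x s t * G.w s t i) ∧
      (∀ U, G.IsMWEC U → ∀ i, 0 ≤ ∑ s ∈ U, ∑ t ∈ U with G.E s t, x s t * G.w s t i ∧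
        (0 < ∑ s ∈ U, y s → 0 < ∑ s ∈ U, ∑ t ∈ U with G.E s t, x s t * G.w s t i)) ∧
      ∀ U, G.IsMWEC U → ∀ δ N, (∀ n ≥ N, δ ≤ ∑ c with c.state ∈ U,
        evolve f.matrix (f.initMass s₀) n c) → δ ≤ ∑ s ∈ U, y s := by
  have hp := f.isStochastic_matrix
  obtain ⟨ξ, z, l, φ, hφ, hξ0, hz0, hl0, hξ1, hξst, hlim, hzR, hlR, hξR, hzl, hpos, hB⟩ :=
    exists_transient_decomposition hp (initMass_nonneg (f := f) s₀) (sum_initMass s₀)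
  have hposξ : ∀ c, ξ c ≠ 0 → c ∈ Rec f.matrix ∧ Good c := fun c hc => by
    refine ⟨by_contra fun h => hc (hξR c h), ?_⟩
    obtain ⟨n, hn⟩ := hpos c (Or.inl (lt_of_le_of_ne (hξ0 c) (Ne.symm hc)))
    exact good_of_evolve_pos hWC hn
  have hposl : ∀ c, l c ≠ 0 → c ∈ Rec f.matrix ∧ Good c := fun c hc => by
    refine ⟨by_contra fun h => hc (hlR c h), ?_⟩
    obtain ⟨n, hn⟩ := hpos c (Or.inr (Or.inr (lt_of_le_of_ne (hl0 c) (Ne.symm hc))))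
    exact good_of_evolve_pos hWC hn
  -- `ξ` is carried by recurrent classes, and one that meets a MWEC stays in it; so the flow of `ξ`
  -- never crosses the boundary of a MWEC.
  have hstay : ∀ U, G.IsMWEC U → ∀ a b, ξ a ≠ 0 → 0 < f.matrix a b →
      (a.state ∈ U ↔ b.state ∈ U) := by
    intro U hU a b ha hab
    obtain ⟨hrec, hgood⟩ := hposξ a ha
    have hc : Conn f.matrix a b := Relation.ReflTransGen.single hab
    exact ⟨fun h => state_mem_of_conn hU hrec hgood h hc,
      fun h => state_mem_of_conn hU (rec_closed hrec hc) (hgood.conn hc) h (hrec b hc)⟩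
  have hxU : ∀ U, G.IsMWEC U → ∀ s ∈ U, ∀ t ∉ U, f.edgeFlow ξ s t = 0 := by
    intro U hU s hs t ht
    refine Finset.sum_eq_zero fun m _ => ?_
    by_contra hne
    have h1 := left_ne_zero_of_mul hne
    have h2 := (PMF.toReal_pos_iff _ _).1
      (lt_of_le_of_ne ENNReal.toReal_nonneg (Ne.symm (right_ne_zero_of_mul hne)))
    obtain ⟨c', h3, h4⟩ := exists_conf_of_mem_next h2
    exact ht (h4 ▸ (hstay U hU _ c' h1 h3).1 hs)
  have hin : ∀ U, G.IsMWEC U → ∀ s ∈ U, ∀ v : S → ℝ,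
      ∑ t ∈ U with G.E s t, f.edgeFlow ξ s t * v t = ∑ t with G.E s t, f.edgeFlow ξ s t * v t := by
    intro U hU s hs v
    refine Finset.sum_subset (Finset.filter_subset_filter _ (Finset.subset_univ U))
      fun t ht ht' => ?_
    rw [hxU U hU s hs t fun h => ht' (Finset.mem_filter.2 ⟨h, (Finset.mem_filter.1 ht).2⟩),
      zero_mul]
  -- This becomes (B). The good recurrent configurations over `U` form a closed recurrent set, to
  -- which the equality of the masses of `ξ` and `l` applies.
  have hUsum : ∀ U, G.IsMWEC U → ∑ c with c.state ∈ U, l c = ∑ c with c.state ∈ U, ξ c := by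
    intro U hU
    obtain ⟨B, hBmem⟩ : ∃ B : Set f.Conf,
        ∀ c, c ∈ B ↔ (c ∈ Rec f.matrix ∧ Good c) ∧ c.state ∈ U := ⟨{c | _}, fun _ => Iff.rfl⟩
    have h1 := hB B (fun c hc => ((hBmem c).1 hc).1.1) fun a ha b hab => by
      have hc : Conn f.matrix a b := Relation.ReflTransGen.single hab
      rw [hBmem] at ha ⊢
      exact ⟨⟨rec_closed ha.1.1 hc, ha.1.2.conn hc⟩, state_mem_of_conn hU ha.1.1 ha.1.2 ha.2 hc⟩
    have h2 : ∀ v : f.Conf → ℝ, (∀ c, v c ≠ 0 → c ∈ Rec f.matrix ∧ Good c) →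
        ∑ c with c ∈ B, v c = ∑ c with c.state ∈ U, v c := by
      intro v hv
      refine Finset.sum_subset (fun c hc => ?_) fun c hc hc' => ?_
      · exact Finset.mem_filter.2 ⟨Finset.mem_univ _, ((hBmem c).1 (Finset.mem_filter.1 hc).2).2⟩
      · by_contra hne
        exact hc' (Finset.mem_filter.2
          ⟨Finset.mem_univ _, (hBmem c).2 ⟨hv c hne, (Finset.mem_filter.1 hc).2⟩⟩)
    rw [h2 ξ hposξ, h2 l hposl] at h1
    exact h1.symm
  have hflow : ∀ s, (if s = s₀ then 1 else 0) + ∑ r with G.E r s, f.edgeFlow z r s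
      = ∑ m, z ⟨s, m⟩ + ∑ m, l ⟨s, m⟩ := by
    intro s
    rw [← sum_initMass_mem (f := f), sum_edgeFlow_in, ← Finset.sum_add_distrib,
      ← Finset.sum_add_distrib]
    exact Finset.sum_congr rfl fun m _ => (hzl _).symm
  have hl1 : ∑ c, l c = 1 := by
    have h1 := hB (Rec f.matrix) (Set.Subset.refl _) fun a ha b hab =>
      rec_closed ha (Relation.ReflTransGen.single hab)
    rw [Finset.sum_filter_of_ne fun c _ hc => (hposξ c hc).1,
      Finset.sum_filter_of_ne fun c _ hc => (hposl c hc).1, hξ1] at h1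
    exact h1.symm
  have hin_x : ∀ s, ∑ r with G.E r s, f.edgeFlow ξ r s = ∑ m, ξ ⟨s, m⟩ := fun s => by
    rw [sum_edgeFlow_in]
    exact Finset.sum_congr rfl fun m _ => hξst _
  have hlocal : ∀ U, G.IsMWEC U → ∀ i,
      ∑ s ∈ U, ∑ t ∈ U with G.E s t, f.edgeFlow ξ s t * (G.w s t i : ℝ)
        = ∑ c, (if c.state ∈ U then ξ c else 0)
            * ∑ c', f.matrix c c' * (G.w c.state c'.state i : ℝ) := by
    intro U hU i
    rw [← sum_edgeFlow_payoff, ← Finset.sum_subset (Finset.subset_univ U)]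
    · refine Finset.sum_congr rfl fun s hs => ?_
      rw [hin U hU s hs fun t => (G.w s t i : ℝ)]
      simp only [edgeFlow, if_pos hs]
    · intro s _ hs
      simp only [edgeFlow, if_neg hs, zero_mul, Finset.sum_const_zero]
  have hlocal_pos : ∀ U, G.IsMWEC U → ∀ i, 0 < ∑ c with c.state ∈ U, ξ c →
      0 < ∑ s ∈ U, ∑ t ∈ U with G.E s t, f.edgeFlow ξ s t * (G.w s t i : ℝ) := by
    intro U hU i hUpos
    rw [hlocal U hU i]
    obtain ⟨c, hcU, hc⟩ := (Finset.sum_pos_iff_of_nonneg fun a _ => hξ0 a).1 hUpos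
    refine payoff_pos_of_stationary (η := fun c => if c.state ∈ U then ξ c else 0) (fun c => ?_)
      ⟨c, ?_⟩ (fun b => ?_) (fun c hc => ?_) i
    · split_ifs
      · exact hξ0 c
      · exact le_rfl
    · rw [if_pos (Finset.mem_filter.1 hcU).2]
      exact hc
    · have h1 : ∀ a, (if a.state ∈ U then ξ a else 0) * f.matrix a b
          = if b.state ∈ U then ξ a * f.matrix a b else 0 := by
        intro a
        by_cases ha : ξ a * f.matrix a b = 0
        · rw [ha, ite_mul, zero_mul, ha, ite_self, ite_self]
        · rw [ite_mul, zero_mul, if_congr (hstay U hU a b (left_ne_zero_of_mul ha)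
            (lt_of_le_of_ne (hp.nonneg a b) (Ne.symm (right_ne_zero_of_mul ha)))) rfl rfl]
      simp only [h1]
      split_ifs
      · exact hξst b
      · exact Finset.sum_const_zero
    · split_ifs at hc
      · exact (hposξ c hc.ne').2
      · exact absurd hc (lt_irrefl _)
  -- The leak is the probability of entering the recurrent part, the flow counts expected
  -- transitions out of transient configurations, and the frequencies are those of the limit.
  refine ⟨fun s => ∑ m, l ⟨s, m⟩, f.edgeFlow z, f.edgeFlow ξ,
    { y_nonneg := fun s => Finset.sum_nonneg fun m _ => hl0 _
      ye_nonneg := fun s t _ => edgeFlow_nonneg hz0 s t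
      x_nonneg := fun s t _ => edgeFlow_nonneg hξ0 s t
      y_flow := fun s => by rw [hflow, sum_edgeFlow_out]
      y_random := fun s hs t _ => ?_
      y_sum := ?_
      x_y := fun U hU => ?_
      x_supp := fun s t _ hno => ?_
      x_flow := fun s => by rw [hin_x, sum_edgeFlow_out]
      x_random := fun s hs t _ => by rw [hin_x, edgeFlow_random _ hs] },
    fun i => ?_, fun U hU i => ?_, fun U hU δ N hδ => ?_⟩
  -- (A1') ignores the initial flow. There is none at a state of Random, since `s₀` belongs to
  -- Controller.
  · have h1 := hflow s
    rw [if_neg (fun h : s = s₀ => hs (h ▸ hs₀)), zero_add] at h1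
    rw [h1, add_sub_cancel_right, edgeFlow_random _ hs]
  · rw [sum_isMWEC, ← f.sum_conf, hl1]
    intro s hs
    obtain ⟨m, -, hm⟩ := Finset.exists_ne_zero_of_sum_ne_zero hs
    obtain ⟨h1, h2⟩ := hposl _ hm
    exact exists_isMWEC_of_rec h1 h2
  · rw [sum_conf_mem, hUsum U hU, ← sum_conf_mem]
    refine Finset.sum_congr rfl fun s hs => ?_
    have h1 := hin U hU s hs fun _ => 1
    simp only [mul_one] at h1
    rw [h1, sum_edgeFlow_out]
  · by_contra hne
    obtain ⟨m, -, hm⟩ := Finset.exists_ne_zero_of_sum_ne_zero hne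
    obtain ⟨h1, h2⟩ := hposξ _ (left_ne_zero_of_mul hm)
    obtain ⟨U, hU, hsU⟩ := exists_isMWEC_of_rec h1 h2
    refine hno ⟨U, hU, hsU, ?_⟩
    by_contra ht
    exact hne (hxU U hU s hsU t ht)
  · rw [sum_edgeFlow_payoff]
    refine f.integral_meanPayoff_le (f.init.map fun m => ⟨s₀, m⟩) i hφ ?_
    have h1 : ∀ k, (∑ j ∈ Finset.range (φ k), ∑ c, evolve f.matrix (f.initMass s₀) j c *
        ∑ c', f.matrix c c' * (G.w c.state c'.state i : ℝ)) / (φ k : ℝ)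
        = ∑ c, (∑ j ∈ Finset.range (φ k), evolve f.matrix (f.initMass s₀) j c) / φ k *
        ∑ c', f.matrix c c' * (G.w c.state c'.state i : ℝ) := by
      intro k
      rw [Finset.sum_comm, Finset.sum_div]
      refine Finset.sum_congr rfl fun c _ => ?_
      rw [← Finset.sum_mul, mul_div_right_comm]
    exact (tendsto_finsetSum _ fun c _ => (hlim c).mul_const _).congr fun k => (h1 k).symm
  · rw [sum_conf_mem, hUsum U hU]
    refine ⟨?_, hlocal_pos U hU i⟩
    rcases (Finset.sum_nonneg fun c (_ : c ∈ Finset.univ.filter fun c : f.Conf => c.state ∈ U) =>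
      hξ0 c).eq_or_lt with h | h
    · rw [hlocal U hU i]
      refine le_of_eq (Finset.sum_eq_zero fun c _ => ?_).symm
      split_ifs with hc
      · rw [(Finset.sum_eq_zero_iff_of_nonneg fun c _ => hξ0 c).1 h.symm c
          (Finset.mem_filter.2 ⟨Finset.mem_univ _, hc⟩), zero_mul]
      · rw [zero_mul]
    · exact (hlocal_pos U hU i h).le
  · rw [sum_conf_mem, hUsum U hU]
    have h1 : Tendsto (fun k => ∑ c with c.state ∈ U,
        (∑ j ∈ Finset.range (φ k), evolve f.matrix (f.initMass s₀) j c) / φ k) atTop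
        (𝓝 (∑ c with c.state ∈ U, ξ c)) := tendsto_finsetSum _ fun c _ => hlim c
    -- The first `N` terms may contribute nothing, but their share of the average vanishes.
    have h2 : Tendsto (fun n : ℕ => δ - δ * N * (1 / (n : ℝ))) atTop (𝓝 (δ - δ * N * 0)) :=
      tendsto_const_nhds.sub (tendsto_one_div_atTop_nhds_zero_nat.const_mul _)
    rw [mul_zero, sub_zero] at h2
    refine le_of_tendsto_of_tendsto (h2.comp hφ.tendsto_atTop) h1 ?_
    filter_upwards [eventually_ge_atTop (N + 1)] with k hk
    have hk' : N + 1 ≤ φ k := hk.trans (hφ.id_le k)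
    have hpos' : (0 : ℝ) < φ k := by exact_mod_cast Nat.lt_of_lt_of_le (Nat.succ_pos N) hk'
    rw [← Finset.sum_div, Finset.sum_comm, le_div_iff₀ hpos']
    simp only [Function.comp]
    have h3 : (δ - δ * N * (1 / (φ k : ℝ))) * φ k = δ * ((φ k - N : ℕ) : ℝ) := by
      rw [Nat.cast_sub (by omega)]
      field_simp
    rw [h3, ← Finset.sum_range_add_sum_Ico _ (show N ≤ φ k by omega)]
    have h4 : δ * ((φ k - N : ℕ) : ℝ) = ∑ j ∈ Finset.Ico N (φ k), δ := by
      rw [Finset.sum_const, Nat.card_Ico, nsmul_eq_mul, mul_comm]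
    rw [h4]
    refine le_add_of_nonneg_of_le (Finset.sum_nonneg fun j _ => Finset.sum_nonneg fun c _ =>
      evolve_nonneg hp (initMass_nonneg s₀) j c) (Finset.sum_le_sum fun j hj =>
        hδ j (Finset.mem_Ico.1 hj).1)

end Strategy

end MDP

namespace MDP

variable {S : Type*} [Fintype S] {d : ℕ} {G : MDP S d}

/-! ### Modes and exploration -/

open Classical in
/-- The maximal winning end-component that contains `s`; the set of all states if there is none. -/
noncomputable def modeOf (G : MDP S d) (s : S) : Finset S :=
  if h : ∃ U, G.IsMWEC U ∧ s ∈ U then h.choose else Finset.univ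

lemma modeOf_eq {U : Finset S} (hU : G.IsMWEC U) {s : S} (hs : s ∈ U) : G.modeOf s = U := by
  have h : ∃ U, G.IsMWEC U ∧ s ∈ U := ⟨U, hU, hs⟩
  rw [modeOf, dif_pos h]
  exact h.choose_spec.1.eq_of_mem hU h.choose_spec.2 hs

lemma modeOf_cases (G : MDP S d) (s : S) :
    (G.IsMWEC (G.modeOf s) ∧ s ∈ G.modeOf s) ∨ G.modeOf s = Finset.univ := by
  by_cases h : ∃ U, G.IsMWEC U ∧ s ∈ U
  · obtain ⟨U, hU, hs⟩ := h
    rw [modeOf_eq hU hs]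
    exact Or.inl ⟨hU, hs⟩
  · exact Or.inr (dif_neg h)

lemma mem_modeOf (G : MDP S d) (s : S) : s ∈ G.modeOf s := by
  rcases G.modeOf_cases s with h | h
  · exact h.2
  · rw [h]; exact Finset.mem_univ s

lemma IsPruned.profitable_modeOf (hG : G.IsPruned) (s : S) : G.Profitable (G.modeOf s) := by
  rcases G.modeOf_cases s with h | h
  · exact h.1.1.profitable
  · rw [h]; exact hG.profitable

/-- The plan with the modes `modeOf`. -/
noncomputable def IsPruned.plan (hG : G.IsPruned) (time len : ℕ) (hlen : 1 ≤ len)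
    (first : ℕ → ∀ s, G.Move s) (gamble : ∀ s, G.Move s)
    (hgamble : ∀ s, ∀ t ∈ (gamble s).dist.support, t ∈ G.modeOf s) : G.Plan where
  time := time
  len := len
  first := first
  gamble := gamble
  mode := G.modeOf
  len_pos := hlen
  mem_mode := G.mem_modeOf
  profitable := hG.profitable_modeOf
  gamble_mem s t ht u hu := by
    rcases G.modeOf_cases s with h | h
    · rw [← modeOf_eq h.1 ht]
      exact hgamble t u hu
    · rw [h]; exact Finset.mem_univ u

lemma isRational_uniformOfFinset {A : Type*} (F : Finset A) (hF : F.Nonempty) :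
    (PMF.uniformOfFinset F hF).IsRational := by
  classical
  intro a
  rw [PMF.uniformOfFinset_apply]
  split_ifs
  · exact ⟨(F.card : ℚ)⁻¹, by simp⟩
  · exact ⟨0, by simp⟩

/-- There is a move that takes all edges into `U`. -/
lemma exists_full_move {U : Finset S} {s : S} (h : ∃ t ∈ U, G.E s t)
    (hR : s ∉ G.ctrl → ∀ t, G.E s t → t ∈ U) :
    ∃ m : G.Move s, ∀ t, t ∈ m.dist.support ↔ t ∈ U ∧ G.E s t := by
  classical
  by_cases hs : s ∈ G.ctrl
  · have hne : (U.filter fun t => G.E s t).Nonempty := by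
      obtain ⟨t, htU, ht⟩ := h
      exact ⟨t, Finset.mem_filter.2 ⟨htU, ht⟩⟩
    have hsupp : ∀ t, t ∈ (PMF.uniformOfFinset _ hne).support ↔ t ∈ U ∧ G.E s t := fun t => by
      rw [PMF.mem_support_uniformOfFinset_iff, Finset.mem_filter]
    exact ⟨⟨PMF.uniformOfFinset _ hne, isRational_uniformOfFinset _ _,
      fun t ht => ((hsupp t).1 ht).2, fun h => absurd hs h⟩, hsupp⟩
  · exact ⟨⟨G.R s hs, G.R_rational s hs, fun t ht => (G.R_support s hs t).1 ht, fun _ => rfl⟩,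
      fun t => (G.R_support s hs t).trans ⟨fun h => ⟨hR hs t h, h⟩, fun h => h.2⟩⟩

lemma Plan.law_nonneg (first : ℕ → ∀ s, G.Move s) (s : S) (n : ℕ) (t : S) :
    0 ≤ Plan.law first s n t := by
  induction n generalizing t with
  | zero =>
    simp only [Plan.law]
    split_ifs
    · exact zero_le_one
    · exact le_rfl
  | succ n ih => exact Finset.sum_nonneg fun r _ => mul_nonneg (ih r) ENNReal.toReal_nonneg

lemma Plan.law_succ_pos {first : ℕ → ∀ s, G.Move s} {s : S} {n : ℕ} {r t : S}
    (h : 0 < Plan.law first s n r) (ht : t ∈ (first n r).dist.support) :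
    0 < Plan.law first s (n + 1) t :=
  lt_of_lt_of_le (mul_pos h ((PMF.toReal_pos_iff _ _).2 ht))
    (Finset.single_le_sum (f := fun r => Plan.law first s n r * ((first n r).dist t).toReal)
      (fun a _ => mul_nonneg (Plan.law_nonneg first s n a) ENNReal.toReal_nonneg)
      (Finset.mem_univ r))

open Classical in
/-- Some finite-memory strategy surely has a positive mean payoff and ends in each of the maximal
winning end-components with positive probability. -/
lemma IsPruned.exists_explorer (hG : G.IsPruned) {s₀ : S}
    (hreach : ∀ U : Finset S, G.IsWEC U → ∃ s ∈ U, G.Reachable s₀ s) :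
    ∃ P : G.Plan, ∀ U, G.IsMWEC U → ∃ δ > 0, ∃ N, ∀ n ≥ N, δ ≤ ∑ c with c.state ∈ U,
      evolve P.strategy.matrix (P.strategy.initMass s₀) n c := by
  have hfull : ∀ s, ∃ m : G.Move s, ∀ t, G.E s t → t ∈ m.dist.support := fun s => by
    obtain ⟨t, ht⟩ := G.exists_succ s
    obtain ⟨m, hm⟩ := exists_full_move (U := Finset.univ) ⟨t, Finset.mem_univ t, ht⟩
      fun _ t _ => Finset.mem_univ t
    exact ⟨m, fun t ht => (hm t).2 ⟨Finset.mem_univ t, ht⟩⟩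
  choose m hm using hfull
  choose gamble hgamble using fun s => (hG.profitable_modeOf s).exists_succ (G.mem_modeOf s)
  set first : ℕ → ∀ s, G.Move s := fun _ => m
  have hpath : ∀ t, G.Reachable s₀ t → ∃ n, 0 < Plan.law first s₀ n t := by
    intro t ht
    induction ht with
    | refl => exact ⟨0, by simp [Plan.law]⟩
    | tail _ hE ih =>
      obtain ⟨n, hn⟩ := ih
      exact ⟨n + 1, Plan.law_succ_pos hn (hm _ _ hE)⟩
  -- Every state of a MWEC has a successor in it, and the moves `m` take all edges. So a MWEC that
  -- can be occupied at some time can be occupied at all later times, and one time `N` serves all of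
  -- them.
  have hstay : ∀ U, G.IsMWEC U → ∃ N, ∀ n ≥ N, ∃ t ∈ U, 0 < Plan.law first s₀ n t := by
    intro U hU
    obtain ⟨t, htU, ht⟩ := hreach U hU.1
    obtain ⟨N, hN⟩ := hpath t ht
    refine ⟨N, fun n hn => ?_⟩
    induction n, hn using Nat.le_induction with
    | base => exact ⟨t, htU, hN⟩
    | succ n _ ih =>
      obtain ⟨r, hrU, hr⟩ := ih
      obtain ⟨u, hu⟩ := (gamble r).dist.support_nonempty
      refine ⟨u, ?_, Plan.law_succ_pos hr (hm r u ((gamble r).support u hu))⟩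
      have := hgamble r u hu
      rwa [modeOf_eq hU hrU] at this
  choose! NU hNU using hstay
  set N := Finset.univ.sup NU
  refine ⟨hG.plan N 1 le_rfl first gamble hgamble, fun U hU => ?_⟩
  set P := hG.plan N 1 le_rfl first gamble hgamble
  obtain ⟨t, htU, ht⟩ := hNU U hU N (Finset.le_sup (Finset.mem_univ U))
  refine ⟨Plan.law first s₀ N t, ht, N, fun n hn => ?_⟩
  have hprob : IsProbabilityMeasure (P.strategy.pathMeasure s₀) :=
    inferInstanceAs (IsProbabilityMeasure
      (P.strategy.chainMeasure (P.strategy.init.map fun m => ⟨s₀, m⟩)))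
  have h1 : ∑ c with c.state ∈ U, evolve P.strategy.matrix (P.strategy.initMass s₀) n c
      = ∫ ρ, (fun c : P.strategy.Conf => if c.state ∈ U then (1 : ℝ) else 0) (ρ n)
          ∂(P.strategy.pathMeasure s₀) := by
    refine Eq.trans ?_ (P.strategy.integral_chainMeasure_law
      (P.strategy.init.map fun m => ⟨s₀, m⟩) n fun c => if c.state ∈ U then (1 : ℝ) else 0).symm
    rw [Finset.sum_filter]
    refine Finset.sum_congr rfl fun c _ => ?_
    rw [mul_ite, mul_one, mul_zero]
    rfl
  have h2 := P.integral_state s₀ (n := N) le_rfl fun s => if s ∈ U then (1 : ℝ) else 0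
  -- A play that is in `U` at time `N` takes `U` as its mode and never leaves it.
  have h3 : ∫ ρ, (fun s => if s ∈ U then (1 : ℝ) else 0) (ρ N).state ∂(P.strategy.pathMeasure s₀)
      ≤ ∫ ρ, (fun c : P.strategy.Conf => if c.state ∈ U then (1 : ℝ) else 0) (ρ n)
          ∂(P.strategy.pathMeasure s₀) := by
    refine integral_mono_ae (P.strategy.integrable_path (P.strategy.init.map fun m => ⟨s₀, m⟩) N
      fun c _ => if c.state ∈ U then (1 : ℝ) else 0) (P.strategy.integrable_path
      (P.strategy.init.map fun m => ⟨s₀, m⟩) n fun c _ => if c.state ∈ U then (1 : ℝ) else 0) ?_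
    filter_upwards [P.ae_path_spec s₀] with ρ hρ
    by_cases hN : (ρ N).state ∈ U
    · have h4 := hρ.2.1.mem_mode (n := n) hn
      have h5 : P.mode (ρ P.time).state = U := modeOf_eq hU hN
      rw [h5] at h4
      rw [if_pos hN, if_pos h4]
    · rw [if_neg hN]
      split_ifs
      · exact zero_le_one
      · exact le_rfl
  rw [h1]
  refine le_trans ?_ h3
  rw [h2]
  have h4 := Finset.single_le_sum
    (f := fun t => Plan.law P.first s₀ N t * if t ∈ U then (1 : ℝ) else 0)
    (fun a _ => mul_nonneg (Plan.law_nonneg P.first s₀ N a) (by split_ifs <;> norm_num))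
    (Finset.mem_univ t)
  rw [if_pos htU, mul_one] at h4
  exact h4

/-! ### From strategies to solutions -/

-- The constraints are affine equations and sign conditions, so they are preserved by convex
-- combinations. That the weights add up to `1` matters only for the two constants, the initial flow
-- and the total leak.
open Classical in
lemma WeakSolves.combine {s₀ : S} {y y' : S → ℝ} {ye ye' x x' : S → S → ℝ}
    (h : WeakSolves G s₀ y ye x) (h' : WeakSolves G s₀ y' ye' x') {a b : ℝ} (ha : 0 ≤ a)
    (hb : 0 ≤ b) (hab : a + b = 1) :
    WeakSolves G s₀ (fun s => a * y s + b * y' s) (fun s t => a * ye s t + b * ye' s t)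
      (fun s t => a * x s t + b * x' s t) where
  y_nonneg s := add_nonneg (mul_nonneg ha (h.y_nonneg s)) (mul_nonneg hb (h'.y_nonneg s))
  ye_nonneg s t hE :=
    add_nonneg (mul_nonneg ha (h.ye_nonneg s t hE)) (mul_nonneg hb (h'.ye_nonneg s t hE))
  x_nonneg s t hE :=
    add_nonneg (mul_nonneg ha (h.x_nonneg s t hE)) (mul_nonneg hb (h'.x_nonneg s t hE))
  y_flow s := by
    simp only [Finset.sum_add_distrib, ← Finset.mul_sum]
    linear_combination a * h.y_flow s + b * h'.y_flow s
      - (if s = s₀ then 1 else 0) * hab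
  y_random s hs t hE := by
    simp only [Finset.sum_add_distrib, ← Finset.mul_sum]
    linear_combination a * h.y_random s hs t hE + b * h'.y_random s hs t hE
  y_sum := by
    simp only [Finset.sum_add_distrib, ← Finset.mul_sum]
    linear_combination a * h.y_sum + b * h'.y_sum + hab
  x_y U hU := by
    simp only [Finset.sum_add_distrib, ← Finset.mul_sum]
    linear_combination a * h.x_y U hU + b * h'.x_y U hU
  x_supp s t hE hno := by
    rw [h.x_supp s t hE hno, h'.x_supp s t hE hno, mul_zero, mul_zero, add_zero]
  x_flow s := by
    simp only [Finset.sum_add_distrib, ← Finset.mul_sum]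
    linear_combination a * h.x_flow s + b * h'.x_flow s
  x_random s hs t hE := by
    simp only [Finset.sum_add_distrib, ← Finset.mul_sum]
    linear_combination a * h.x_random s hs t hE + b * h'.x_random s hs t hE

/-- The given strategy yields everything, except that (C3) may fail to be strict on a MWEC that it
enters with probability `0`. The solution of the explorer is strict on all of them, and a small
weight `ε` on it does not spoil the strict inequality (C2). -/
lemma IsPruned.exists_solvesT (hG : G.IsPruned) {s₀ : S} (hs₀ : s₀ ∈ G.ctrl)
    (hreach : ∀ U : Finset S, G.IsWEC U → ∃ s ∈ U, G.Reachable s₀ s) {ν : Fin d → ℝ}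
    {f : G.Strategy} (hf : f.IsFiniteMemory) (hWC : (0 : Fin d → ℝ) ∈ f.WCSol s₀)
    (hexp : ν ∈ f.ExpSol s₀) :
    ∃ (y : S → ℝ) (ye x : S → S → ℝ), G.SolvesT s₀ ν y ye x := by
  classical
  have := f.finite_conf hf
  have : Finite f.Mem := hf
  have := Fintype.ofFinite f.Conf
  have := Fintype.ofFinite f.Mem
  obtain ⟨y, ye, x, hw, hx, hloc, -⟩ := Strategy.exists_weakSolves hs₀ hWC
  obtain ⟨P, hP⟩ := hG.exists_explorer hreach
  obtain ⟨y', ye', x', hw', -, hloc', hy'⟩ :=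
    Strategy.exists_weakSolves (f := P.strategy) hs₀ (P.zero_mem_WCSol s₀)
  set A : Fin d → ℝ := fun i => ∑ s, ∑ t with G.E s t, x s t * G.w s t i with hA
  set B : Fin d → ℝ := fun i => ∑ s, ∑ t with G.E s t, x' s t * G.w s t i with hB
  have hνA : ∀ i, ν i < A i := fun i => (hexp i).trans_le (hx i)
  have hev : ∀ᶠ ε : ℝ in 𝓝[>] 0, (∀ i, ν i < (1 - ε) * A i + ε * B i) ∧ ε < 1 ∧ 0 < ε := by
    refine (eventually_all.2 fun i => ?_).and
      (((eventually_lt_nhds zero_lt_one).filter_mono nhdsWithin_le_nhds).and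
        self_mem_nhdsWithin)
    refine nhdsWithin_le_nhds (ContinuousAt.eventually_lt continuousAt_const ?_ ?_)
    · fun_prop
    · simpa using hνA i
  obtain ⟨ε, hε, hε1, hε0⟩ := hev.exists
  have hw2 := hw.combine hw' (a := 1 - ε) (b := ε) (by linarith) hε0.le (by ring)
  refine ⟨_, _, _,
    { y_nonneg := hw2.y_nonneg
      ye_nonneg := hw2.ye_nonneg
      x_nonneg := hw2.x_nonneg
      y_flow := hw2.y_flow
      y_random := hw2.y_random
      y_sum := hw2.y_sum
      x_y := hw2.x_y
      x_supp := hw2.x_supp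
      x_flow := hw2.x_flow
      x_random := hw2.x_random
      mp_global := fun i => ?_
      mp_local := fun U hU i => ?_ }⟩
  · simp only [add_mul, mul_assoc, Finset.sum_add_distrib, ← Finset.mul_sum]
    exact hε i
  · simp only [add_mul, mul_assoc, Finset.sum_add_distrib, ← Finset.mul_sum]
    obtain ⟨δ, hδ, N, hN⟩ := hP U hU
    exact add_pos_of_nonneg_of_pos (mul_nonneg (by linarith) (hloc U hU i).1)
      (mul_pos hε0 ((hloc' U hU i).2 (hδ.trans_le (hy' U hU δ N hN))))

end MDP

/-! ### Flows through leaking networks. -/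

namespace FiniteChain

variable {C : Type*} [Fintype C]

/-- The flow `I` through a leaking network with initial flow `α`: if the total leak `I c * ℓ c` is
the whole flow, then it is collected by the transient process `evolve Q α`. -/
lemma tendsto_leak {Q : C → C → ℝ} {ℓ I α : C → ℝ} (hQ : ∀ a b, 0 ≤ Q a b) (hℓ : ∀ c, 0 ≤ ℓ c)
    (hα : ∀ c, 0 ≤ α c) (hα1 : ∑ c, α c = 1) (hI0 : ∀ c, 0 ≤ I c)
    (hsum : ∀ a, I a ≠ 0 → ∑ b, Q a b + ℓ a = 1) (hI : ∀ b, I b = α b + ∑ a, I a * Q a b)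
    (hleak : ∑ c, I c * ℓ c = 1) :
    (∀ n c, 0 ≤ evolve Q α n c) ∧ (∀ n c, I c = 0 → evolve Q α n c = 0) ∧
      ∀ c, Tendsto (fun n => ∑ k ∈ Finset.range n, evolve Q α k c * ℓ c) atTop (𝓝 (I c * ℓ c)) := by
  have h0 : ∀ n c, 0 ≤ evolve Q α n c := by
    intro n
    induction n with
    | zero => exact hα
    | succ n ih => exact fun c => Finset.sum_nonneg fun a _ => mul_nonneg (ih a) (hQ a c)
  -- The expected numbers of visits are the least non-negative solution of the flow equation. `I`
  -- may exceed them by circulations that the initial flow never feeds.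
  have hP : ∀ n c, ∑ k ∈ Finset.range n, evolve Q α k c ≤ I c := by
    intro n
    induction n with
    | zero => simpa using hI0
    | succ n ih =>
      intro c
      rw [Finset.sum_range_succ', hI c, add_comm]
      refine add_le_add le_rfl ?_
      simp only [evolve]
      rw [Finset.sum_comm]
      refine Finset.sum_le_sum fun a _ => ?_
      rw [← Finset.sum_mul]
      exact mul_le_mul_of_nonneg_right (ih a) (hQ a c)
  have hle : ∀ n c, evolve Q α n c ≤ I c := fun n c => le_trans
    (Finset.single_le_sum (f := fun k => evolve Q α k c) (fun k _ => h0 k c)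
      (Finset.self_mem_range_succ n)) (hP (n + 1) c)
  have hzero : ∀ n c, I c = 0 → evolve Q α n c = 0 := fun n c hc =>
    le_antisymm (hc ▸ hle n c) (h0 n c)
  have hmass : ∀ n, ∑ c, evolve Q α n c + ∑ c, (∑ k ∈ Finset.range n, evolve Q α k c) * ℓ c = 1 := by
    intro n
    induction n with
    | zero => simpa [evolve] using hα1
    | succ n ih =>
      have e1 : ∑ c, evolve Q α (n + 1) c = ∑ a, evolve Q α n a * (1 - ℓ a) := by
        simp only [evolve]
        rw [Finset.sum_comm]
        refine Finset.sum_congr rfl fun a _ => ?_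
        rw [← Finset.mul_sum]
        by_cases ha : I a = 0
        · rw [hzero n a ha, zero_mul, zero_mul]
        · rw [← hsum a ha, add_sub_cancel_right]
      rw [e1]
      refine Eq.trans ?_ ih
      rw [← Finset.sum_add_distrib, ← Finset.sum_add_distrib]
      refine Finset.sum_congr rfl fun c _ => ?_
      rw [Finset.sum_range_succ]
      ring
  have hsummable : ∀ c, Summable fun n => evolve Q α n c := fun c =>
    summable_of_sum_range_le (fun n => h0 n c) fun n => hP n c
  set T : C → ℝ := fun c => ∑' n, evolve Q α n c
  have hT : ∀ c, Tendsto (fun n => ∑ k ∈ Finset.range n, evolve Q α k c) atTop (𝓝 (T c)) :=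
    fun c => (hsummable c).hasSum.tendsto_sum_nat
  have hTI : ∀ c, T c ≤ I c := fun c => le_of_tendsto' (hT c) fun n => hP n c
  -- Visits are summable, so the mass left in the network tends to `0` and everything leaks. Since
  -- `T ≤ I` and both leak `1` in total, they leak the same amount at every state.
  have hT1 : ∑ c, T c * ℓ c = 1 := by
    have h1 : Tendsto (fun n => ∑ c, evolve Q α n c
        + ∑ c, (∑ k ∈ Finset.range n, evolve Q α k c) * ℓ c) atTop
        (𝓝 (∑ _c : C, (0 : ℝ) + ∑ c, T c * ℓ c)) :=
      (tendsto_finsetSum _ fun c _ => (hsummable c).tendsto_atTop_zero).add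
        (tendsto_finsetSum _ fun c _ => (hT c).mul_const _)
    simp only [hmass, Finset.sum_const_zero, zero_add] at h1
    exact tendsto_nhds_unique h1 tendsto_const_nhds
  refine ⟨h0, hzero, fun c => ?_⟩
  have heq : T c * ℓ c = I c * ℓ c := by
    have h1 : ∑ c, (I c * ℓ c - T c * ℓ c) = 0 := by
      rw [Finset.sum_sub_distrib, hleak, hT1, sub_self]
    have h2 := (Finset.sum_eq_zero_iff_of_nonneg fun c _ => sub_nonneg.2
      (mul_le_mul_of_nonneg_right (hTI c) (hℓ c))).1 h1 c (Finset.mem_univ c)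
    linarith
  rw [← heq]
  simp only [← Finset.sum_mul]
  exact (hT c).mul_const _

end FiniteChain

namespace MDP

variable {S : Type*} [Fintype S] {d : ℕ} {G : MDP S d}

/-! ### Moves with real probabilities -/

/-- `q` is a distribution over the successors of `s`, which is the given one if `s` is a state of
Random. -/
structure RealMove (G : MDP S d) (s : S) (q : S → ℝ) : Prop where
  nonneg : ∀ t, 0 ≤ q t
  sum_eq_one : ∑ t, q t = 1
  edge : ∀ t, q t ≠ 0 → G.E s t
  random : ∀ (hs : s ∉ G.ctrl) t, q t = (G.R s hs t).toReal

lemma Move.realMove {s : S} (m : G.Move s) : G.RealMove s fun t => (m.dist t).toReal where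
  nonneg _ := ENNReal.toReal_nonneg
  sum_eq_one := m.dist.sum_toReal
  edge t ht := m.support t ((PMF.toReal_pos_iff _ _).1
    (lt_of_le_of_ne ENNReal.toReal_nonneg (Ne.symm ht)))
  random hs t := by rw [m.random hs]

/-- A move with real probabilities is a limit of moves with rational probabilities. -/
lemma RealMove.exists_seq {s : S} {q : S → ℝ} (hq : G.RealMove s q) :
    ∃ m : ℕ → G.Move s, (∀ k, ∀ t ∈ (m k).dist.support, q t ≠ 0) ∧
      ∀ t, Tendsto (fun k => ((m k).dist t).toReal) atTop (𝓝 (q t)) := by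
  -- A `ℚ`-linear map that fixes `1` preserves the sum of the probabilities, their zeros and all
  -- rational values, in particular the distributions of Random. Non-negativity holds from some
  -- index `K` on.
  obtain ⟨φ, h1, hφ⟩ := exists_linear_rational_approx
  have hev : ∀ᶠ k in atTop, ∀ t, 0 ≤ φ k (q t) := by
    refine eventually_all.2 fun t => ?_
    rcases (hq.nonneg t).eq_or_lt with h | h
    · refine Eventually.of_forall fun k => ?_
      rw [← h, map_zero]
    · filter_upwards [(hφ (q t)).eventually (lt_mem_nhds h)] with k hk
      exact_mod_cast hk.le
  obtain ⟨K, hK⟩ := eventually_atTop.1 hev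
  have hnn : ∀ k t, 0 ≤ ((φ (k + K) (q t) : ℚ) : ℝ) := fun k t => by
    exact_mod_cast hK (k + K) (Nat.le_add_left _ _) t
  have hsum : ∀ k, ∑ t, ENNReal.ofReal ((φ (k + K) (q t) : ℚ) : ℝ) = 1 := by
    intro k
    rw [← ENNReal.ofReal_sum_of_nonneg fun t _ => hnn k t, ← Rat.cast_sum, ← map_sum,
      hq.sum_eq_one, h1, Rat.cast_one, ENNReal.ofReal_one]
  have hval : ∀ k t, ((PMF.ofFintype _ (hsum k)) t).toReal = ((φ (k + K) (q t) : ℚ) : ℝ) :=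
    fun k t => by rw [PMF.ofFintype_apply, ENNReal.toReal_ofReal (hnn k t)]
  have hsupp : ∀ k, ∀ t ∈ (PMF.ofFintype _ (hsum k)).support, q t ≠ 0 := by
    intro k t ht h
    have := (PMF.toReal_pos_iff _ _).2 ht
    rw [hval, h, map_zero, Rat.cast_zero] at this
    exact lt_irrefl _ this
  refine ⟨fun k => ⟨PMF.ofFintype _ (hsum k), fun t => ⟨_, hval k t⟩,
    fun t ht => hq.edge t (hsupp k t ht), fun hs => ?_⟩, hsupp, fun t => ?_⟩
  · ext t
    rw [PMF.ofFintype_apply]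
    obtain ⟨r, hr⟩ := G.R_rational s hs t
    have h2 : φ (k + K) (q t) = r := by
      rw [hq.random hs t, hr]
      have h3 : (r : ℝ) = r • (1 : ℝ) := by rw [Rat.smul_def, mul_one]
      rw [h3, map_smul, h1, smul_eq_mul, mul_one]
    rw [h2, ← hr, ENNReal.ofReal_toReal ((G.R s hs).apply_ne_top t)]
  · simp only [hval]
    exact (hφ (q t)).comp (tendsto_add_atTop_nat K)

-- At a fixed time the law is a polynomial in finitely many move probabilities, hence continuous in
-- them.
open Classical in
lemma Plan.tendsto_law {m : ℕ → ∀ s, ℕ → G.Move s} {M : ℕ → S → ℝ} {σ : ℕ → S → S → ℝ} {s₀ : S}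
    (hm : ∀ n s t, Tendsto (fun k => ((m n s k).dist t).toReal) atTop (𝓝 (σ n s t)))
    (h0 : ∀ t, M 0 t = if t = s₀ then 1 else 0)
    (hM : ∀ n t, M (n + 1) t = ∑ r, M n r * σ n r t) (n : ℕ) (t : S) :
    Tendsto (fun k => Plan.law (fun n s => m n s k) s₀ n t) atTop (𝓝 (M n t)) := by
  induction n generalizing t with
  | zero =>
    rw [h0]
    simp only [Plan.law]
    exact tendsto_const_nhds
  | succ n ih =>
    rw [hM]
    exact tendsto_finsetSum _ fun r _ => (ih r).mul (hm n r t)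

/-- The settled mass: it enters from the transient mass `p` with the rates `ℓ`, and then moves
according to `Z`. -/
def settled (p : ℕ → S → ℝ) (ℓ : S → ℝ) (Z : S → S → ℝ) : ℕ → S → ℝ
  | 0 => 0
  | n + 1 => fun t => ∑ s, (settled p ℓ Z n s + p n s * ℓ s) * Z s t

lemma settled_nonneg {p : ℕ → S → ℝ} {ℓ : S → ℝ} {Z : S → S → ℝ} (hp : ∀ n s, 0 ≤ p n s)
    (hℓ : ∀ s, 0 ≤ ℓ s) (hZ : ∀ s t, 0 ≤ Z s t) (n : ℕ) (s : S) : 0 ≤ settled p ℓ Z n s := by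
  induction n generalizing s with
  | zero => exact le_rfl
  | succ n ih =>
    exact Finset.sum_nonneg fun r _ =>
      mul_nonneg (add_nonneg (ih r) (mul_nonneg (hp n r) (hℓ r))) (hZ r s)

/-- Mass that leaks in `U` is settled from the next step on and remains in `U`, because the rows of
`Z` at states of `U` have all their weight in `U`. Mass settled elsewhere can only add to it. -/
lemma le_sum_settled {p : ℕ → S → ℝ} {ℓ : S → ℝ} {Z : S → S → ℝ} (hp : ∀ n s, 0 ≤ p n s)
    (hℓ : ∀ s, 0 ≤ ℓ s) (hZ : ∀ s t, 0 ≤ Z s t) {U : Finset S}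
    (hU : ∀ s ∈ U, ∑ t ∈ U, Z s t = 1) (n : ℕ) :
    ∑ s ∈ U, ∑ k ∈ Finset.range n, p k s * ℓ s ≤ ∑ s ∈ U, settled p ℓ Z n s := by
  induction n with
  | zero => simp [settled]
  | succ n ih =>
    have h0 : ∀ s, 0 ≤ settled p ℓ Z n s + p n s * ℓ s := fun s =>
      add_nonneg (settled_nonneg hp hℓ hZ n s) (mul_nonneg (hp n s) (hℓ s))
    calc _ = ∑ s ∈ U, ∑ k ∈ Finset.range n, p k s * ℓ s + ∑ s ∈ U, p n s * ℓ s := by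
          simp only [Finset.sum_range_succ, Finset.sum_add_distrib]
      _ ≤ ∑ s ∈ U, settled p ℓ Z n s + ∑ s ∈ U, p n s * ℓ s := add_le_add ih le_rfl
      _ = ∑ s ∈ U, (settled p ℓ Z n s + p n s * ℓ s) * ∑ t ∈ U, Z s t := by
          rw [← Finset.sum_add_distrib]
          exact Finset.sum_congr rfl fun s hs => by rw [hU s hs, mul_one]
      _ ≤ ∑ s, (settled p ℓ Z n s + p n s * ℓ s) * ∑ t ∈ U, Z s t :=
          Finset.sum_le_sum_of_subset_of_nonneg (Finset.subset_univ U) fun s _ _ =>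
            mul_nonneg (h0 s) (Finset.sum_nonneg fun t _ => hZ s t)
      _ = _ := by
          simp only [settled, Finset.mul_sum]
          rw [Finset.sum_comm]

open Classical in
/-- Initial moves that settle in each set `U` with a probability close to the leak in `U`. -/
lemma exists_first {s₀ : S} (hs₀ : s₀ ∈ G.ctrl) {y : S → ℝ} {ye : S → S → ℝ}
    (hy : ∀ s, 0 ≤ y s) (hye : ∀ s t, G.E s t → 0 ≤ ye s t)
    (hflow : ∀ s, (if s = s₀ then 1 else 0) + ∑ r with G.E r s, ye r s
      = ∑ t with G.E s t, ye s t + y s)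
    (hrand : ∀ s (hs : s ∉ G.ctrl) t, G.E s t →
      ye s t = (G.R s hs t).toReal * (∑ r with G.E r s, ye r s - y s))
    {Z : S → S → ℝ} (hZ : ∀ s, G.RealMove s (Z s)) {η : ℝ} (hη : 0 < η) :
    ∃ (N : ℕ) (first : ℕ → ∀ s, G.Move s), ∀ U : Finset S,
      (∀ s ∈ U, ∀ t, Z s t ≠ 0 → t ∈ U) →
        ∑ s ∈ U, y s - η < ∑ t ∈ U, Plan.law first s₀ N t := by
  set e : S → S → ℝ := fun s t => if G.E s t then ye s t else 0 with he
  have he0 : ∀ s t, 0 ≤ e s t := fun s t => by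
    simp only [he]
    split_ifs with h
    · exact hye s t h
    · exact le_rfl
  set α : S → ℝ := fun s => if s = s₀ then 1 else 0 with hα
  have hα0 : ∀ s, 0 ≤ α s := fun s => by
    simp only [hα]
    split_ifs
    · exact zero_le_one
    · exact le_rfl
  -- The total flow through a state, including the initial flow. Where it is positive, `Q` and `ℓ`
  -- below are the conditional probabilities of moving on and of leaking.
  set I : S → ℝ := fun s => α s + ∑ r, e r s with hI
  have hI0 : ∀ s, 0 ≤ I s := fun s => add_nonneg (hα0 s) (Finset.sum_nonneg fun r _ => he0 r s)
  have hin : ∀ s, ∑ r with G.E r s, ye r s = ∑ r, e r s := fun s => by rw [Finset.sum_filter]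
  have hout : ∀ s, I s = ∑ t, e s t + y s := fun s => by
    simp only [hI, ← hin, hα]
    rw [hflow, Finset.sum_filter]
  have hez : ∀ s, I s = 0 → ∀ t, e s t = 0 := fun s hs t => by
    have h1 := Finset.single_le_sum (f := fun t => e s t) (fun t _ => he0 s t) (Finset.mem_univ t)
    have h2 := hout s
    have := hy s
    have := he0 s t
    linarith
  have hyz : ∀ s, I s = 0 → y s = 0 := fun s hs => by
    have h1 := Finset.sum_nonneg fun t (_ : t ∈ Finset.univ) => he0 s t
    have h2 := hout s
    have := hy s
    linarith
  set Q : S → S → ℝ := fun s t => e s t / I s with hQ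
  set ℓ : S → ℝ := fun s => y s / I s with hℓ
  have hIQ : ∀ s t, I s * Q s t = e s t := fun s t => by
    by_cases h : I s = 0
    · rw [h, zero_mul, hez s h t]
    · exact mul_div_cancel₀ _ h
  have hIℓ : ∀ s, I s * ℓ s = y s := fun s => by
    by_cases h : I s = 0
    · rw [h, zero_mul, hyz s h]
    · exact mul_div_cancel₀ _ h
  have hQ0 : ∀ s t, 0 ≤ Q s t := fun s t => div_nonneg (he0 s t) (hI0 s)
  have hℓ0 : ∀ s, 0 ≤ ℓ s := fun s => div_nonneg (hy s) (hI0 s)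
  have hα1 : ∑ s, α s = 1 := by simp [hα]
  have hsum : ∀ s, I s ≠ 0 → ∑ t, Q s t + ℓ s = 1 := fun s hs => by
    simp only [hQ, hℓ]
    rw [← Finset.sum_div, ← add_div, ← hout, div_self hs]
  -- Sum the flow conservation over all states.
  have hy1 : ∑ s, y s = 1 := by
    have h1 : ∑ s, I s = ∑ s, (∑ t, e s t + y s) := Finset.sum_congr rfl fun s _ => hout s
    simp only [hI, Finset.sum_add_distrib, hα1] at h1
    rw [Finset.sum_comm] at h1
    linarith
  obtain ⟨hp0, hpz, hlim⟩ := tendsto_leak hQ0 hℓ0 hα0 hα1 hI0 hsum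
    (fun t => by simp only [hIQ]; rfl) (by simp only [hIℓ]; exact hy1)
  set p : ℕ → S → ℝ := fun n => evolve Q α n with hp
  set q : ℕ → S → ℝ := settled p ℓ Z with hq
  have hZ0 : ∀ s t, 0 ≤ Z s t := fun s => (hZ s).nonneg
  have hq0 : ∀ n s, 0 ≤ q n s := settled_nonneg hp0 hℓ0 hZ0
  -- The first moves know the time and the state, but not whether the play has settled. Averaging
  -- the two behaviours with the weights `p` and `q` reproduces the total mass `p + q` at all times.
  -- A state without mass gets the default `Z`.
  set σ : ℕ → S → S → ℝ := fun n s t => if p n s + q n s = 0 then Z s t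
    else (p n s * Q s t + (q n s + p n s * ℓ s) * Z s t) / (p n s + q n s) with hσ
  have hpsum : ∀ n s, p n s * (∑ t, Q s t) = p n s * (1 - ℓ s) := fun n s => by
    by_cases h : I s = 0
    · simp only [hp]
      rw [hpz n s h, zero_mul, zero_mul]
    · rw [← hsum s h, add_sub_cancel_right]
  have hmove : ∀ n s, G.RealMove s (σ n s) := by
    intro n s
    by_cases h : p n s + q n s = 0
    · simp only [hσ, if_pos h]
      exact hZ s
    · have hnn : 0 ≤ p n s + q n s := add_nonneg (hp0 n s) (hq0 n s)
      simp only [hσ, if_neg h]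
      refine ⟨fun t => div_nonneg (add_nonneg (mul_nonneg (hp0 n s) (hQ0 s t)) (mul_nonneg
        (add_nonneg (hq0 n s) (mul_nonneg (hp0 n s) (hℓ0 s))) (hZ0 s t))) hnn, ?_, fun t ht => ?_,
        fun hs t => ?_⟩
      · rw [← Finset.sum_div, Finset.sum_add_distrib, ← Finset.mul_sum, ← Finset.mul_sum,
          (hZ s).sum_eq_one, hpsum, div_eq_one_iff_eq h]
        ring
      · by_contra hE
        refine ht ?_
        have h1 : Q s t = 0 := by simp only [hQ, he, if_neg hE, zero_div]
        have h2 : Z s t = 0 := by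
          by_contra h3
          exact hE ((hZ s).edge t h3)
        rw [h1, h2, mul_zero, mul_zero, add_zero, zero_div]
      · rw [div_eq_iff h, (hZ s).random hs t]
        -- By (A1') the flow that does not leak is distributed as Random prescribes; here the inflow
        -- is all of `I s`, because `s ≠ s₀`.
        have h1 : p n s * Q s t = (G.R s hs t).toReal * (p n s * (1 - ℓ s)) := by
          by_cases hI' : I s = 0
          · simp only [hp]
            rw [hpz n s hI', zero_mul, zero_mul, mul_zero]
          · have h2 : e s t = (G.R s hs t).toReal * (I s - y s) := by
              by_cases hE : G.E s t
              · simp only [he, if_pos hE]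
                rw [hrand s hs t hE, hin]
                simp only [hI, hα, if_neg (fun h : s = s₀ => hs (h ▸ hs₀)), zero_add]
              · have h3 : (G.R s hs t).toReal = 0 := by
                  by_contra hne
                  exact hE ((G.R_support s hs t).1 ((PMF.toReal_pos_iff _ _).1
                    (lt_of_le_of_ne ENNReal.toReal_nonneg (Ne.symm hne))))
                simp only [he, if_neg hE]
                rw [h3, zero_mul]
            simp only [hQ, hℓ, h2]
            field_simp
        rw [h1]
        ring
  choose m _ hmlim using fun n s => (hmove n s).exists_seq
  have hstep : ∀ n t, p (n + 1) t + q (n + 1) t = ∑ r, (p n r + q n r) * σ n r t := by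
    intro n t
    have h1 : ∀ r, (p n r + q n r) * σ n r t
        = p n r * Q r t + (q n r + p n r * ℓ r) * Z r t := by
      intro r
      by_cases h : p n r + q n r = 0
      · have h2 : p n r = 0 := le_antisymm (by linarith [hq0 n r]) (hp0 n r)
        have h3 : q n r = 0 := by linarith
        rw [h2, h3]
        ring
      · simp only [hσ, if_neg h]
        exact mul_div_cancel₀ _ h
    simp only [h1, Finset.sum_add_distrib]
    rfl
  have hlaw := fun n t => Plan.tendsto_law (M := fun n t => p n t + q n t) hmlim
    (s₀ := s₀) (fun t => by
      change α t + 0 = _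
      rw [add_zero]) hstep n t
  -- Half of `η` is lost by stopping at a finite time, the other half by the rational approximation.
  -- Both choices are uniform in the finitely many sets `U`.
  have hN : ∀ᶠ n in atTop, ∀ U : Finset S, ∑ s ∈ U, y s - η / 2
      < ∑ s ∈ U, ∑ k ∈ Finset.range n, p k s * ℓ s := by
    refine eventually_all.2 fun U => ?_
    have h1 : Tendsto (fun n => ∑ s ∈ U, ∑ k ∈ Finset.range n, p k s * ℓ s) atTop
        (𝓝 (∑ s ∈ U, y s)) := tendsto_finsetSum _ fun s _ => hIℓ s ▸ hlim s
    exact h1.eventually (lt_mem_nhds (by linarith))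
  obtain ⟨N, hN⟩ := hN.exists
  have hk : ∀ᶠ k in atTop, ∀ U : Finset S, ∑ t ∈ U, (p N t + q N t) - η / 2
      < ∑ t ∈ U, Plan.law (fun n s => m n s k) s₀ N t := by
    refine eventually_all.2 fun U => ?_
    exact (tendsto_finsetSum U fun t _ => hlaw N t).eventually (lt_mem_nhds (by linarith))
  obtain ⟨k, hk⟩ := hk.exists
  refine ⟨N, fun n s => m n s k, fun U hU => ?_⟩
  have h1 : ∑ s ∈ U, ∑ k ∈ Finset.range N, p k s * ℓ s ≤ ∑ s ∈ U, q N s := by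
    refine le_sum_settled hp0 hℓ0 hZ0 (fun s hs => ?_) N
    rw [← (hZ s).sum_eq_one]
    exact Finset.sum_subset (Finset.subset_univ U) fun t _ ht => by
      by_contra h
      exact ht (hU s hs t h)
  have h2 : ∑ s ∈ U, q N s ≤ ∑ t ∈ U, (p N t + q N t) :=
    Finset.sum_le_sum fun s _ => le_add_of_nonneg_left (hp0 N s)
  linarith [hN U, hk U]

end MDP

namespace MDP

variable {S : Type*} [Fintype S] {d : ℕ} {G : MDP S d}

/-! ### Circulations -/

/-- `x` is a circulation in the subgraph induced by `U`, with the given probabilities at the states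
of Random. -/
structure Circulation (G : MDP S d) (U : Finset S) (x : S → S → ℝ) : Prop where
  nonneg : ∀ s t, 0 ≤ x s t
  mem : ∀ s t, x s t ≠ 0 → s ∈ U ∧ t ∈ U ∧ G.E s t
  flow : ∀ s, ∑ r, x r s = ∑ t, x s t
  random : ∀ s (hs : s ∉ G.ctrl) t, x s t = (G.R s hs t).toReal * ∑ u, x s u

lemma Circulation.combine {U : Finset S} {x x' : S → S → ℝ} (h : G.Circulation U x)
    (h' : G.Circulation U x') {a b : ℝ} (ha : 0 ≤ a) (hb : 0 ≤ b) :
    G.Circulation U fun s t => a * x s t + b * x' s t where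
  nonneg s t := add_nonneg (mul_nonneg ha (h.nonneg s t)) (mul_nonneg hb (h'.nonneg s t))
  mem s t hne := by
    by_cases h0 : x s t = 0
    · refine h'.mem s t fun h0' => hne ?_
      rw [h0, h0', mul_zero, mul_zero, add_zero]
    · exact h.mem s t h0
  flow s := by
    simp only [Finset.sum_add_distrib, ← Finset.mul_sum, h.flow, h'.flow]
  random s hs t := by
    simp only [Finset.sum_add_distrib, ← Finset.mul_sum]
    linear_combination a * h.random s hs t + b * h'.random s hs t

lemma IsWEC.exists_succ {U : Finset S} (hU : G.IsWEC U) {s : S} (hs : s ∈ U) :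
    ∃ t ∈ U, G.E s t := by
  obtain ⟨m, hm⟩ := hU.profitable.exists_succ hs
  obtain ⟨t, ht⟩ := m.dist.support_nonempty
  exact ⟨t, hm t ht, m.support t ht⟩

section restrict

variable {U : Finset S} {Z : S → S → ℝ} (hZ : ∀ s ∈ U, G.RealMove s (Z s))
  (hZU : ∀ s ∈ U, ∀ t, Z s t ≠ 0 → t ∈ U)

include hZ hZU in
lemma isStochastic_restrict : IsStochastic fun a b : U => Z a b where
  nonneg a b := (hZ a a.2).nonneg b
  sum_eq_one a := by
    rw [Finset.sum_coe_sort U fun t => Z a t, ← (hZ a a.2).sum_eq_one]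
    exact Finset.sum_subset (Finset.subset_univ U) fun t _ ht => by
      by_contra h
      exact ht (hZU a a.2 t h)

lemma conn_restrict (hU : G.IsEC U) (hpos : ∀ s ∈ U, ∀ t ∈ U, G.E s t → 0 < Z s t) (a b : U) :
    Conn (fun a b : U => Z a b) a b := by
  have key : ∀ t, Relation.ReflTransGen (fun a b => a ∈ U ∧ b ∈ U ∧ G.E a b) a t →
      ∀ ht : t ∈ U, Conn (fun a b : U => Z a b) a ⟨t, ht⟩ := by
    intro t h
    induction h with
    | refl => exact fun _ => Relation.ReflTransGen.refl
    | tail _ hbc ih =>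
      exact fun ht => (ih hbc.1).tail (hpos _ hbc.1 _ ht hbc.2.2)
  exact key b (hU.2.1 a a.2 b b.2) b.2

end restrict

lemma sum_eq_sum_coe {U : Finset S} (φ : S → ℝ) (h : ∀ s, s ∉ U → φ s = 0) :
    ∑ s, φ s = ∑ a : U, φ a := by
  rw [Finset.sum_coe_sort U φ]
  exact (Finset.sum_subset (Finset.subset_univ U) fun s _ hs => h s hs).symm

/-- A winning end-component has a circulation that is positive on all edges. -/
lemma IsWEC.exists_circulation {U : Finset S} (hU : G.IsWEC U) :
    ∃ ζ : S → S → ℝ, G.Circulation U ζ ∧ (∀ s ∈ U, ∀ t ∈ U, G.E s t → 0 < ζ s t) ∧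
      ∑ s, ∑ t, ζ s t = 1 := by
  classical
  -- The chain that takes all edges inside of `U` is irreducible, so its stationary distribution is
  -- positive everywhere; the flow of the latter along the edges is the circulation.
  choose! m hm using fun s (hs : s ∈ U) =>
    exists_full_move (hU.exists_succ hs) (hU.1.2.2 s hs)
  set Z : S → S → ℝ := fun s t => ((m s).dist t).toReal with hZdef
  have hpos : ∀ s ∈ U, ∀ t ∈ U, G.E s t → 0 < Z s t := fun s hs t ht hE =>
    (PMF.toReal_pos_iff _ _).2 ((hm s hs t).2 ⟨ht, hE⟩)
  have hsupp : ∀ s ∈ U, ∀ t, Z s t ≠ 0 → t ∈ U := fun s hs t hne => ((hm s hs t).1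
    ((PMF.toReal_pos_iff _ _).1 (lt_of_le_of_ne ENNReal.toReal_nonneg (Ne.symm hne)))).1
  have hp := isStochastic_restrict (Z := Z) (fun s _ => (m s).realMove) hsupp
  obtain ⟨s₁, hs₁⟩ := hU.1.1
  set α : U → ℝ := fun a => if a = ⟨s₁, hs₁⟩ then 1 else 0 with hα
  have hα0 : ∀ a, 0 ≤ α a := fun a => by
    simp only [hα]
    split_ifs <;> norm_num
  have hα1 : ∑ a, α a = 1 := by simp [hα]
  obtain ⟨ξ, φ, -, hξ0, hξ1, hξst, -⟩ := exists_cesaro_limit hp hα0 hα1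
  have hξpos : ∀ a, 0 < ξ a := by
    obtain ⟨b, -, hb⟩ := Finset.exists_ne_zero_of_sum_ne_zero (by rw [hξ1]; exact one_ne_zero)
    exact fun a => conn_pos hp hξ0 hξst (conn_restrict hU.1 hpos b a)
      (lt_of_le_of_ne (hξ0 b) (Ne.symm hb))
  set ξ' : S → ℝ := fun s => if h : s ∈ U then ξ ⟨s, h⟩ else 0 with hξ'
  have hin : ∀ a : U, ξ' a = ξ a := fun a => dif_pos a.2
  have hout : ∀ s, s ∉ U → ξ' s = 0 := fun s hs => dif_neg hs
  have hξ'0 : ∀ s, 0 ≤ ξ' s := fun s => by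
    by_cases hs : s ∈ U
    · rw [hin ⟨s, hs⟩]; exact hξ0 _
    · rw [hout s hs]
  have hrow : ∀ s, ∑ t, ξ' s * Z s t = ξ' s := fun s => by
    rw [← Finset.mul_sum, (m s).realMove.sum_eq_one, mul_one]
  refine ⟨fun s t => ξ' s * Z s t, ⟨fun s t => mul_nonneg (hξ'0 s) ENNReal.toReal_nonneg,
    fun s t hne => ?_, fun s => ?_, fun s hs t => ?_⟩, fun s hs t ht hE => ?_, ?_⟩
  · have hs : s ∈ U := by
      by_contra hs
      exact hne (by rw [hout s hs, zero_mul])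
    have hne2 := right_ne_zero_of_mul hne
    exact ⟨hs, hsupp s hs t hne2, (m s).realMove.edge t hne2⟩
  · rw [hrow, sum_eq_sum_coe (U := U) _ fun r hr => by rw [hout r hr, zero_mul]]
    by_cases hs : s ∈ U
    · simp only [hin]
      rw [hin ⟨s, hs⟩]
      exact hξst ⟨s, hs⟩
    · rw [hout s hs]
      refine Finset.sum_eq_zero fun a _ => ?_
      by_contra hne
      exact hs (hsupp a a.2 s (right_ne_zero_of_mul hne))
  · rw [hrow, mul_comm]
    exact congrArg (· * ξ' s) ((m s).realMove.random hs t)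
  · exact mul_pos (by rw [hin ⟨s, hs⟩]; exact hξpos _) (hpos s hs t ht hE)
  · simp only [hrow]
    rw [sum_eq_sum_coe ξ' hout]
    simp only [hin]
    exact hξ1

/-- The moves with the frequencies of a positive circulation have a potential for each component of
the payoff. -/
lemma Circulation.exists_potential {U : Finset S} (hU : G.IsWEC U) {x : S → S → ℝ}
    (hx : G.Circulation U x) (hpos : ∀ s ∈ U, ∀ t ∈ U, G.E s t → 0 < x s t) :
    ∃ Z : S → S → ℝ, (∀ s ∈ U, G.RealMove s (Z s)) ∧ (∀ s ∈ U, ∀ t, Z s t ≠ 0 → t ∈ U) ∧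
      ∀ i, ∃ g : S → ℝ, ∀ s ∈ U, (∑ s, ∑ t, x s t * G.w s t i) / (∑ s, ∑ t, x s t) + g s
        = ∑ t, Z s t * (G.w s t i + g t) := by
  set h : S → ℝ := fun s => ∑ t, x s t with hh
  have hhpos : ∀ s ∈ U, 0 < h s := fun s hs => by
    obtain ⟨t, ht, hE⟩ := hU.exists_succ hs
    exact lt_of_lt_of_le (hpos s hs t ht hE)
      (Finset.single_le_sum (fun t _ => hx.nonneg s t) (Finset.mem_univ t))
  have hxout : ∀ s, s ∉ U → ∀ t, x s t = 0 := fun s hs t => by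
    by_contra hne
    exact hs (hx.mem s t hne).1
  set Z : S → S → ℝ := fun s t => x s t / h s with hZdef
  have hhZ : ∀ s ∈ U, ∀ t, h s * Z s t = x s t := fun s hs t =>
    mul_div_cancel₀ _ (hhpos s hs).ne'
  have hZ : ∀ s ∈ U, G.RealMove s (Z s) := fun s hs =>
    { nonneg := fun t => div_nonneg (hx.nonneg s t) (hhpos s hs).le
      sum_eq_one := by
        simp only [hZdef]
        rw [← Finset.sum_div, div_self (hhpos s hs).ne']
      edge := fun t hne => (hx.mem s t fun h0 => hne (by simp only [hZdef, h0, zero_div])).2.2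
      random := fun hs' t => by
        simp only [hZdef]
        rw [div_eq_iff (hhpos s hs).ne']
        exact hx.random s hs' t }
  have hZU : ∀ s ∈ U, ∀ t, Z s t ≠ 0 → t ∈ U := fun s _ t hne =>
    (hx.mem s t fun h0 => hne (by simp only [hZdef, h0, zero_div])).2.1
  have hZpos : ∀ s ∈ U, ∀ t ∈ U, G.E s t → 0 < Z s t := fun s hs t ht hE =>
    div_pos (hpos s hs t ht hE) (hhpos s hs)
  refine ⟨Z, hZ, hZU, fun i => ?_⟩
  obtain ⟨s₁, hs₁⟩ := hU.1.1
  have : Nonempty U := ⟨⟨s₁, hs₁⟩⟩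
  set X := ∑ s, ∑ t, x s t with hX
  set V := ∑ s, ∑ t, x s t * (G.w s t i : ℝ) with hV
  have hXh : X = ∑ a : U, h a :=
    sum_eq_sum_coe (U := U) h fun s hs => Finset.sum_eq_zero fun t _ => hxout s hs t
  have hXpos : 0 < X := by
    rw [hXh]
    exact Finset.sum_pos (fun a _ => hhpos a a.2) Finset.univ_nonempty
  -- Flow conservation makes the row sums `h` stationary for the normalised rows `Z`, and positivity
  -- of `x` on all edges makes the chain irreducible. The mean payoff per step is `V / X`.
  obtain ⟨g, hg⟩ := exists_poisson (isStochastic_restrict hZ hZU) (conn_restrict hU.1 hZpos)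
    (ξ := fun a : U => h a) (fun a => hhpos a a.2) (fun b => by
      have h1 : ∀ a : U, h a * Z a b = x a b := fun a => hhZ a a.2 b
      simp only [h1]
      rw [← sum_eq_sum_coe (U := U) (fun s => x s b) fun s hs => hxout s hs b]
      exact hx.flow b) (fun a => ∑ t, Z a t * (G.w a t i : ℝ)) (V / X) (by
      have h1 : ∀ a : U, h a * (∑ t, Z a t * (G.w a t i : ℝ) - V / X)
          = ∑ t, x a t * (G.w a t i : ℝ) - h a * (V / X) := fun a => by
        rw [mul_sub, Finset.mul_sum]
        congr 1
        refine Finset.sum_congr rfl fun t _ => ?_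
        rw [← mul_assoc, hhZ a a.2]
      simp only [h1]
      rw [Finset.sum_sub_distrib, ← Finset.sum_mul, ← hXh, mul_div_cancel₀ _ hXpos.ne', hV,
        sub_eq_zero]
      exact (sum_eq_sum_coe (U := U) (fun s => ∑ t, x s t * (G.w s t i : ℝ)) fun s hs =>
        Finset.sum_eq_zero fun t _ => by rw [hxout s hs t, zero_mul]).symm)
  classical
  -- The values outside of `U` do not matter, since `Z` stays in `U`.
  set g' : S → ℝ := fun s => if h : s ∈ U then g ⟨s, h⟩ else 0 with hg'
  refine ⟨g', fun s hs => ?_⟩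
  have h1 : ∑ t, Z s t * g' t = ∑ b : U, Z s b * g b := by
    rw [sum_eq_sum_coe (U := U) _ fun t ht => by simp only [hg', dif_neg ht, mul_zero]]
    exact Finset.sum_congr rfl fun b _ => by simp only [hg', dif_pos b.2]
  have h2 := hg ⟨s, hs⟩
  simp only [mul_add, Finset.sum_add_distrib]
  rw [h1, ← h2]
  simp only [hg', dif_pos hs]

/-! ### From solutions to strategies -/

namespace SolvesT

variable {s₀ : S} {ν : Fin d → ℝ} {y : S → ℝ} {ye x : S → S → ℝ} (hT : G.SolvesT s₀ ν y ye x)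

open Classical in
/-- The part of the frequencies inside of `U`. -/
noncomputable def part (G : MDP S d) (x : S → S → ℝ) (U : Finset S) (s t : S) : ℝ :=
  if s ∈ U ∧ t ∈ U ∧ G.E s t then x s t else 0

open Classical in
lemma sum_part (x v : S → S → ℝ) (U : Finset S) :
    ∑ s, ∑ t, part G x U s t * v s t = ∑ s ∈ U, ∑ t ∈ U with G.E s t, x s t * v s t := by
  rw [← Finset.sum_subset (Finset.subset_univ U)]
  · refine Finset.sum_congr rfl fun s hs => ?_
    rw [← Finset.sum_subset (Finset.subset_univ (U.filter fun t => G.E s t))]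
    · refine Finset.sum_congr rfl fun t ht => ?_
      rw [part, if_pos ⟨hs, Finset.mem_filter.1 ht⟩]
    · intro t _ ht
      rw [part, if_neg fun h => ht (Finset.mem_filter.2 h.2), zero_mul]
  · intro s _ hs
    refine Finset.sum_eq_zero fun t _ => ?_
    rw [part, if_neg fun h => hs h.1, zero_mul]

include hT

/-- By (B') an edge that carries frequency lies inside of some MWEC, and distinct MWECs are
disjoint. -/
lemma mem_iff {s t : S} (hE : G.E s t) (hne : x s t ≠ 0) {U : Finset S} (hU : G.IsMWEC U) :
    s ∈ U ↔ t ∈ U := by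
  by_contra hcon
  refine hne (hT.x_supp s t hE ?_)
  rintro ⟨V, hV, hs, ht⟩
  refine hcon ⟨fun h => ?_, fun h => ?_⟩
  · rwa [hU.eq_of_mem hV h hs]
  · rwa [hU.eq_of_mem hV h ht]

open Classical in
lemma part_out {U : Finset S} (hU : G.IsMWEC U) {s : S} (hs : s ∈ U) (v : S → ℝ) :
    ∑ t, part G x U s t * v t = ∑ t with G.E s t, x s t * v t := by
  rw [Finset.sum_filter]
  refine Finset.sum_congr rfl fun t _ => ?_
  by_cases hE : G.E s t
  · rw [if_pos hE]
    by_cases hne : x s t = 0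
    · rw [part, hne, ite_self]
    · rw [part, if_pos ⟨hs, (hT.mem_iff hE hne hU).1 hs, hE⟩]
  · rw [if_neg hE, part, if_neg fun h => hE h.2.2, zero_mul]

open Classical in
lemma part_in {U : Finset S} (hU : G.IsMWEC U) {s : S} (hs : s ∈ U) :
    ∑ r, part G x U r s = ∑ r with G.E r s, x r s := by
  rw [Finset.sum_filter]
  refine Finset.sum_congr rfl fun r _ => ?_
  by_cases hE : G.E r s
  · rw [if_pos hE]
    by_cases hne : x r s = 0
    · rw [part, hne, ite_self]
    · rw [part, if_pos ⟨(hT.mem_iff hE hne hU).2 hs, hs, hE⟩]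
  · rw [if_neg hE, part, if_neg fun h => hE h.2.2]

/-- No frequency crosses the boundary of `U`, so the balance equations (C1) and (C1') restrict to
`U`. -/
lemma circulation {U : Finset S} (hU : G.IsMWEC U) : G.Circulation U (part G x U) := by
  classical
  have hout : ∀ s ∈ U, ∑ t, part G x U s t = ∑ t with G.E s t, x s t := fun s hs => by
    have := hT.part_out hU hs fun _ => 1
    simpa only [mul_one] using this
  have hz : ∀ s, s ∉ U → ∀ t, part G x U s t = 0 := fun s hs t => if_neg fun h => hs h.1
  refine ⟨fun s t => ?_, fun s t hne => ?_, fun s => ?_, fun s hs t => ?_⟩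
  · unfold part
    split_ifs with h
    · exact hT.x_nonneg s t h.2.2
    · exact le_rfl
  · by_contra h
    exact hne (if_neg h)
  · by_cases hs : s ∈ U
    · rw [hT.part_in hU hs, hT.x_flow, hout s hs]
    · rw [Finset.sum_eq_zero fun t _ => hz s hs t]
      exact Finset.sum_eq_zero fun r _ => if_neg fun h => hs h.2.1
  · by_cases hsU : s ∈ U
    · rw [hout s hsU, ← hT.x_flow]
      by_cases hE : G.E s t
      · rw [part, if_pos ⟨hsU, hU.1.1.2.2 s hsU hs t hE, hE⟩]
        exact hT.x_random s hs t hE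
      · have h3 : (G.R s hs t).toReal = 0 := by
          by_contra hne
          exact hE ((G.R_support s hs t).1 ((PMF.toReal_pos_iff _ _).1
            (lt_of_le_of_ne ENNReal.toReal_nonneg (Ne.symm hne))))
        rw [part, if_neg fun h => hE h.2.2, h3, zero_mul]
    · rw [hz s hsU, Finset.sum_eq_zero fun t _ => hz s hsU t, mul_zero]

open Classical in
lemma sum_payoff (i : Fin d) :
    ∑ U : Finset S with G.IsMWEC U, ∑ s, ∑ t, part G x U s t * G.w s t i
      = ∑ s, ∑ t with G.E s t, x s t * (G.w s t i : ℝ) := by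
  rw [← sum_isMWEC (G := G) (y := fun s => ∑ t with G.E s t, x s t * (G.w s t i : ℝ))]
  · refine Finset.sum_congr rfl fun U hU => ?_
    rw [← Finset.sum_subset (Finset.subset_univ U)]
    · exact Finset.sum_congr rfl fun s hs => hT.part_out (Finset.mem_filter.1 hU).2 hs _
    · intro s _ hs
      refine Finset.sum_eq_zero fun t _ => ?_
      rw [part, if_neg fun h => hs h.1, zero_mul]
  · intro s hs
    obtain ⟨t, ht, hne⟩ := Finset.exists_ne_zero_of_sum_ne_zero hs
    by_contra hno
    refine left_ne_zero_of_mul hne (hT.x_supp s t (Finset.mem_filter.1 ht).2 ?_)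
    rintro ⟨U, hU, hsU, -⟩
    exact hno ⟨U, hU, hsU⟩

end SolvesT

end MDP

namespace MDP

variable {S : Type*} [Fintype S] {d : ℕ} {G : MDP S d}

namespace SolvesT

variable {s₀ : S} {ν : Fin d → ℝ} {y : S → ℝ} {ye x : S → S → ℝ}

open Classical in
/-- Real moves that stay in the maximal winning end-components, with payoffs `c` inside of them that
are above the threshold in the average. -/
lemma exists_gamble (hT : G.SolvesT s₀ ν y ye x) (hG : G.IsPruned) :
    ∃ (Z : S → S → ℝ) (c : Finset S → Fin d → ℝ) (g : Finset S → Fin d → S → ℝ) (δ : ℝ), 0 < δ ∧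
      (∀ s, G.RealMove s (Z s)) ∧ (∀ s t, Z s t ≠ 0 → t ∈ G.modeOf s) ∧
      (∀ U, G.IsMWEC U → ∀ i, 0 ≤ c U i) ∧
      (∀ U, G.IsMWEC U → ∀ s ∈ U, ∀ i,
        c U i + δ + g U i s ≤ ∑ t, Z s t * (G.w s t i + g U i t)) ∧
      ∀ i, ν i < ∑ U : Finset S with G.IsMWEC U, (∑ s ∈ U, y s) * c U i := by
  choose! ζ hζ hζpos hζ1 using fun U (hU : G.IsMWEC U) => hU.1.exists_circulation
  set A : Finset S → Fin d → ℝ := fun U i => ∑ s, ∑ t, part G x U s t * G.w s t i with hA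
  set B : Finset S → Fin d → ℝ := fun U i => ∑ s, ∑ t, ζ U s t * G.w s t i with hB
  set X : Finset S → ℝ := fun U => ∑ s, ∑ t, part G x U s t with hX
  have hXy : ∀ U, G.IsMWEC U → X U = ∑ s ∈ U, y s := fun U hU => by
    rw [hT.x_y U hU]
    have := sum_part (G := G) x (fun _ _ => 1) U
    simpa only [mul_one] using this
  have hA0 : ∀ U, G.IsMWEC U → ∀ i, 0 < A U i := fun U hU i => by
    simp only [hA]
    rw [sum_part x (fun s t => (G.w s t i : ℝ)) U]
    exact hT.mp_local U hU i
  -- By (C3): without frequency in `U`, its payoff would be `0`.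
  have hX0 : ∀ U, G.IsMWEC U → 0 < X U := fun U hU => by
    have hc := hT.circulation hU
    have hrow : ∀ s ∈ Finset.univ, 0 ≤ ∑ t, part G x U s t := fun s _ =>
      Finset.sum_nonneg fun t _ => hc.nonneg s t
    refine lt_of_le_of_ne (Finset.sum_nonneg hrow) fun h => ?_
    refine (hA0 U hU ⟨0, G.one_le_dim⟩).ne' (Finset.sum_eq_zero fun s _ =>
      Finset.sum_eq_zero fun t _ => ?_)
    have h1 := (Finset.sum_eq_zero_iff_of_nonneg hrow).1 h.symm s (Finset.mem_univ s)
    rw [(Finset.sum_eq_zero_iff_of_nonneg fun t _ => hc.nonneg s t).1 h1 t (Finset.mem_univ t),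
      zero_mul]
  -- Mixing in the positive circulation `ζ U`, scaled to the mass `X U`, makes every edge of `U`
  -- used without changing the mass. The strict inequalities (C2) and (C3) survive for small `ε`.
  have hev : ∀ᶠ ε : ℝ in 𝓝[>] 0, (∀ U i, G.IsMWEC U → 0 < (1 - ε) * A U i + ε * X U * B U i) ∧
      (∀ i, ν i < ∑ U : Finset S with G.IsMWEC U, ((1 - ε) * A U i + ε * X U * B U i)) ∧
      ε < 1 ∧ 0 < ε := by
    refine ((eventually_all.2 fun U => eventually_all.2 fun i => ?_).filter_mono
      nhdsWithin_le_nhds).and (((eventually_all.2 fun i => ?_).filter_mono nhdsWithin_le_nhds).and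
        (((eventually_lt_nhds zero_lt_one).filter_mono nhdsWithin_le_nhds).and
        self_mem_nhdsWithin))
    · refine eventually_imp_distrib_left.2 fun hU => ?_
      refine ContinuousAt.eventually_lt continuousAt_const ?_ ?_
      · fun_prop
      · simpa using hA0 U hU i
    · refine ContinuousAt.eventually_lt continuousAt_const ?_ ?_
      · fun_prop
      · simp only [sub_zero, one_mul, zero_mul, add_zero]
        rw [hT.sum_payoff]
        exact hT.mp_global i
  obtain ⟨ε, hε, hεν, hε1, hε0⟩ := hev.exists
  set V : Finset S → Fin d → ℝ := fun U i => (1 - ε) * A U i + ε * X U * B U i with hV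
  have hpot : ∀ U, G.IsMWEC U → ∃ Z : S → S → ℝ, (∀ s ∈ U, G.RealMove s (Z s)) ∧
      (∀ s ∈ U, ∀ t, Z s t ≠ 0 → t ∈ U) ∧
      ∀ i, ∃ g : S → ℝ, ∀ s ∈ U, V U i / X U + g s = ∑ t, Z s t * (G.w s t i + g t) := by
    intro U hU
    have hc := (hT.circulation hU).combine (hζ U hU) (a := 1 - ε) (b := ε * X U) (by linarith)
      (mul_nonneg hε0.le (hX0 U hU).le)
    obtain ⟨Z, h1, h2, h3⟩ := hc.exists_potential hU.1 fun s hs t ht hE =>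
      add_pos_of_nonneg_of_pos (mul_nonneg (by linarith) ((hT.circulation hU).nonneg s t))
        (mul_pos (mul_pos hε0 (hX0 U hU)) (hζpos U hU s hs t ht hE))
    refine ⟨Z, h1, h2, fun i => ?_⟩
    obtain ⟨g, hg⟩ := h3 i
    refine ⟨g, fun s hs => ?_⟩
    rw [← hg s hs]
    simp only [add_mul, mul_assoc, Finset.sum_add_distrib, ← Finset.mul_sum, hζ1 U hU, hV, hA, hB]
    congr 2
    change X U = (1 - ε) * X U + _
    ring
  choose! Z hZ hZU g hg using hpot
  choose gam hgam using fun s => (hG.profitable_modeOf s).exists_succ (G.mem_modeOf s)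
  -- Outside of the MWECs any move that stays in the mode will do.
  set Z' : S → S → ℝ := fun s => if G.IsMWEC (G.modeOf s) then Z (G.modeOf s) s
    else fun t => ((gam s).dist t).toReal with hZ'
  have hZ'U : ∀ U, G.IsMWEC U → ∀ s ∈ U, Z' s = Z U s := fun U hU s hs => by
    simp only [hZ', modeOf_eq hU hs, if_pos hU]
  -- A margin `δ` of the payoff is given up. It becomes the surplus that pays for rational
  -- approximation and recovery.
  have hδ : ∀ᶠ δ : ℝ in 𝓝[>] 0, (∀ U i, G.IsMWEC U → 0 < V U i / X U - δ) ∧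
      (∀ i, ν i < ∑ U : Finset S with G.IsMWEC U, X U * (V U i / X U - δ)) ∧ 0 < δ := by
    refine ((eventually_all.2 fun U => eventually_all.2 fun i => ?_).filter_mono
      nhdsWithin_le_nhds).and (((eventually_all.2 fun i => ?_).filter_mono nhdsWithin_le_nhds).and
        self_mem_nhdsWithin)
    · refine eventually_imp_distrib_left.2 fun hU => ?_
      refine ContinuousAt.eventually_lt continuousAt_const ?_ ?_
      · fun_prop
      · rw [sub_zero]
        exact div_pos (hε U i hU) (hX0 U hU)
    · refine ContinuousAt.eventually_lt continuousAt_const ?_ ?_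
      · fun_prop
      · refine (hεν i).trans_eq (Finset.sum_congr rfl fun U hU => ?_)
        rw [sub_zero, mul_div_cancel₀ _ (hX0 U (Finset.mem_filter.1 hU).2).ne']
  obtain ⟨δ, hδc, hδν, hδ0⟩ := hδ.exists
  refine ⟨Z', fun U i => V U i / X U - δ, g, δ, hδ0, fun s => ?_, fun s t hne => ?_,
    fun U hU i => (hδc U i hU).le, fun U hU s hs i => ?_, fun i => ?_⟩
  · by_cases h : G.IsMWEC (G.modeOf s)
    · rw [hZ'U _ h s (G.mem_modeOf s)]
      exact hZ _ h s (G.mem_modeOf s)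
    · simp only [hZ', if_neg h]
      exact (gam s).realMove
  · by_cases h : G.IsMWEC (G.modeOf s)
    · rw [hZ'U _ h s (G.mem_modeOf s)] at hne
      exact hZU _ h s (G.mem_modeOf s) t hne
    · simp only [hZ', if_neg h] at hne
      exact hgam s t ((PMF.toReal_pos_iff _ _).1
        (lt_of_le_of_ne ENNReal.toReal_nonneg (Ne.symm hne)))
  · rw [hZ'U U hU s hs, ← hg U hU i s hs]
    exact le_of_eq (by ring)
  · refine (hδν i).trans_eq (Finset.sum_congr rfl fun U hU => ?_)
    rw [← hXy U (Finset.mem_filter.1 hU).2]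

/-- The room left by (C2) is spent on an error `η` in the probabilities of settling. Of the margin
`δ` in the drift, one half absorbs the rational approximation of the gamble and the other half the
recovery in long blocks. The worst case holds for every plan. -/
lemma exists_strategy (hT : G.SolvesT s₀ ν y ye x) (hG : G.IsPruned) (hs₀ : s₀ ∈ G.ctrl) :
    ∃ f : G.Strategy, f.IsFiniteMemory ∧ (0 : Fin d → ℝ) ∈ f.WCSol s₀ ∧ ν ∈ f.ExpSol s₀ := by
  classical
  obtain ⟨Z, c, g, δ, hδ, hZ, hZmode, hc0, hdrift, hν⟩ := hT.exists_gamble hG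
  have hη : ∀ᶠ η : ℝ in 𝓝[>] 0, (∀ i, ν i
      < ∑ U : Finset S with G.IsMWEC U, (∑ s ∈ U, y s - η) * c U i) ∧ 0 < η := by
    refine ((eventually_all.2 fun i => ?_).filter_mono nhdsWithin_le_nhds).and self_mem_nhdsWithin
    refine ContinuousAt.eventually_lt continuousAt_const ?_ ?_
    · fun_prop
    · simpa using hν i
  obtain ⟨η, hην, hη0⟩ := hη.exists
  obtain ⟨N, first, hlaw⟩ :=
    exists_first hs₀ hT.y_nonneg hT.ye_nonneg hT.y_flow hT.y_random hZ hη0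
  choose m hmsupp hmlim using fun s => (hZ s).exists_seq
  have hev : ∀ᶠ k in atTop, ∀ U s i, G.IsMWEC U ∧ s ∈ U → c U i + δ / 2 + g U i s
      < ∑ t, ((m s k).dist t).toReal * (G.w s t i + g U i t) := by
    refine eventually_all.2 fun U => eventually_all.2 fun s => eventually_all.2 fun i =>
      eventually_imp_distrib_left.2 fun hU => ?_
    have h1 : Tendsto (fun k => ∑ t, ((m s k).dist t).toReal * (G.w s t i + g U i t)) atTop
        (𝓝 (∑ t, Z s t * (G.w s t i + g U i t))) :=
      tendsto_finsetSum _ fun t _ => (hmlim s t).mul_const _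
    refine h1.eventually (lt_mem_nhds ?_)
    linarith [hdrift U hU.1 s hU.2 i]
  obtain ⟨k, hk⟩ := hev.exists
  have hcert := fun U (hU : G.IsMWEC U) => Plan.exists_certificate hU.1.profitable
    (fun s => m s k) (g U) (c U) (hc0 U hU) (half_pos hδ) fun s hs i => (hk U s i ⟨hU, hs⟩).le
  choose! J hJ using hcert
  set P := hG.plan N (max 1 (Finset.univ.sup J)) (le_max_left _ _) first (fun s => m s k)
    fun s t ht => hZmode s t (hmsupp s k t ht) with hP
  refine ⟨P.strategy, P.isFiniteMemory, P.zero_mem_WCSol s₀, fun i => ?_⟩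
  -- Modes that are not MWECs are valued at `0`, which their surely positive mean payoff justifies.
  have h1 := P.le_expMeanPayoff s₀ i (fun U => if G.IsMWEC U then c U i else 0) fun U => by
    by_cases hU : G.IsMWEC U
    · rw [if_pos hU]
      exact Or.inr (hJ U hU P rfl ((Finset.le_sup (Finset.mem_univ U)).trans (le_max_right _ _)) i)
    · exact Or.inl (if_neg hU)
  refine lt_of_lt_of_le ((hην i).trans_le ?_) h1
  rw [← sum_isMWEC (G := G)]
  · refine Finset.sum_le_sum fun U hU => ?_
    have hU' := (Finset.mem_filter.1 hU).2
    have h2 : ∀ t ∈ U, Plan.law P.first s₀ P.time t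
        * (if G.IsMWEC (P.mode t) then c (P.mode t) i else 0)
        = Plan.law first s₀ N t * c U i := by
      intro t ht
      have h3 : P.mode t = U := modeOf_eq hU' ht
      rw [h3, if_pos hU']
      rfl
    rw [Finset.sum_congr rfl h2, ← Finset.sum_mul]
    -- As `c U i` is non-negative, a lower bound of the probability of settling in `U` is enough.
    refine mul_le_mul_of_nonneg_right (hlaw U fun s hs t hne => ?_).le (hc0 U hU' i)
    rw [← modeOf_eq hU' hs]
    exact hZmode s t hne
  · intro t ht
    have h3 : G.IsMWEC (P.mode t) := by
      by_contra h
      exact ht (by rw [if_neg h, mul_zero])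
    exact ⟨P.mode t, h3, P.mem_mode t⟩

end SolvesT

end MDP

theorem mainTheorem7 {S : Type*} [Fintype S] {d : ℕ} (G : MDP S d) (hG : G.IsPruned)
    (s₀ : S) (hs₀ : s₀ ∈ G.ctrl)
    (hreach : ∀ U : Finset S, G.IsWEC U → ∃ s ∈ U, G.Reachable s₀ s)
    (ν : Fin d → ℝ) (hν : 0 ≤ ν) :
    (∃ h : G.Strategy, h.IsFiniteMemory ∧ ((0, ν) : (Fin d → ℝ) × (Fin d → ℝ)) ∈ h.BWCSol s₀) ↔
      ∃ (y : S → ℝ) (ye x : S → S → ℝ), G.SolvesT s₀ ν y ye x := by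
  constructor
  · rintro ⟨f, hf, hWC, hexp⟩
    exact hG.exists_solvesT hs₀ hreach hf hWC hexp
  · rintro ⟨y, ye, x, hT⟩
    obtain ⟨f, hf, hWC, hexp⟩ := hT.exists_strategy hG hs₀
    exact ⟨f, hf, hWC, hexp⟩
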